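/- Fix $d\ge 1$, $\beta,L,M,c>0$ and $x_0\in[0,1]^d$, and let $\lfloor\beta\rfloor$ be the largest integer strictly smaller than $\beta$. **Model.** For $n\ge1$ one observes $Z^{(n)}=(X_i,Y_i)_{i\le n}$, $Y_i=f(X_i)+\xi_i$, where the $X_i$ are uniform on $[0,1]^d$, $\xi_i$ has density $g_i$, and all the $X_i$ and $\xi_i$ are independent. Each $g_i$ is a symmetric probability density that is monotone on $(0,\infty)$. $\mathbb E_f$ is the expectation under the law of $Z^{(n)}$. **Hölder class.** $\mathbb H_d(\beta,L,M)$ is the set of $f:[0,1]^d\to\mathbb R$ having all partial derivatives $\partial^pf$ of order $|p|\le\lfloor\beta\rfloor$ on $[0,1]^d$, with $|\partial^pf(x)-\partial^pf(y)|\le L\|x-y\|_1^{\beta-\lfloor\beta\rfloor}$ for $|p|=\lfloor\beta\rfloor$ and $x,y\in[0,1]^d$, and $\sum_{|p|\le\lfloor\beta\rfloor}\sup_{x\in[0,1]^d}|\partial^pf(x)|\le M$. **Contrast.** $\rho:\mathbb R\to[0,\infty)$ is even, convex, differentiable, $\rho(0)=0$, and $\rho'$ is bounded and $1$-Lipschitz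 (so $\rho''$ exists almost everywhere). There are $L_\rho,\alpha>0$ with $\int|\rho''(z+u)-\rho''(z+v)|\,g_i(z)\,dz\le L_\rho|u-v|^\alpha$ for all $i$ and all $u,v\in\mathbb R$. The sequence $(g_i)_{i\ge1}$ belongs to $\mathcal G_\rho^{(c)}$, i.e. $\int\rho''g_i\ge c$ for all $i$. **Kernel.** $K:\mathbb R^d\to[0,\infty)$ is bounded and measurable, vanishes outside $[-\frac12,\frac12]^d$, and $\int K=1$. Moreover $K$ has positive integral over the set of $z$ such that $z_j\ge0$ whenever $x_{0,j}=0$ and $z_j\le0$ whenever $x_{0,j}=1$ (automatic if $x_0$ is an interior point of the cube). **Estimator.** Let $\bar h=(L^2n)^{-1/(2\beta+d)}$, $V=\{x\in[0,1]^d: |x_j-x_{0,j}|\le\bar h/2 \text{ for all } j\}$ and $f_t(x)=\sum_{|p|\le\lfloor\beta\rfloor}t_p\big(\tfrac{x-x_0}{\bar h}\big)^p\,\mathbf 1_V(x)$. Let $\hat\theta$ minimise $$\frac1{n\bar h^d}\sum_{i=1}^n\rho\big(Y_i-f_t(X_i)\big)\,K\Big(\frac{X_i-x_0}{\bar h}\Big)$$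 over $t=(t_p)_{|p|\le\lfloor\beta\rfloor}$ with $\|t\|_1\le M$. Let $\hat f_n=\hat\theta_{0,\dots,0}$; the minimiser may be chosen arbitrarily, provided $\hat f_n$ is a measurable function of $Z^{(n)}$. **Claim.** Let $\varphi_n=n^{-\beta/(2\beta+d)}$. For an estimator $\tilde f$, i.e. a measurable function of $Z^{(n)}$, put $R_{n,r}[\tilde f]=\sup_{f\in\mathbb H_d(\beta,L,M)}\mathbb E_f|\tilde f-f(x_0)|^r$. 1. For every $r\ge1$, $\limsup_{n\to\infty}\varphi_n^{-r}R_{n,r}[\hat f_n]<\infty$. 2. Suppose moreover that there are $v_0>0$ and $\kappa$ such that $\int g_i(u)\ln\frac{g_i(u)}{g_i(u+v)}\,du\le\kappa v^2$ for all $i$ and all $|v|\le v_0$. Then for every $r\ge1$ also $\liminf_{n\to\infty}\varphi_n^{-r}\inf_{\tilde f}R_{n,r}[\tilde f]>0$ (infimum over all estimators), and in particular $\liminf_{n\to\infty}\varphi_n^{-r}R_{n,r}[\hat f_n]>0$. Hence $\varphi_n$ is the minimax rate and $\hat f_n$ is asymptotically minimax. -/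

import Mathlib

open MeasureTheory Filter Set
open scoped ENNReal Topology

noncomputable section

namespace RhoLPA

/-- The unit cube `[0,1]^d`. -/
def cube (d : ℕ) : Set (Fin d → ℝ) := Icc 0 1

/-- The largest integer strictly smaller than `β` (for `β > 0`). -/
def strictFloor (β : ℝ) : ℕ := ⌈β⌉₊ - 1

/-- The set `S_b` of multi-indices `p ∈ ℕ^d` with `|p| ≤ b`. -/
def multiIndices (d b : ℕ) : Finset (Fin d → ℕ) :=
  (Fintype.piFinset fun _ => Finset.range (b + 1)).filter fun p => ∑ j, p j ≤ b

theorem mem_multiIndices {d b : ℕ} {p : Fin d → ℕ} :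
    p ∈ multiIndices d b ↔ ∑ j, p j ≤ b := by
  simp only [multiIndices, Finset.mem_filter, Fintype.mem_piFinset, Finset.mem_range,
    and_iff_right_iff_imp]
  intro h j
  have := Finset.single_le_sum (f := p) (fun _ _ => Nat.zero_le _) (Finset.mem_univ j)
  omega

/-- The multi-index `(0, …, 0)`. -/
def zeroIndex (d b : ℕ) : multiIndices d b := ⟨0, by simp [mem_multiIndices]⟩

/-! ### The isotropic Hölder class -/

/-- Partial derivative in the `j`-th coordinate of a function on `[0,1]^d` (one-sided on the
faces of the cube). -/
def partialDeriv {d : ℕ} (j : Fin d) (f : (Fin d → ℝ) → ℝ) (x : Fin d → ℝ) : ℝ :=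
  derivWithin (fun t => f (Function.update x j t)) (Icc 0 1) (x j)

/-- `∂^{|p|} f / ∂x_1^{p_1} ⋯ ∂x_d^{p_d}` on `[0,1]^d`. -/
def iterPartial {d : ℕ} (p : Fin d → ℕ) (f : (Fin d → ℝ) → ℝ) : (Fin d → ℝ) → ℝ :=
  (List.finRange d).foldr (fun j g => (partialDeriv j)^[p j] g) f

/-- The isotropic Hölder class `ℍ_d(β, L, M)`. A function on `[0,1]^d` is represented by a
function on `ℝ^d` whose values outside the cube play no role. -/
structure IsHolder (d : ℕ) (β L M : ℝ) (f : (Fin d → ℝ) → ℝ) : Prop where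
  /-- all partial derivatives up to order `⌊β⌋` exist on the cube -/
  exists_partial : ∀ p : Fin d → ℕ, ∑ j, p j < strictFloor β → ∀ j, ∀ x ∈ cube d,
    DifferentiableWithinAt ℝ (fun t => iterPartial p f (Function.update x j t)) (Icc 0 1) (x j)
  /-- those of order `⌊β⌋` are Hölder continuous for the `ℓ¹` distance -/
  holder : ∀ p : Fin d → ℕ, ∑ j, p j = strictFloor β → ∀ x ∈ cube d, ∀ y ∈ cube d,
    |iterPartial p f x - iterPartial p f y| ≤ L * (∑ j, |x j - y j|) ^ (β - strictFloor β)
  /-- the sum of the sup-norms of all partial derivatives of order at most `⌊β⌋` -/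
  bounded : ∑ p ∈ multiIndices d (strictFloor β),
    ⨆ x ∈ cube d, ENNReal.ofReal |iterPartial p f x| ≤ ENNReal.ofReal M

/-! ### The regression model -/

/-- `g` is a probability density on `ℝ`, symmetric and monotone (hence nonincreasing) on the
positive half-line. -/
structure IsNoiseDensity (g : ℝ → ℝ) : Prop where
  measurable : Measurable g
  nonneg : ∀ z, 0 ≤ g z
  lintegral_eq_one : ∫⁻ z, ENNReal.ofReal (g z) = 1
  symm : ∀ z, g (-z) = g z
  antitone : AntitoneOn g (Ioi 0)

/-- The law on `ℝ` with Lebesgue density `g`. -/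
def noiseLaw (g : ℝ → ℝ) : Measure ℝ := volume.withDensity fun z => ENNReal.ofReal (g z)

/-- Sample space of `Z^{(n)} = (X_i, Y_i)_{i ≤ n}`. -/
abbrev Sample (d n : ℕ) : Type := Fin n → (Fin d → ℝ) × ℝ

/-- The law `ℙ_f` of `Z^{(n)}`: `X_i` uniform on `[0,1]^d`, `Y_i = f(X_i) + ξ_i` with `ξ_i` of
density `g_i`, all the `X_i` and `ξ_i` independent. -/
def sampleLaw (d n : ℕ) (g : ℕ → ℝ → ℝ) (f : (Fin d → ℝ) → ℝ) : Measure (Sample d n) :=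
  Measure.pi fun i : Fin n =>
    Measure.map (fun w : (Fin d → ℝ) × ℝ => (w.1, f w.1 + w.2))
      ((volume.restrict (cube d)).prod (noiseLaw (g i)))

/-! ### Contrast functions and the classes of noise densities -/

/-- `ρ` is a contrast function (relative to the noise densities `g_i`). -/
structure IsContrast (ρ : ℝ → ℝ) (g : ℕ → ℝ → ℝ) : Prop where
  nonneg : ∀ z, 0 ≤ ρ z
  symm : ∀ z, ρ (-z) = ρ z
  convex : ConvexOn ℝ univ ρ
  map_zero : ρ 0 = 0
  differentiable : Differentiable ℝ ρ
  lipschitz_deriv : LipschitzWith 1 (deriv ρ)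
  bounded_deriv : ∃ B, ∀ z, |deriv ρ z| ≤ B
  ae_twice_differentiable : ∀ᵐ z, DifferentiableAt ℝ (deriv ρ) z
  smooth_second : ∃ Lρ : ℝ, 0 < Lρ ∧ ∃ α : ℝ, 0 < α ∧ ∀ i, ∀ u v : ℝ,
    ∫ z, |deriv (deriv ρ) (z + u) - deriv (deriv ρ) (z + v)| * g i z ≤ Lρ * |u - v| ^ α

/-- The set `𝒢_ρ^{(c)}` of sequences of noise densities. -/
def densityClass (ρ : ℝ → ℝ) (c : ℝ) : Set (ℕ → ℝ → ℝ) :=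
  {g | (∀ i, IsNoiseDensity (g i)) ∧ ∀ i, c ≤ ∫ z, deriv (deriv ρ) z * g i z}

/-- Kernel: nonnegative, bounded, supported in `[-1/2,1/2]^d`, with integral one. -/
structure IsKernel {d : ℕ} (K : (Fin d → ℝ) → ℝ) : Prop where
  measurable : Measurable K
  nonneg : ∀ z, 0 ≤ K z
  bounded : ∃ B, ∀ z, K z ≤ B
  support : Function.support K ⊆ Icc (fun _ => -(1 / 2)) (fun _ => 1 / 2)
  integral_eq_one : ∫ z, K z = 1

/-- The directions at `x₀ ∈ [0,1]^d` that point into the cube (all of `ℝ^d` if `x₀` is an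
interior point). -/
def inwardDirections {d : ℕ} (x₀ : Fin d → ℝ) : Set (Fin d → ℝ) :=
  {z | ∀ j, (x₀ j = 0 → 0 ≤ z j) ∧ (x₀ j = 1 → z j ≤ 0)}

/-! ### The `ρ`-LPA estimator -/

/-- The neighbourhood `V_{x₀}(h)`. -/
def nbhd {d : ℕ} (x₀ : Fin d → ℝ) (h : ℝ) : Set (Fin d → ℝ) :=
  Icc (fun j => x₀ j - h / 2) (fun j => x₀ j + h / 2) ∩ cube d

/-- The local polynomial `f_t`. -/
def localPoly {d b : ℕ} (x₀ : Fin d → ℝ) (h : ℝ) (t : multiIndices d b → ℝ) :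
    (Fin d → ℝ) → ℝ :=
  (nbhd x₀ h).indicator fun x => ∑ p, t p * ∏ j, ((x j - x₀ j) / h) ^ (p.1 j)

/-- The `ℓ¹` ball `Θ(M)` of coefficients. -/
def coeffBall (d b : ℕ) (M : ℝ) : Set (multiIndices d b → ℝ) := {t | ∑ p, |t p| ≤ M}

/-- The local `ρ`-criterion. -/
def criterion {d b n : ℕ} (ρ : ℝ → ℝ) (K : (Fin d → ℝ) → ℝ) (x₀ : Fin d → ℝ) (h : ℝ)
    (z : Sample d n) (t : multiIndices d b → ℝ) : ℝ :=
  1 / (n * h ^ d) *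
    ∑ i, ρ ((z i).2 - localPoly x₀ h t (z i).1) * K (fun j => ((z i).1 j - x₀ j) / h)

/-- `fhat` is a `ρ`-LPA estimator of the value at `x₀` (bandwidth `h`, degree `b`): a measurable
function of the sample that is the `(0, …, 0)` coordinate of a minimiser of the local
`ρ`-criterion over `Θ(M)`. -/
def IsLPAEstimator {d n : ℕ} (b : ℕ) (M : ℝ) (ρ : ℝ → ℝ) (K : (Fin d → ℝ) → ℝ)
    (x₀ : Fin d → ℝ) (h : ℝ) (fhat : Sample d n → ℝ) : Prop :=
  Measurable fhat ∧ ∀ z, ∃ θ ∈ coeffBall d b M,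
    (∀ t ∈ coeffBall d b M, criterion ρ K x₀ h z θ ≤ criterion ρ K x₀ h z t) ∧
    fhat z = θ (zeroIndex d b)

/-- The bandwidth `(L² n)^{-1/(2β+d)}`. -/
def bandwidth (d : ℕ) (β L : ℝ) (n : ℕ) : ℝ := (L ^ 2 * n) ^ (-(1 / (2 * β + d)))

/-- The rate `n^{-β/(2β+d)}`. -/
def rate (d : ℕ) (β : ℝ) (n : ℕ) : ℝ := (n : ℝ) ^ (-(β / (2 * β + d)))

/-! ### Risks -/

/-- Maximal risk over `ℍ_d(β, L, M)` of an estimator of `f(x₀)`. -/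
def maxRisk {d n : ℕ} (β L M : ℝ) (g : ℕ → ℝ → ℝ) (x₀ : Fin d → ℝ) (r : ℝ)
    (fhat : Sample d n → ℝ) : ℝ≥0∞ :=
  ⨆ f, ⨆ _ : IsHolder d β L M f,
    ∫⁻ z, ENNReal.ofReal (|fhat z - f x₀| ^ r) ∂(sampleLaw d n g f)

/-- Minimax risk: infimum of the maximal risk over all (measurable) estimators. -/
def minimaxRisk {d : ℕ} (n : ℕ) (β L M : ℝ) (g : ℕ → ℝ → ℝ) (x₀ : Fin d → ℝ) (r : ℝ) : ℝ≥0∞ :=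
  ⨅ fhat : Sample d n → ℝ, ⨅ _ : Measurable fhat, maxRisk β L M g x₀ r fhat

/-- `limsup ψ_n^{-r} R_{n,r}[fhat, ℍ_d(β,L,M)] < ∞`. -/
def UpperBound {d : ℕ} (β L M : ℝ) (g : ℕ → ℝ → ℝ) (x₀ : Fin d → ℝ) (r : ℝ) (ψ : ℕ → ℝ)
    (fhat : ∀ n, Sample d n → ℝ) : Prop :=
  limsup (fun n => ENNReal.ofReal (ψ n ^ (-r)) * maxRisk β L M g x₀ r (fhat n)) atTop < ∞

/-- `ψ` is the minimax rate of convergence and `fhat` is asymptotically minimax: no estimator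
improves on the rate `ψ` in order, and `fhat` attains it. -/
structure IsMinimax {d : ℕ} (β L M : ℝ) (g : ℕ → ℝ → ℝ) (x₀ : Fin d → ℝ) (r : ℝ) (ψ : ℕ → ℝ)
    (fhat : ∀ n, Sample d n → ℝ) : Prop where
  lower_minimax :
    0 < liminf (fun n => ENNReal.ofReal (ψ n ^ (-r)) * minimaxRisk n β L M g x₀ r) atTop
  lower :
    0 < liminf (fun n => ENNReal.ofReal (ψ n ^ (-r)) * maxRisk β L M g x₀ r (fhat n)) atTop
  upper : UpperBound β L M g x₀ r ψ fhat

/-- Kullback condition on the noise: for some `v₀ > 0` and `κ`, every `g_i` satisfies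
`∫ g_i(u) log (g_i(u) / g_i(u + v)) du ≤ κ v²` for `|v| ≤ v₀`. -/
def KullbackCondition (g : ℕ → ℝ → ℝ) : Prop :=
  ∃ v₀ : ℝ, 0 < v₀ ∧ ∃ κ : ℝ, ∀ i, ∀ v : ℝ, |v| ≤ v₀ →
    InformationTheory.klDiv (noiseLaw (g i)) (noiseLaw fun u => g i (u + v))
      ≤ ENNReal.ofReal (κ * v ^ 2)

end RhoLPA

end

noncomputable section

namespace RhoLPA

/-!
Upper bound. The Taylor polynomial of `f` at `x₀` is a competitor of the minimiser with bias of
order `h ^ β` on the window. The criterion is convex in the coefficients, so an estimator far from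
the competitor forces the score `ρ'` to have a small mean along some direction of the unit sphere,
already at a small distance `δ` from the competitor. The expected score however increases there at
least linearly: the condition on `ρ''` makes the mean score of the noise strictly increasing near
`0`, with a slope uniform in `i`, and a polynomial that vanishes almost everywhere on the window is
zero, so the design matrix is positive definite. As the summands are bounded, a Chernoff bound over
a finite net of directions shows that the error exceeds `δ` with probability at most
`C exp (-c n h ^ d δ ^ 2)`, and integrating this tail bounds every moment of the normalised error.

Lower bound. A smooth bump of height `a n ^ (-β / (2β + d))` at `x₀` lies in the Hölder class, and
by the chain rule for the Kullback–Leibler divergence the laws of the sample under `0` and under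
the bump are at divergence of order `a ^ 2`. Since `P A + Q Aᶜ + KL(P, Q) ≥ 1 - e⁻¹` for every
event `A`, no estimator separates the two hypotheses.
-/

/-! ### Taylor expansion in the Hölder class -/

theorem hasDerivAt_taylorSum {E : Type*} [NormedAddCommGroup E] [NormedSpace ℝ E] (a : ℕ → E)
    (m : ℕ) (s t : ℝ) :
    HasDerivAt (fun t : ℝ => ∑ k ∈ Finset.range (m + 1), ((t - s) ^ k / k.factorial) • a k)
      (∑ k ∈ Finset.range m, ((t - s) ^ k / k.factorial) • a (k + 1)) t := by
  have hsum : HasDerivAt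
      (fun t : ℝ => ∑ k ∈ Finset.range (m + 1), ((t - s) ^ k / k.factorial) • a k)
      (∑ k ∈ Finset.range (m + 1), ((k : ℝ) * (t - s) ^ (k - 1) * 1 / k.factorial) • a k) t :=
    HasDerivAt.fun_sum fun k _ =>
      ((((hasDerivAt_id t).sub_const s).pow k).div_const _).smul_const _
  rw [Finset.sum_range_succ', Nat.cast_zero, zero_mul, zero_mul, zero_div, zero_smul,
    add_zero] at hsum
  refine hsum.congr_deriv (Finset.sum_congr rfl fun k _ => ?_)
  congr 1
  rw [Nat.factorial_succ]
  push_cast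
  field_simp

theorem norm_sub_taylorSum_le {E : Type*} [NormedAddCommGroup E] [NormedSpace ℝ E] {S : Set ℝ}
    (hS : Convex ℝ S) {s : ℝ} (hs : s ∈ S) {C γ : ℝ} (hC : 0 ≤ C) (hγ : 0 ≤ γ) {m : ℕ}
    {φ : ℕ → ℝ → E} (hφ : ∀ k < m, ∀ t ∈ S, HasDerivWithinAt (φ k) (φ (k + 1) t) S t)
    (hm : ∀ t ∈ S, ‖φ m t - φ m s‖ ≤ C * |t - s| ^ γ) {t : ℝ} (ht : t ∈ S) :
    ‖φ 0 t - ∑ k ∈ Finset.range (m + 1), ((t - s) ^ k / k.factorial) • φ k s‖ ≤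
      C * |t - s| ^ ((m : ℝ) + γ) := by
  induction m generalizing φ t with
  | zero => simpa using hm t ht
  | succ m ih =>
    set R : ℝ → E := fun u =>
      φ 0 u - ∑ k ∈ Finset.range (m + 1 + 1), ((u - s) ^ k / k.factorial) • φ k s with hR
    set R' : ℝ → E := fun u =>
      φ 1 u - ∑ k ∈ Finset.range (m + 1), ((u - s) ^ k / k.factorial) • φ (k + 1) s
    have hsub : uIcc s t ⊆ S := hS.ordConnected.uIcc_subset hs ht
    have hderiv : ∀ u ∈ uIcc s t, HasDerivWithinAt R (R' u) (uIcc s t) u := fun u hu =>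
      ((hφ 0 m.succ_pos u (hsub hu)).mono hsub).sub
        (hasDerivAt_taylorSum (fun k => φ k s) (m + 1) s u).hasDerivWithinAt
    have hbound : ∀ u ∈ uIcc s t, ‖R' u‖ ≤ C * |t - s| ^ ((m : ℝ) + γ) := fun u hu => by
      have hut : |u - s| ≤ |t - s| := abs_sub_left_of_mem_uIcc hu
      refine (ih (φ := fun k => φ (k + 1)) (fun k hk => hφ (k + 1) (by lia)) hm (hsub hu)).trans ?_
      gcongr
    have hmvt := (convex_uIcc s t).norm_image_sub_le_of_norm_hasDerivWithin_le hderiv hbound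
      left_mem_uIcc right_mem_uIcc
    have hRs : R s = 0 := by simp [hR, Finset.sum_range_succ']
    rw [hRs, sub_zero, Real.norm_eq_abs] at hmvt
    rcases eq_or_ne t s with rfl | hts
    · rw [sub_self, abs_zero, mul_zero] at hmvt
      exact hmvt.trans (by positivity)
    · have hpos : 0 < |t - s| := abs_pos.2 (sub_ne_zero.2 hts)
      rwa [mul_assoc, ← Real.rpow_add_one hpos.ne', add_right_comm, ← Nat.cast_succ] at hmvt

theorem strictFloor_lt {β : ℝ} (hβ : 0 < β) : (strictFloor β : ℝ) < β := by
  have h := Nat.ceil_lt_add_one hβ.le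
  rw [strictFloor, Nat.cast_sub (Nat.ceil_pos.2 hβ)]
  push_cast
  linarith

theorem le_strictFloor_add_one (β : ℝ) : β ≤ strictFloor β + 1 := by
  refine (Nat.le_ceil β).trans ?_
  exact_mod_cast (show ⌈β⌉₊ ≤ ⌈β⌉₊ - 1 + 1 by lia)

theorem apply_mem_Icc_of_mem_cube {d : ℕ} {x : Fin d → ℝ} (hx : x ∈ cube d) (j : Fin d) :
    x j ∈ Icc (0 : ℝ) 1 :=
  ⟨hx.1 j, hx.2 j⟩

theorem update_mem_cube {d : ℕ} {x : Fin d → ℝ} (hx : x ∈ cube d) (j : Fin d) {t : ℝ}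
    (ht : t ∈ Icc (0 : ℝ) 1) : Function.update x j t ∈ cube d :=
  ⟨le_update_iff.2 ⟨ht.1, fun i _ => hx.1 i⟩, update_le_iff.2 ⟨ht.2, fun i _ => hx.2 i⟩⟩

section Partial

variable {d : ℕ}

theorem foldr_iterate_partialDeriv_update (f : (Fin d → ℝ) → ℝ) (j : Fin d) (p : Fin d → ℕ)
    (hp : ∀ i < j, p i = 0) :
    ∀ l : List (Fin d), l.Pairwise (· < ·) → j ∈ l →
      l.foldr (fun i g => (partialDeriv i)^[Function.update p j (p j + 1) i] g) f =
        partialDeriv j (l.foldr (fun i g => (partialDeriv i)^[p i] g) f)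
  | [], _, h => by simp at h
  | a :: l, hl, h => by
    rw [List.pairwise_cons] at hl
    rcases eq_or_ne a j with rfl | haj
    · have hrest : l.foldr (fun i g => (partialDeriv i)^[Function.update p a (p a + 1) i] g) f =
          l.foldr (fun i g => (partialDeriv i)^[p i] g) f :=
        List.foldr_ext _ _ f fun b hb _ => by rw [Function.update_of_ne (hl.1 b hb).ne']
      simp only [List.foldr_cons, hrest, Function.update_self, Function.iterate_succ_apply']
    · have hj : j ∈ l := by simpa [haj.symm] using h
      have ha : p a = 0 := hp a (hl.1 j hj)
      simp only [List.foldr_cons, Function.update_of_ne haj, ha, Function.iterate_zero, id]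
      exact foldr_iterate_partialDeriv_update f j p hp l hl.2 hj

theorem iterPartial_update_succ (f : (Fin d → ℝ) → ℝ) (j : Fin d) (p : Fin d → ℕ)
    (hp : ∀ i < j, p i = 0) :
    iterPartial (Function.update p j (p j + 1)) f = partialDeriv j (iterPartial p f) :=
  foldr_iterate_partialDeriv_update f j p hp _ (List.pairwise_lt_finRange d)
    (List.mem_finRange j)

theorem iterPartial_zero (f : (Fin d → ℝ) → ℝ) : iterPartial 0 f = f := by
  unfold iterPartial
  induction List.finRange d with
  | nil => rfl
  | cons a l _ => simp

/-- The normalised monomial `w^p / p!` of the multivariate Taylor expansion. -/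
def taylorMonomial (p : Fin d → ℕ) (w : Fin d → ℝ) : ℝ :=
  ∏ j, w j ^ p j / (p j).factorial

theorem continuous_taylorMonomial (p : Fin d → ℕ) : Continuous (taylorMonomial p) := by
  unfold taylorMonomial
  fun_prop

theorem sum_update_of_eq_zero {q : Fin d → ℕ} {j : Fin d} (hq : q j = 0) (k : ℕ) :
    ∑ i, Function.update q j k i = k + ∑ i, q i := by
  rw [Finset.sum_update_of_mem (Finset.mem_univ j), Finset.sdiff_singleton_eq_erase,
    ← Finset.add_sum_erase _ q (Finset.mem_univ j), hq, zero_add]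

theorem taylorMonomial_update {q : Fin d → ℕ} {j : Fin d} (hq : q j = 0) (k : ℕ)
    (w : Fin d → ℝ) :
    taylorMonomial (Function.update q j k) w = w j ^ k / k.factorial * taylorMonomial q w := by
  unfold taylorMonomial
  rw [← Finset.mul_prod_erase _ _ (Finset.mem_univ j),
    ← Finset.mul_prod_erase _ (fun i => w i ^ q i / (q i).factorial) (Finset.mem_univ j)]
  simp only [Function.update_self, hq, pow_zero, Nat.factorial_zero, Nat.cast_one, div_one, one_mul]
  congr 1
  refine Finset.prod_congr rfl fun i hi => ?_
  rw [Function.update_of_ne (Finset.ne_of_mem_erase hi)]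

theorem abs_taylorMonomial_le (p : Fin d → ℕ) (w : Fin d → ℝ) :
    |taylorMonomial p w| ≤ ‖w‖ ^ ∑ j, p j := by
  unfold taylorMonomial
  rw [Finset.abs_prod, ← Finset.prod_pow_eq_pow_sum]
  refine Finset.prod_le_prod (fun _ _ => abs_nonneg _) fun j _ => ?_
  rw [abs_div, abs_pow, Nat.abs_cast]
  refine (div_le_self (by positivity) (by exact_mod_cast Nat.factorial_pos _)).trans ?_
  exact pow_le_pow_left₀ (abs_nonneg _) (norm_le_pi_norm w j) _

/-- The multi-indices of order at most `b` that vanish in the coordinates below `j`. -/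
def tailIndices (d b j : ℕ) : Finset (Fin d → ℕ) :=
  (multiIndices d b).filter fun p => ∀ i : Fin d, i.1 < j → p i = 0

theorem mem_tailIndices {b j : ℕ} {p : Fin d → ℕ} :
    p ∈ tailIndices d b j ↔ ∑ i, p i ≤ b ∧ ∀ i : Fin d, i.1 < j → p i = 0 := by
  simp [tailIndices, mem_multiIndices]

theorem tailIndices_zero (d b : ℕ) : tailIndices d b 0 = multiIndices d b := by
  ext p
  simp [tailIndices]

theorem tailIndices_self (d b : ℕ) : tailIndices d b d = {0} := by
  ext p
  rw [mem_tailIndices, Finset.mem_singleton]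
  constructor
  · rintro ⟨-, h⟩
    exact funext fun i => h i i.2
  · rintro rfl
    simp

theorem sum_tailIndices_succ {A : Type*} [AddCommMonoid A] {b : ℕ} (j : Fin d)
    (F : (Fin d → ℕ) → A) :
    ∑ p ∈ tailIndices d b j, F p =
      ∑ q ∈ tailIndices d b (j + 1), ∑ k ∈ Finset.range (b - ∑ i, q i + 1),
        F (Function.update q j k) := by
  rw [Finset.sum_sigma']
  have hzero : ∀ q ∈ tailIndices d b (j + 1), q j = 0 := fun q hq =>
    (mem_tailIndices.1 hq).2 j (Nat.lt_succ_self _)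
  refine Finset.sum_bij' (fun p _ => ⟨Function.update p j 0, p j⟩)
    (fun s _ => Function.update s.1 j s.2) (fun p hp => ?_) (fun s hs => ?_) (by simp)
    (fun s hs => ?_) (by simp)
  · have hsum := sum_update_of_eq_zero (q := Function.update p j 0) (j := j) (by simp) (p j)
    simp only [Function.update_idem, Function.update_eq_self] at hsum
    obtain ⟨hpb, hp⟩ := mem_tailIndices.1 hp
    simp only [Finset.mem_sigma, mem_tailIndices, Finset.mem_range]
    refine ⟨⟨by lia, fun i hi => ?_⟩, by lia⟩
    rcases eq_or_ne i j with rfl | hij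
    · simp
    · rw [Function.update_of_ne hij]
      exact hp i (by have := Fin.val_ne_of_ne hij; lia)
  · simp only [Finset.mem_sigma, Finset.mem_range] at hs
    have hsj := hzero _ hs.1
    rw [mem_tailIndices] at hs ⊢
    rw [sum_update_of_eq_zero hsj]
    refine ⟨by lia, fun i hi => ?_⟩
    rw [Function.update_of_ne (by rintro rfl; lia)]
    exact hs.1.2 i (by lia)
  · have hsj := hzero _ (Finset.mem_sigma.1 hs).1
    simp only [Function.update_idem, Function.update_self, ← hsj, Function.update_eq_self]

/-- The point whose coordinates are those of `x` below `j` and those of `y` from `j` on: a step on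
the path from `y` to `x` that moves one coordinate at a time. -/
def mixPoint (x y : Fin d → ℝ) (j : ℕ) : Fin d → ℝ := fun i => if i.1 < j then x i else y i

theorem mixPoint_zero (x y : Fin d → ℝ) : mixPoint x y 0 = y := by
  ext i
  simp [mixPoint]

theorem mixPoint_self (x y : Fin d → ℝ) : mixPoint x y d = x := by
  ext i
  simp [mixPoint]

theorem mixPoint_apply_self (x y : Fin d → ℝ) (j : Fin d) : mixPoint x y j j = y j := by
  simp [mixPoint]

theorem mixPoint_succ (x y : Fin d → ℝ) (j : Fin d) :
    mixPoint x y (j + 1) = Function.update (mixPoint x y j) j (x j) := by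
  ext i
  rcases eq_or_ne i j with rfl | hij
  · simp [mixPoint]
  · have hlt : i.1 < j + 1 ↔ i.1 < j := by have := Fin.val_ne_of_ne hij; lia
    simp [mixPoint, hlt, hij]

theorem mixPoint_mem_cube {x y : Fin d → ℝ} (hx : x ∈ cube d) (hy : y ∈ cube d) (j : ℕ) :
    mixPoint x y j ∈ cube d := by
  constructor <;> intro i <;> unfold mixPoint <;> split_ifs
  exacts [hx.1 i, hy.1 i, hx.2 i, hy.2 i]

end Partial

namespace IsHolder

variable {d : ℕ} {β L M : ℝ} {f : (Fin d → ℝ) → ℝ} {x y : Fin d → ℝ}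

theorem hasDerivWithinAt_iterPartial (hf : IsHolder d β L M f) (hx : x ∈ cube d) {j : Fin d}
    {p : Fin d → ℕ} (hp : ∀ i < j, p i = 0) (hpβ : ∑ i, p i < strictFloor β) {t : ℝ}
    (ht : t ∈ Icc (0 : ℝ) 1) :
    HasDerivWithinAt (fun t => iterPartial p f (Function.update x j t))
      (iterPartial (Function.update p j (p j + 1)) f (Function.update x j t)) (Icc 0 1) t := by
  have hdiff := hf.exists_partial p hpβ j _ (update_mem_cube hx j ht)
  simp only [Function.update_idem, Function.update_self] at hdiff
  simpa only [iterPartial_update_succ f j p hp, partialDeriv, Function.update_idem,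
    Function.update_self] using hdiff.hasDerivWithinAt

theorem abs_iterPartial_update_sub_le (hf : IsHolder d β L M f) (hx : x ∈ cube d) (j : Fin d)
    {p : Fin d → ℕ} (hp : ∑ i, p i = strictFloor β) {s t : ℝ} (hs : s ∈ Icc (0 : ℝ) 1)
    (ht : t ∈ Icc (0 : ℝ) 1) :
    |iterPartial p f (Function.update x j t) - iterPartial p f (Function.update x j s)| ≤
      L * |t - s| ^ (β - strictFloor β) := by
  have h := hf.holder p hp _ (update_mem_cube hx j ht) _ (update_mem_cube hx j hs)
  rwa [Finset.sum_eq_single j (fun i _ hi => by simp [hi]) (by simp), Function.update_self,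
    Function.update_self] at h

theorem abs_iterPartial_update_sub_taylorSum_le (hβ : 0 < β) (hL : 0 ≤ L)
    (hf : IsHolder d β L M f) (hx : x ∈ cube d) {j : Fin d} {q : Fin d → ℕ}
    (hq : q ∈ tailIndices d (strictFloor β) (j + 1)) {t : ℝ} (ht : t ∈ Icc (0 : ℝ) 1) :
    |iterPartial q f (Function.update x j t) -
        ∑ k ∈ Finset.range (strictFloor β - ∑ i, q i + 1),
          (t - x j) ^ k / k.factorial * iterPartial (Function.update q j k) f x| ≤
      L * |t - x j| ^ (β - ∑ i, q i) := by
  obtain ⟨hqβ, hq0⟩ := mem_tailIndices.1 hq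
  have hqj : q j = 0 := hq0 j (Nat.lt_succ_self _)
  have hexp : β - ((∑ i, q i : ℕ) : ℝ) =
      ((strictFloor β - ∑ i, q i : ℕ) : ℝ) + (β - strictFloor β) := by
    rw [Nat.cast_sub hqβ]
    ring
  have h := norm_sub_taylorSum_le (convex_Icc 0 1) (apply_mem_Icc_of_mem_cube hx j) hL
    (sub_nonneg.2 (strictFloor_lt hβ).le) (m := strictFloor β - ∑ i, q i)
    (φ := fun k t => iterPartial (Function.update q j k) f (Function.update x j t))
    (fun k hk t ht => ?_) (fun t ht => ?_) ht
  · have hq_update : Function.update q j 0 = q := by rw [← hqj, Function.update_eq_self]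
    simpa only [Real.norm_eq_abs, smul_eq_mul, Function.update_eq_self, hq_update, hexp] using h
  · have hlow : ∀ i < j, Function.update q j k i = 0 := fun i hi => by
      rw [Function.update_of_ne hi.ne]
      exact hq0 i (Nat.lt_succ_of_lt hi)
    simpa using hf.hasDerivWithinAt_iterPartial hx hlow
      (by rw [sum_update_of_eq_zero hqj]; lia) ht
  · exact hf.abs_iterPartial_update_sub_le hx j (by rw [sum_update_of_eq_zero hqj]; lia)
      (apply_mem_Icc_of_mem_cube hx j) ht

theorem abs_iterPartial_mul_taylorMonomial_sub_le (hβ : 0 < β) (hL : 0 ≤ L)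
    (hf : IsHolder d β L M f) (hx : x ∈ cube d) {j : Fin d} {q : Fin d → ℕ}
    (hq : q ∈ tailIndices d (strictFloor β) (j + 1)) {t : ℝ} (ht : t ∈ Icc (0 : ℝ) 1)
    {w : Fin d → ℝ} (hw : w j = t - x j) :
    |iterPartial q f (Function.update x j t) * taylorMonomial q w -
        ∑ k ∈ Finset.range (strictFloor β - ∑ i, q i + 1),
          iterPartial (Function.update q j k) f x * taylorMonomial (Function.update q j k) w| ≤
      L * ‖w‖ ^ β := by
  obtain ⟨hqβ, hq0⟩ := mem_tailIndices.1 hq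
  have hqβ' : ((∑ i, q i : ℕ) : ℝ) ≤ β := (Nat.cast_le.2 hqβ).trans (strictFloor_lt hβ).le
  have hfactor : ∀ k, iterPartial (Function.update q j k) f x *
      taylorMonomial (Function.update q j k) w =
      (t - x j) ^ k / k.factorial * iterPartial (Function.update q j k) f x *
        taylorMonomial q w := fun k => by
    rw [taylorMonomial_update (hq0 j (Nat.lt_succ_self _)), hw]
    ring
  simp only [hfactor]
  rw [← Finset.sum_mul, ← sub_mul, abs_mul]
  calc _ ≤ L * |t - x j| ^ (β - ((∑ i, q i : ℕ) : ℝ)) * ‖w‖ ^ ∑ i, q i :=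
        mul_le_mul (hf.abs_iterPartial_update_sub_taylorSum_le hβ hL hx hq ht)
          (abs_taylorMonomial_le _ _) (abs_nonneg _) (by positivity)
    _ ≤ L * ‖w‖ ^ (β - ((∑ i, q i : ℕ) : ℝ)) * ‖w‖ ^ ∑ i, q i := by
        rw [← hw]
        gcongr
        exact norm_le_pi_norm w j
    _ = L * ‖w‖ ^ β := by
        rw [mul_assoc, ← Real.rpow_natCast, ← Real.rpow_add_of_nonneg (norm_nonneg _)
          (sub_nonneg.2 hqβ') (Nat.cast_nonneg _), sub_add_cancel]

theorem abs_sum_tailIndices_succ_sub_le (hβ : 0 < β) (hL : 0 ≤ L) (hf : IsHolder d β L M f)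
    (hx : x ∈ cube d) (hy : y ∈ cube d) (j : Fin d) :
    |∑ p ∈ tailIndices d (strictFloor β) (j + 1),
        iterPartial p f (mixPoint x y (j + 1)) * taylorMonomial p (x - y) -
      ∑ p ∈ tailIndices d (strictFloor β) j,
        iterPartial p f (mixPoint x y j) * taylorMonomial p (x - y)| ≤
      (multiIndices d (strictFloor β)).card * (L * ‖x - y‖ ^ β) := by
  rw [sum_tailIndices_succ j, ← Finset.sum_sub_distrib]
  refine (Finset.abs_sum_le_sum_abs _ _).trans
    ((Finset.sum_le_card_nsmul _ _ (L * ‖x - y‖ ^ β) fun q hq => ?_).trans ?_)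
  · rw [mixPoint_succ]
    exact hf.abs_iterPartial_mul_taylorMonomial_sub_le hβ hL (mixPoint_mem_cube hx hy j) hq
      (apply_mem_Icc_of_mem_cube hx j) (by rw [mixPoint_apply_self, Pi.sub_apply])
  · rw [nsmul_eq_mul]
    gcongr
    exact Finset.filter_subset _ _

/-- The point moves from `y` to `x` one coordinate at a time, and along each coordinate the partial
derivatives not yet used up are expanded by the one-dimensional formula. -/
theorem abs_sub_taylor_le (hβ : 0 < β) (hL : 0 ≤ L) (hf : IsHolder d β L M f) (hx : x ∈ cube d)
    (hy : y ∈ cube d) :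
    |f x - ∑ p ∈ multiIndices d (strictFloor β), iterPartial p f y * taylorMonomial p (x - y)| ≤
      d * ((multiIndices d (strictFloor β)).card * (L * ‖x - y‖ ^ β)) := by
  set S : ℕ → ℝ := fun j => ∑ p ∈ tailIndices d (strictFloor β) j,
    iterPartial p f (mixPoint x y j) * taylorMonomial p (x - y) with hS
  have h0 : S 0 = ∑ p ∈ multiIndices d (strictFloor β),
      iterPartial p f y * taylorMonomial p (x - y) := by
    simp only [hS, tailIndices_zero, mixPoint_zero]
  have hd : S d = f x := by
    simp [hS, tailIndices_self, mixPoint_self, iterPartial_zero, taylorMonomial]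
  rw [← h0, ← hd, ← Finset.sum_range_sub]
  refine (Finset.abs_sum_le_sum_abs _ _).trans ((Finset.sum_le_card_nsmul _ _ _ fun j hj =>
    hf.abs_sum_tailIndices_succ_sub_le hβ hL hx hy ⟨j, Finset.mem_range.1 hj⟩).trans_eq ?_)
  rw [Finset.card_range, nsmul_eq_mul]

protected theorem continuousOn (hβ : 0 < β) (hL : 0 ≤ L) (hf : IsHolder d β L M f) :
    ContinuousOn f (cube d) := by
  intro y hy
  set T : (Fin d → ℝ) → ℝ := fun x => ∑ p ∈ multiIndices d (strictFloor β),
    iterPartial p f y * taylorMonomial p (x - y)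
  set B : (Fin d → ℝ) → ℝ := fun x =>
    d * ((multiIndices d (strictFloor β)).card * (L * ‖x - y‖ ^ β))
  have hT : Continuous T := continuous_finsetSum _ fun p _ =>
    continuous_const.mul ((continuous_taylorMonomial p).comp (continuous_id.sub continuous_const))
  have hB : Continuous B := by
    have : Continuous fun x : Fin d → ℝ => ‖x - y‖ ^ β :=
      (continuous_id.sub continuous_const).norm.rpow_const fun _ => Or.inr hβ.le
    fun_prop
  have hBy : B y = 0 := by simp [B, Real.zero_rpow hβ.ne']
  have hTy : T y = f y := by
    have h : |f y - T y| ≤ B y := hf.abs_sub_taylor_le hβ hL hy hy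
    rw [hBy, abs_nonpos_iff, sub_eq_zero] at h
    exact h.symm
  have hfT : Tendsto (fun x => f x - T x) (𝓝[cube d] y) (𝓝 0) :=
    squeeze_zero_norm' (eventually_nhdsWithin_of_forall fun x hx =>
      hf.abs_sub_taylor_le hβ hL hx hy) (hBy ▸ hB.continuousWithinAt (s := cube d))
  simpa [ContinuousWithinAt, hTy] using hfT.add (hT.continuousWithinAt (s := cube d) (x := y))

theorem sum_abs_iterPartial_le (hM : 0 ≤ M) (hf : IsHolder d β L M f) (hx : x ∈ cube d) :
    ∑ p ∈ multiIndices d (strictFloor β), |iterPartial p f x| ≤ M := by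
  rw [← ENNReal.ofReal_le_ofReal_iff hM, ENNReal.ofReal_sum_of_nonneg fun _ _ => abs_nonneg _]
  refine (Finset.sum_le_sum fun p _ => ?_).trans hf.bounded
  exact le_iSup₂ (f := fun y (_ : y ∈ cube d) => ENNReal.ofReal |iterPartial p f y|) x hx

end IsHolder

/-! ### The mean score of a noise law -/

/-- The expected score `𝔼 ψ(ξ + v)` of a residual whose noise `ξ` has law `ν` and whose
deterministic part is `v`; in the application `ψ = ρ'`. -/
def meanScore (ψ : ℝ → ℝ) (ν : Measure ℝ) (v : ℝ) : ℝ := ∫ z, ψ (z + v) ∂ν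

section MeanScore

variable {ψ : ℝ → ℝ} {ν : Measure ℝ} {B : ℝ}

theorem integrable_comp_add_of_bounded [IsFiniteMeasure ν] (hψ : Measurable ψ)
    (hB : ∀ z, |ψ z| ≤ B) (v : ℝ) : Integrable (fun z => ψ (z + v)) ν :=
  Integrable.of_bound (hψ.comp (measurable_id.add_const v)).aestronglyMeasurable B
    (ae_of_all _ fun _ => hB _)

theorem meanScore_zero_of_odd [ν.IsNegInvariant] (hodd : ∀ z, ψ (-z) = -ψ z) :
    meanScore ψ ν 0 = 0 := by
  have h := integral_neg_eq_self ψ ν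
  simp only [hodd, integral_neg] at h
  simp only [meanScore, add_zero]
  linarith

variable [IsProbabilityMeasure ν]

theorem abs_meanScore_sub_le (hψ : LipschitzWith 1 ψ) (hB : ∀ z, |ψ z| ≤ B) (v w : ℝ) :
    |meanScore ψ ν v - meanScore ψ ν w| ≤ |v - w| := by
  have hint := integrable_comp_add_of_bounded (ν := ν) hψ.continuous.measurable hB
  rw [meanScore, meanScore, ← integral_sub (hint v) (hint w)]
  have hle : ∀ z, ‖ψ (z + v) - ψ (z + w)‖ ≤ |v - w| := fun z => by
    simpa [Real.dist_eq] using hψ.dist_le_mul (z + v) (z + w)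
  simpa using norm_integral_le_of_norm_le_const (μ := ν) (ae_of_all _ hle)

theorem hasDerivAt_meanScore (hν : ν ≪ volume) (hψ : LipschitzWith 1 ψ)
    (hB : ∀ z, |ψ z| ≤ B) (v : ℝ) :
    HasDerivAt (meanScore ψ ν) (∫ z, deriv ψ (z + v) ∂ν) v := by
  have hmeas : Measurable ψ := hψ.continuous.measurable
  have hdiff : ∀ᵐ z ∂ν, DifferentiableAt ℝ ψ (z + v) :=
    hν.ae_le <| (measurePreserving_add_right volume v).quasiMeasurePreserving.ae
      hψ.ae_differentiableAt_real
  refine (hasDerivAt_integral_of_dominated_loc_of_lip (μ := ν) (s := univ)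
    (bound := fun _ => 1) (F := fun v z => ψ (z + v)) univ_mem
    (Eventually.of_forall fun w =>
      (integrable_comp_add_of_bounded hmeas hB w).aestronglyMeasurable)
    (integrable_comp_add_of_bounded hmeas hB v)
    ((measurable_deriv _).comp (measurable_id.add_const v)).aestronglyMeasurable
    (ae_of_all _ fun z => ?_) (integrable_const _) ?_).2
  · refine LipschitzOnWith.of_dist_le_mul fun x _ y _ => ?_
    simpa [Real.dist_eq] using hψ.dist_le_mul (z + x) (z + y)
  · filter_upwards [hdiff] with z hz
    simpa using HasDerivAt.comp_const_add z v hz.hasDerivAt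

end MeanScore

theorem mul_sq_le_of_hasDerivAt_ge {F F' : ℝ → ℝ} (hF : ∀ x, HasDerivAt F (F' x) x) {γ r : ℝ}
    (hγ : ∀ x, |x| ≤ r → γ ≤ F' x) {v w : ℝ} (hv : |v| ≤ r) (hw : |w| ≤ r) :
    γ * (w - v) ^ 2 ≤ (F w - F v) * (w - v) := by
  wlog hvw : v ≤ w generalizing v w
  · linarith [this hw hv (le_of_not_ge hvw)]
  have h : γ * (w - v) ≤ F w - F v := by
    refine (convex_Icc (-r) r).mul_sub_le_image_sub_of_le_deriv
      (fun x _ => (hF x).continuousAt.continuousWithinAt)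
      (fun x _ => (hF x).differentiableAt.differentiableWithinAt)
      (fun x hx => ?_) v (abs_le.1 hv) w (abs_le.1 hw) hvw
    rw [(hF x).deriv]
    exact hγ x (abs_le.2 (mem_Icc.1 (interior_subset hx)))
  nlinarith

/-- The noise laws for which the score `ψ` identifies the centre: the mean score vanishes at `0`
and is strongly monotone, with modulus `γ`, on `[-r, r]`. -/
structure IsIdentifiedBy (ψ : ℝ → ℝ) (γ r : ℝ) (ν : Measure ℝ) : Prop where
  isProbabilityMeasure : IsProbabilityMeasure ν
  meanScore_zero : meanScore ψ ν 0 = 0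
  mul_sq_le : ∀ {v w : ℝ}, |v| ≤ r → |w| ≤ r →
    γ * (w - v) ^ 2 ≤ (meanScore ψ ν w - meanScore ψ ν v) * (w - v)

theorem IsIdentifiedBy.abs_meanScore_le {ψ : ℝ → ℝ} {γ r B : ℝ} {ν : Measure ℝ}
    (hν : IsIdentifiedBy ψ γ r ν) (hψ : LipschitzWith 1 ψ) (hB : ∀ z, |ψ z| ≤ B) (v : ℝ) :
    |meanScore ψ ν v| ≤ |v| := by
  have := hν.isProbabilityMeasure
  simpa [hν.meanScore_zero] using abs_meanScore_sub_le (ν := ν) hψ hB v 0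

theorem noiseLaw_absolutelyContinuous (g : ℝ → ℝ) : noiseLaw g ≪ volume :=
  withDensity_absolutelyContinuous _ _

namespace IsNoiseDensity

variable {g : ℝ → ℝ}

theorem isProbabilityMeasure (hg : IsNoiseDensity g) : IsProbabilityMeasure (noiseLaw g) :=
  ⟨by rw [noiseLaw, withDensity_apply _ MeasurableSet.univ, Measure.restrict_univ,
    hg.lintegral_eq_one]⟩

theorem integral_noiseLaw (hg : IsNoiseDensity g) (F : ℝ → ℝ) :
    ∫ z, F z ∂noiseLaw g = ∫ z, F z * g z := by
  rw [noiseLaw, integral_withDensity_eq_integral_toReal_smul hg.measurable.ennreal_ofReal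
    (ae_of_all _ fun _ => ENNReal.ofReal_lt_top)]
  refine integral_congr_ae (ae_of_all _ fun z => ?_)
  simp only [ENNReal.toReal_ofReal (hg.nonneg z), smul_eq_mul, mul_comm]

theorem isNegInvariant (hg : IsNoiseDensity g) : (noiseLaw g).IsNegInvariant := by
  refine ⟨Measure.ext fun s hs => ?_⟩
  have h := (Measure.measurePreserving_neg (volume : Measure ℝ)).setLIntegral_comp_preimage hs
    hg.measurable.ennreal_ofReal
  simpa only [hg.symm, neg_preimage, noiseLaw, withDensity_apply _ hs, Measure.neg_apply,
    withDensity_apply _ hs.neg] using h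

end IsNoiseDensity

namespace IsContrast

variable {ρ : ℝ → ℝ} {g : ℕ → ℝ → ℝ}

theorem deriv_neg (hρ : IsContrast ρ g) (z : ℝ) : deriv ρ (-z) = -deriv ρ z := by
  have h := deriv_comp_neg ρ z
  rw [funext hρ.symm] at h
  linarith

theorem abs_deriv_deriv_le (hρ : IsContrast ρ g) (z : ℝ) : |deriv (deriv ρ) z| ≤ 1 := by
  simpa using norm_deriv_le_of_lipschitz hρ.lipschitz_deriv (x₀ := z)

theorem sub_le_integral_deriv_deriv (hρ : IsContrast ρ g) {c Lρ α : ℝ} {i : ℕ}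
    (hgi : IsNoiseDensity (g i)) (hci : c ≤ ∫ z, deriv (deriv ρ) z * g i z)
    (hsmooth : ∀ u v : ℝ, ∫ z, |deriv (deriv ρ) (z + u) - deriv (deriv ρ) (z + v)| * g i z ≤
      Lρ * |u - v| ^ α) (v : ℝ) :
    c - Lρ * |v| ^ α ≤ ∫ z, deriv (deriv ρ) (z + v) ∂noiseLaw (g i) := by
  have := hgi.isProbabilityMeasure
  have hint := integrable_comp_add_of_bounded (ν := noiseLaw (g i)) (measurable_deriv (deriv ρ))
    hρ.abs_deriv_deriv_le
  have hle : |∫ z, deriv (deriv ρ) (z + v) ∂noiseLaw (g i) -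
      ∫ z, deriv (deriv ρ) (z + 0) ∂noiseLaw (g i)| ≤ Lρ * |v - 0| ^ α := by
    rw [← integral_sub (hint v) (hint 0)]
    refine (abs_integral_le_integral_abs).trans ?_
    rw [hgi.integral_noiseLaw]
    exact hsmooth v 0
  rw [← hgi.integral_noiseLaw] at hci
  simp only [add_zero, sub_zero] at hle
  linarith [(abs_le.1 hle).1]

theorem exists_isIdentifiedBy (hρ : IsContrast ρ g) {c : ℝ} (hc : 0 < c)
    (hg : g ∈ densityClass ρ c) :
    ∃ r : ℝ, 0 < r ∧ ∀ i, IsIdentifiedBy (deriv ρ) (c / 2) r (noiseLaw (g i)) := by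
  obtain ⟨Lρ, hLρ, α, hα, hsmooth⟩ := hρ.smooth_second
  obtain ⟨B, hB⟩ := hρ.bounded_deriv
  refine ⟨(c / (2 * Lρ)) ^ (1 / α), by positivity, fun i => ?_⟩
  have hprob := (hg.1 i).isProbabilityMeasure
  have := (hg.1 i).isNegInvariant
  have hr : Lρ * ((c / (2 * Lρ)) ^ (1 / α)) ^ α = c / 2 := by
    rw [← Real.rpow_mul (by positivity), one_div_mul_cancel hα.ne', Real.rpow_one]
    field_simp
  refine ⟨hprob, meanScore_zero_of_odd hρ.deriv_neg, mul_sq_le_of_hasDerivAt_ge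
    (hasDerivAt_meanScore (noiseLaw_absolutelyContinuous _) hρ.lipschitz_deriv hB)
    fun v hv => ?_⟩
  have hv' : Lρ * |v| ^ α ≤ Lρ * ((c / (2 * Lρ)) ^ (1 / α)) ^ α := by gcongr
  linarith [hρ.sub_le_integral_deriv_deriv (hg.1 i) (hg.2 i) (hsmooth i) v]

end IsContrast

/-! ### A Chernoff bound -/

section Chernoff

open ProbabilityTheory

variable {Ω : Type*} [MeasurableSpace Ω] {μ : Measure Ω} [IsProbabilityMeasure μ] {B S m : ℝ}

theorem integrable_exp_mul_of_bounded {Z : Ω → ℝ} (hZ : Measurable Z) (hB : ∀ ω, |Z ω| ≤ B)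
    (t : ℝ) : Integrable (fun ω => Real.exp (t * Z ω)) μ :=
  integrable_exp_mul_of_mem_Icc hZ.aemeasurable (ae_of_all _ fun ω => abs_le.1 (hB ω))

theorem mgf_neg_le {Z : Ω → ℝ} (hZ : Measurable Z) (hB : ∀ ω, |Z ω| ≤ B)
    (hS : ∫ ω, |Z ω| ∂μ ≤ S) (hm : m ≤ ∫ ω, Z ω ∂μ) {l : ℝ} (hl : 0 ≤ l) (hlB : l * B ≤ 1) :
    mgf Z μ (-l) ≤ Real.exp (-(l * m - l ^ 2 * B * S)) := by
  have hint : Integrable Z μ := Integrable.of_bound hZ.aestronglyMeasurable B (ae_of_all _ hB)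
  have hexp : ∀ ω, Real.exp (-l * Z ω) ≤ 1 - l * Z ω + l ^ 2 * B * |Z ω| := fun ω => by
    have hle : |-l * Z ω| ≤ 1 := by
      rw [abs_mul, abs_neg, abs_of_nonneg hl]
      exact (mul_le_mul_of_nonneg_left (hB ω) hl).trans hlB
    have hsq : (-l * Z ω) ^ 2 ≤ l ^ 2 * B * |Z ω| := by
      rw [mul_pow, neg_sq, mul_assoc, ← sq_abs (Z ω), sq |Z ω|]
      have := hB ω
      gcongr
    linarith [(abs_le.1 (Real.abs_exp_sub_one_sub_id_le hle)).2]
  have hB0 : 0 ≤ B := (abs_nonneg _).trans (hB μ.nonempty_of_neZero.some)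
  calc mgf Z μ (-l) ≤ ∫ ω, (1 - l * Z ω + l ^ 2 * B * |Z ω|) ∂μ :=
        integral_mono (integrable_exp_mul_of_bounded hZ hB _)
          (((integrable_const _).sub (hint.const_mul l)).add (hint.abs.const_mul _)) hexp
    _ = 1 - l * ∫ ω, Z ω ∂μ + l ^ 2 * B * ∫ ω, |Z ω| ∂μ := by
        have hlin : Integrable (fun ω => 1 - l * Z ω) μ :=
          (integrable_const _).sub (hint.const_mul l)
        rw [integral_add hlin (hint.abs.const_mul _),
          integral_sub (integrable_const _) (hint.const_mul l), integral_const_mul,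
          integral_const_mul]
        simp
    _ ≤ 1 - l * m + l ^ 2 * B * S := by gcongr
    _ ≤ Real.exp (-(l * m - l ^ 2 * B * S)) := by
        linarith [Real.add_one_le_exp (-(l * m - l ^ 2 * B * S))]

-- The optimal exponent is `l = m / (2BS)`, admissible because `m ≤ 𝔼 Z ≤ 𝔼 |Z| ≤ S`.
theorem mgf_neg_div_le {Z : Ω → ℝ} (hZ : Measurable Z) (hB : ∀ ω, |Z ω| ≤ B)
    (hS : ∫ ω, |Z ω| ∂μ ≤ S) (hm : m ≤ ∫ ω, Z ω ∂μ) (hB0 : 0 < B) (hS0 : 0 < S) (hm0 : 0 ≤ m) :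
    mgf Z μ (-(m / (2 * B * S))) ≤ Real.exp (-(m ^ 2 / (4 * B * S))) := by
  have hmS : m ≤ S := hm.trans ((le_abs_self _).trans (abs_integral_le_integral_abs.trans hS))
  refine (mgf_neg_le hZ hB hS hm (by positivity) ?_).trans_eq ?_
  · rw [show m / (2 * B * S) * B = m / (2 * S) by field_simp, div_le_one (by positivity)]
    linarith
  · congr 1
    field_simp
    ring

theorem measureReal_sum_nonpos_le {ι : Type*} [Fintype ι] {Z : ι → Ω → ℝ} (hind : iIndepFun Z μ)
    (hZ : ∀ i, Measurable (Z i)) (hB : ∀ i ω, |Z i ω| ≤ B) (hS : ∀ i, ∫ ω, |Z i ω| ∂μ ≤ S)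
    (hm : ∀ i, m ≤ ∫ ω, Z i ω ∂μ) (hB0 : 0 < B) (hS0 : 0 < S) (hm0 : 0 ≤ m) :
    μ.real {ω | ∑ i, Z i ω ≤ 0} ≤
      Real.exp (-(Fintype.card ι * (m ^ 2 / (4 * B * S)))) := by
  set l := m / (2 * B * S)
  have hl : -l ≤ 0 := neg_nonpos.2 (by positivity)
  have hint := hind.integrable_exp_mul_sum (s := Finset.univ) (t := -l) hZ
    fun i _ => integrable_exp_mul_of_bounded (hZ i) (hB i) _
  calc μ.real {ω | ∑ i, Z i ω ≤ 0} ≤ mgf (∑ i, Z i) μ (-l) := by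
        simpa using measure_le_le_exp_mul_mgf 0 hl hint
    _ = ∏ i, mgf (Z i) μ (-l) := hind.mgf_sum hZ Finset.univ
    _ ≤ ∏ _i : ι, Real.exp (-(m ^ 2 / (4 * B * S))) :=
        Finset.prod_le_prod (fun i _ => mgf_nonneg) fun i _ =>
          mgf_neg_div_le (hZ i) (hB i) (hS i) (hm i) hB0 hS0 hm0
    _ = _ := by
        rw [Finset.prod_const, ← Real.exp_nat_mul, Finset.card_univ, mul_neg]

theorem measureReal_pi_sum_nonpos_le {ι E : Type*} [Fintype ι] [MeasurableSpace E]
    {ν : ι → Measure E} [∀ i, IsProbabilityMeasure (ν i)] {Z : E → ℝ} (hZ : Measurable Z)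
    (hB : ∀ z, |Z z| ≤ B) (hS : ∀ i, ∫ z, |Z z| ∂ν i ≤ S) (hm : ∀ i, m ≤ ∫ z, Z z ∂ν i)
    (hB0 : 0 < B) (hS0 : 0 < S) (hm0 : 0 ≤ m) :
    (Measure.pi ν).real {z | ∑ i, Z (z i) ≤ 0} ≤
      Real.exp (-(Fintype.card ι * (m ^ 2 / (4 * B * S)))) :=
  measureReal_sum_nonpos_le (iIndepFun_pi fun _ => hZ.aemeasurable)
    (fun i => hZ.comp (measurable_pi_apply i)) (fun _ _ => hB _)
    (fun i => (integral_comp_eval (i := i) hZ.abs.aestronglyMeasurable).trans_le (hS i))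
    (fun i => (hm i).trans_eq (integral_comp_eval (i := i) hZ.aestronglyMeasurable).symm)
    hB0 hS0 hm0

end Chernoff

/-! ### Weighted linear regression with random design -/

section Regression

variable {E ι : Type*} [MeasurableSpace E] [Fintype ι]

theorem abs_dotProduct_le (e v : ι → ℝ) : |e ⬝ᵥ v| ≤ Fintype.card ι * (‖e‖ * ‖v‖) := by
  calc |e ⬝ᵥ v| ≤ ∑ p, |e p * v p| := Finset.abs_sum_le_sum_abs _ _
    _ ≤ ∑ _p : ι, ‖e‖ * ‖v‖ := Finset.sum_le_sum fun p _ => by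
        rw [abs_mul]
        exact mul_le_mul (norm_le_pi_norm e p) (norm_le_pi_norm v p) (abs_nonneg _)
          (norm_nonneg _)
    _ = Fintype.card ι * (‖e‖ * ‖v‖) := by simp

/-- A random design of law `π` with weights `w` and features `φ`: the weights are at most `W` with
total mass at most `H`, the features are normalised on the support of `w`, and the design matrix
`∫ w φ φᵀ ∂π` is at least `q H`. Here `H` plays the role of the volume `h ^ d` of the smoothing
window, so that `W` and `q` do not depend on the bandwidth `h`. -/
structure IsDesign (π : Measure E) (w : E → ℝ) (φ : E → ι → ℝ) (W H q : ℝ) : Prop where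
  measurable_weight : Measurable w
  measurable_feature : Measurable φ
  weight_nonneg : ∀ x, 0 ≤ w x
  weight_le : ∀ x, w x ≤ W
  norm_feature_le : ∀ x, w x ≠ 0 → ‖φ x‖ ≤ 1
  integral_weight_le : ∫ x, w x ∂π ≤ H
  le_integral_sq : ∀ e : ι → ℝ, q * H * ‖e‖ ^ 2 ≤ ∫ x, w x * (e ⬝ᵥ φ x) ^ 2 ∂π

/-- The law of one observation `(X, f X + ξ)`, where `X` has law `π` and `ξ` has law `ν`. -/
def obsLaw (π : Measure E) (f : E → ℝ) (ν : Measure ℝ) : Measure (E × ℝ) :=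
  Measure.map (fun a : E × ℝ => (a.1, f a.1 + a.2)) (π.prod ν)

section Observation

variable {π : Measure E} {f : E → ℝ} {ν : Measure ℝ} {F : E × ℝ → ℝ} {B : ℝ}

theorem aemeasurable_obs (hf : AEMeasurable f π) :
    AEMeasurable (fun a : E × ℝ => (a.1, f a.1 + a.2)) (π.prod ν) :=
  measurable_fst.aemeasurable.prodMk
    ((hf.comp_quasiMeasurePreserving Measure.quasiMeasurePreserving_fst).add
      measurable_snd.aemeasurable)

variable [IsProbabilityMeasure π] [IsProbabilityMeasure ν]

theorem isProbabilityMeasure_obsLaw (hf : AEMeasurable f π) :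
    IsProbabilityMeasure (obsLaw π f ν) :=
  Measure.isProbabilityMeasure_map (aemeasurable_obs hf)

theorem integrable_comp_obs (hf : AEMeasurable f π) (hF : Measurable F) (hB : ∀ z, |F z| ≤ B) :
    Integrable (fun a : E × ℝ => F (a.1, f a.1 + a.2)) (π.prod ν) :=
  Integrable.of_bound (hF.comp_aemeasurable (aemeasurable_obs hf)).aestronglyMeasurable B
    (ae_of_all _ fun _ => hB _)

theorem integral_obsLaw (hf : AEMeasurable f π) (hF : Measurable F) (hB : ∀ z, |F z| ≤ B) :
    ∫ z, F z ∂obsLaw π f ν = ∫ x, ∫ ξ, F (x, f x + ξ) ∂ν ∂π := by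
  rw [obsLaw, integral_map (aemeasurable_obs hf) hF.aestronglyMeasurable,
    integral_prod _ (integrable_comp_obs hf hF hB)]

end Observation

namespace IsDesign

variable {π : Measure E} [IsProbabilityMeasure π] {w : E → ℝ} {φ : E → ι → ℝ} {W H q : ℝ}

theorem bound_nonneg (hD : IsDesign π w φ W H q) : 0 ≤ W :=
  have ⟨x⟩ := π.nonempty_of_neZero
  (hD.weight_nonneg x).trans (hD.weight_le x)

theorem abs_weight_mul_le (hD : IsDesign π w φ W H q) {x : E} {y A : ℝ} (hA0 : 0 ≤ A)
    (hy : w x ≠ 0 → |y| ≤ A) : |w x * y| ≤ W * A := by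
  rw [abs_mul, abs_of_nonneg (hD.weight_nonneg x)]
  have hW := hD.bound_nonneg
  rcases eq_or_ne (w x) 0 with h0 | h0
  · rw [h0, zero_mul]
    positivity
  · exact mul_le_mul (hD.weight_le x) (hy h0) (abs_nonneg _) hW

theorem integrable_weight_mul (hD : IsDesign π w φ W H q) {u : E → ℝ} (hu : Measurable u) {A : ℝ}
    (hA0 : 0 ≤ A) (hA : ∀ x, w x ≠ 0 → |u x| ≤ A) : Integrable (fun x => w x * u x) π :=
  Integrable.of_bound (hD.measurable_weight.mul hu).aestronglyMeasurable (W * A)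
    (ae_of_all _ fun x => hD.abs_weight_mul_le hA0 (hA x))

variable {f : E → ℝ} {ν : Measure ℝ} [IsProbabilityMeasure ν]

theorem integral_weight_mul_le_integral_obsLaw (hD : IsDesign π w φ W H q)
    (hf : AEMeasurable f π) {u : E → ℝ} (hu : Measurable u) {G : E × ℝ → ℝ} (hG : Measurable G)
    {A : ℝ} (hA0 : 0 ≤ A) (hu' : ∀ x, w x ≠ 0 → |u x| ≤ A) (hG' : ∀ z, w z.1 ≠ 0 → |G z| ≤ A)
    (hle : ∀ᵐ x ∂π, w x ≠ 0 → u x ≤ ∫ ξ, G (x, f x + ξ) ∂ν) :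
    ∫ x, w x * u x ∂π ≤ ∫ z, w z.1 * G z ∂obsLaw π f ν := by
  have hmeas : Measurable fun z : E × ℝ => w z.1 * G z :=
    (hD.measurable_weight.comp measurable_fst).mul hG
  have hbound : ∀ z : E × ℝ, |w z.1 * G z| ≤ W * A := fun z => hD.abs_weight_mul_le hA0 (hG' z)
  rw [integral_obsLaw hf hmeas hbound]
  refine integral_mono_ae (hD.integrable_weight_mul hu hA0 hu')
    (integrable_comp_obs hf hmeas hbound).integral_prod_left ?_
  filter_upwards [hle] with x hx
  rw [integral_const_mul]
  rcases eq_or_ne (w x) 0 with h0 | h0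
  · simp [h0]
  · exact mul_le_mul_of_nonneg_left (hx h0) (hD.weight_nonneg x)

theorem integrable_weight_mul_obsLaw (hD : IsDesign π w φ W H q) (hf : AEMeasurable f π)
    {G : E × ℝ → ℝ} (hG : Measurable G) {A : ℝ} (hA0 : 0 ≤ A)
    (hA : ∀ z, w z.1 ≠ 0 → |G z| ≤ A) : Integrable (fun z => w z.1 * G z) (obsLaw π f ν) :=
  have := isProbabilityMeasure_obsLaw (ν := ν) hf
  Integrable.of_bound ((hD.measurable_weight.comp measurable_fst).mul hG).aestronglyMeasurable
    (W * A) (ae_of_all _ fun z => hD.abs_weight_mul_le hA0 (hA z))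

theorem integral_abs_weight_mul_le (hD : IsDesign π w φ W H q) (hf : AEMeasurable f π)
    {G : E × ℝ → ℝ} (hG : Measurable G) {A : ℝ} (hA0 : 0 ≤ A)
    (hA : ∀ z, w z.1 ≠ 0 → |G z| ≤ A) :
    ∫ z, |w z.1 * G z| ∂obsLaw π f ν ≤ A * H := by
  have hle := hD.integral_weight_mul_le_integral_obsLaw hf (ν := ν) (u := fun _ => -A)
    measurable_const (G := fun z => -|G z|) hG.abs.neg hA0
    (fun _ _ => by rw [abs_neg, abs_of_nonneg hA0])
    (fun z hz => by simpa using hA z hz) ?_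
  · simp only [mul_neg, integral_neg, integral_mul_const] at hle
    simp only [abs_mul, abs_of_nonneg (hD.weight_nonneg _)]
    nlinarith [hD.integral_weight_le]
  · refine ae_of_all _ fun x hx => ?_
    rw [integral_neg, neg_le_neg_iff]
    simpa using integral_mono_of_nonneg (μ := ν) (ae_of_all _ fun _ => abs_nonneg _)
      (integrable_const A) (ae_of_all _ fun ξ => hA (x, f x + ξ) hx)

theorem measureReal_sum_weight_mul_le (hD : IsDesign π w φ W H q) (hH0 : 0 < H) (hH1 : H ≤ 1)
    (hf : AEMeasurable f π) {τ : Type*} [Fintype τ] {ν : τ → Measure ℝ}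
    [∀ i, IsProbabilityMeasure (ν i)] {G : E × ℝ → ℝ} (hG : Measurable G) {A s m : ℝ}
    (hA0 : 0 < A) (hA : ∀ z, w z.1 ≠ 0 → |G z| ≤ A) (hs : |s| ≤ A) (hm0 : 0 ≤ m)
    (hm : ∀ i, (m + s) * H ≤ ∫ z, w z.1 * G z ∂obsLaw π f (ν i)) :
    (Measure.pi fun i => obsLaw π f (ν i)).real
        {z | ∑ i, w (z i).1 * G (z i) ≤ Fintype.card τ * (s * H)} ≤
      Real.exp (-(m ^ 2 / (8 * (W + 1) * A ^ 2) * (Fintype.card τ * H))) := by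
  have hW := hD.bound_nonneg
  have := fun i => isProbabilityMeasure_obsLaw (ν := ν i) hf
  set Z : E × ℝ → ℝ := fun z => w z.1 * G z - s * H
  have hwG : Measurable fun z : E × ℝ => w z.1 * G z :=
    (hD.measurable_weight.comp measurable_fst).mul hG
  have hZ : Measurable Z := hwG.sub_const _
  have hint := fun i => hD.integrable_weight_mul_obsLaw hf (ν := ν i) hG hA0.le hA
  have hsH : |s * H| ≤ A * H := by
    rw [abs_mul, abs_of_pos hH0]
    gcongr
  have hZB : ∀ z, |Z z| ≤ (W + 1) * A := fun z => by
    refine (abs_sub _ _).trans ?_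
    nlinarith [hD.abs_weight_mul_le hA0.le (hA z)]
  have hZS : ∀ i, ∫ z, |Z z| ∂obsLaw π f (ν i) ≤ 2 * A * H := fun i => by
    calc ∫ z, |Z z| ∂obsLaw π f (ν i)
        ≤ ∫ z, (|w z.1 * G z| + A * H) ∂obsLaw π f (ν i) :=
          integral_mono ((hint i).sub (integrable_const _)).abs
            ((hint i).abs.add (integrable_const _)) fun z => (abs_sub _ _).trans (by gcongr)
      _ ≤ A * H + A * H := by
          rw [integral_add (hint i).abs (integrable_const _)]
          simpa using hD.integral_abs_weight_mul_le hf hG hA0.le hA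
      _ = 2 * A * H := by ring
  have hZm : ∀ i, m * H ≤ ∫ z, Z z ∂obsLaw π f (ν i) := fun i => by
    rw [integral_sub (hint i) (integrable_const _)]
    simpa using by linarith [hm i]
  have hset : {z : τ → E × ℝ | ∑ i, w (z i).1 * G (z i) ≤ Fintype.card τ * (s * H)} =
      {z | ∑ i, Z (z i) ≤ 0} := by
    ext z
    simp [Z, Finset.sum_sub_distrib]
  rw [hset]
  refine (measureReal_pi_sum_nonpos_le hZ hZB hZS hZm (by positivity) (by positivity)
    (by positivity)).trans_eq ?_
  congr 1
  field_simp
  ring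

end IsDesign

end Regression

/-! ### Linear M-estimation -/

section MEstimation

variable {E ι : Type*} [Fintype ι]

/-- The residual of the observation `z = (x, y)` for the linear predictor with coefficients `θ`. -/
def residual (φ : E → ι → ℝ) (θ : ι → ℝ) (z : E × ℝ) : ℝ := z.2 - θ ⬝ᵥ φ z.1

/-- The increment of the score `ψ` at one observation, in the direction `e`, when the coefficients
move from `θ + δ e` to `θ`. -/
def scoreIncrement (ψ : ℝ → ℝ) (φ : E → ι → ℝ) (θ e : ι → ℝ) (δ : ℝ) (z : E × ℝ) : ℝ :=
  (ψ (residual φ θ z) - ψ (residual φ θ z - δ * (e ⬝ᵥ φ z.1))) * (e ⬝ᵥ φ z.1)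

theorem residual_add_smul (φ : E → ι → ℝ) (θ e : ι → ℝ) (s : ℝ) (z : E × ℝ) :
    residual φ (θ + s • e) z = residual φ θ z - s * (e ⬝ᵥ φ z.1) := by
  simp only [residual, add_dotProduct, smul_dotProduct, smul_eq_mul]
  ring

theorem residual_obs (φ : E → ι → ℝ) (f : E → ℝ) (θ : ι → ℝ) (x : E) (ξ : ℝ) :
    residual φ θ (x, f x + ξ) = ξ + (f x - θ ⬝ᵥ φ x) := by
  simp only [residual]
  ring

section Increment

variable {ψ : ℝ → ℝ} {φ : E → ι → ℝ} {θ e e' : ι → ℝ} {δ : ℝ} {z : E × ℝ}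

theorem abs_scoreIncrement_le (hψ : LipschitzWith 1 ψ) (hδ : 0 ≤ δ) :
    |scoreIncrement ψ φ θ e δ z| ≤ δ * (e ⬝ᵥ φ z.1) ^ 2 := by
  have hle := hψ.dist_le_mul (residual φ θ z) (residual φ θ z - δ * (e ⬝ᵥ φ z.1))
  rw [Real.dist_eq, Real.dist_eq, sub_sub_cancel, abs_mul, abs_of_nonneg hδ, NNReal.coe_one,
    one_mul] at hle
  rw [scoreIncrement, abs_mul, ← sq_abs (e ⬝ᵥ _), sq, ← mul_assoc]
  gcongr

theorem abs_scoreIncrement_sub_le (hψ : LipschitzWith 1 ψ) (hδ : 0 ≤ δ) {D ε : ℝ}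
    (he : |e ⬝ᵥ φ z.1| ≤ D) (he' : |e' ⬝ᵥ φ z.1| ≤ D) (hee' : |(e - e') ⬝ᵥ φ z.1| ≤ ε) :
    |scoreIncrement ψ φ θ e δ z - scoreIncrement ψ φ θ e' δ z| ≤ δ * (2 * D * ε) := by
  rw [sub_dotProduct] at hee'
  simp only [scoreIncrement]
  set r := residual φ θ z
  set a := e ⬝ᵥ φ z.1
  set a' := e' ⬝ᵥ φ z.1
  have hψ' : ∀ x y, |ψ x - ψ y| ≤ |x - y| := fun x y => by
    simpa [Real.dist_eq] using hψ.dist_le_mul x y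
  have hD : 0 ≤ D := (abs_nonneg _).trans he
  have hε : 0 ≤ ε := (abs_nonneg _).trans hee'
  have hscore : |ψ (r - δ * a') - ψ (r - δ * a)| ≤ δ * ε := by
    refine (hψ' _ _).trans ?_
    rw [show r - δ * a' - (r - δ * a) = δ * (a - a') by ring, abs_mul, abs_of_nonneg hδ]
    gcongr
  have hincr : |ψ r - ψ (r - δ * a')| ≤ δ * D := by
    refine (hψ' _ _).trans ?_
    rw [sub_sub_cancel, abs_mul, abs_of_nonneg hδ]
    gcongr
  calc |(ψ r - ψ (r - δ * a)) * a - (ψ r - ψ (r - δ * a')) * a'|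
      = |(ψ (r - δ * a') - ψ (r - δ * a)) * a + (ψ r - ψ (r - δ * a')) * (a - a')| := by
        congr 1
        ring
    _ ≤ (δ * ε) * D + (δ * D) * ε := by
        refine (abs_add_le _ _).trans ?_
        rw [abs_mul, abs_mul]
        gcongr
    _ = δ * (2 * D * ε) := by ring

end Increment

section Expectation

variable [MeasurableSpace E] {π : Measure E} [IsProbabilityMeasure π] {w : E → ℝ} {φ : E → ι → ℝ}
  {W H q : ℝ} {ψ : ℝ → ℝ} {γ r B : ℝ} {f : E → ℝ} {ν : Measure ℝ} {θ e : ι → ℝ} {δ η : ℝ}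

theorem measurable_dotProduct_feature (hφ : Measurable φ) (e : ι → ℝ) :
    Measurable fun x => e ⬝ᵥ φ x :=
  Finset.measurable_sum _ fun p _ => ((measurable_pi_apply p).comp hφ).const_mul (e p)

theorem measurable_residual (hφ : Measurable φ) (θ : ι → ℝ) : Measurable (residual φ θ) :=
  measurable_snd.sub ((measurable_dotProduct_feature hφ θ).comp measurable_fst)

theorem measurable_scoreIncrement (hψ : Measurable ψ) (hφ : Measurable φ) (θ e : ι → ℝ) (δ : ℝ) :
    Measurable (scoreIncrement ψ φ θ e δ) := by
  have he : Measurable fun z : E × ℝ => e ⬝ᵥ φ z.1 :=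
    (measurable_dotProduct_feature hφ e).comp measurable_fst
  have hr := measurable_residual hφ θ
  exact ((hψ.comp hr).sub (hψ.comp (hr.sub (he.const_mul δ)))).mul he

namespace IsDesign

omit [IsProbabilityMeasure π] in
theorem abs_dotProduct_feature_le (hD : IsDesign π w φ W H q) (e : ι → ℝ) {x : E}
    (hx : w x ≠ 0) : |e ⬝ᵥ φ x| ≤ Fintype.card ι * ‖e‖ := by
  refine (abs_dotProduct_le e (φ x)).trans ?_
  gcongr
  exact mul_le_of_le_one_right (norm_nonneg e) (hD.norm_feature_le x hx)

theorem neg_le_integral_score (hD : IsDesign π w φ W H q) (hf : AEMeasurable f π)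
    (hψ : LipschitzWith 1 ψ) (hB : ∀ z, |ψ z| ≤ B) (hν : IsIdentifiedBy ψ γ r ν) (hη0 : 0 ≤ η)
    (hbias : ∀ᵐ x ∂π, w x ≠ 0 → |f x - θ ⬝ᵥ φ x| ≤ η) {a : E → ℝ} (ha : Measurable a)
    (ha1 : ∀ x, w x ≠ 0 → |a x| ≤ 1) :
    -η * H ≤ ∫ z, w z.1 * (ψ (residual φ θ z) * a z.1) ∂obsLaw π f ν := by
  have := hν.isProbabilityMeasure
  have hB0 : 0 ≤ B := (abs_nonneg _).trans (hB 0)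
  have hG : Measurable fun z : E × ℝ => ψ (residual φ θ z) * a z.1 :=
    (hψ.continuous.measurable.comp (measurable_residual hD.measurable_feature θ)).mul
      (ha.comp measurable_fst)
  refine le_trans ?_ (hD.integral_weight_mul_le_integral_obsLaw hf (u := fun _ => -η)
    (A := B + η) measurable_const hG (by positivity) (fun x _ => ?_) (fun z hz => ?_) ?_)
  · rw [integral_mul_const]
    nlinarith [hD.integral_weight_le]
  · rw [abs_neg, abs_of_nonneg hη0]
    linarith
  · rw [abs_mul]
    nlinarith [mul_le_mul (hB (residual φ θ z)) (ha1 _ hz) (abs_nonneg _) hB0]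
  · filter_upwards [hbias] with x hx hw
    simp only [residual_obs, integral_mul_const]
    change -η ≤ meanScore ψ ν _ * a x
    refine (abs_le.1 ?_).1
    rw [abs_mul, ← mul_one η]
    exact mul_le_mul ((hν.abs_meanScore_le hψ hB _).trans (hx hw)) (ha1 x hw) (abs_nonneg _) hη0

theorem le_integral_scoreIncrement (hD : IsDesign π w φ W H q) (hf : AEMeasurable f π)
    (hψ : LipschitzWith 1 ψ) (hB : ∀ z, |ψ z| ≤ B) (hν : IsIdentifiedBy ψ γ r ν) (hγ : 0 ≤ γ)
    (hbias : ∀ᵐ x ∂π, w x ≠ 0 → |f x - θ ⬝ᵥ φ x| ≤ r / 2) (he : ‖e‖ = 1) (hδ : 0 < δ)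
    (hδr : δ * Fintype.card ι ≤ r / 2) :
    γ * δ * q * H ≤ ∫ z, w z.1 * scoreIncrement ψ φ θ e δ z ∂obsLaw π f ν := by
  have := hν.isProbabilityMeasure
  have hdir : ∀ x, w x ≠ 0 → |e ⬝ᵥ φ x| ≤ Fintype.card ι := fun x hx => by
    simpa [he] using hD.abs_dotProduct_feature_le e hx
  have hsq : ∀ x, w x ≠ 0 → (e ⬝ᵥ φ x) ^ 2 ≤ (Fintype.card ι : ℝ) ^ 2 := fun x hx =>
    sq_le_sq' (abs_le.1 (hdir x hx)).1 (abs_le.1 (hdir x hx)).2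
  calc γ * δ * q * H = γ * δ * (q * H * ‖e‖ ^ 2) := by rw [he]; ring
    _ ≤ γ * δ * ∫ x, w x * (e ⬝ᵥ φ x) ^ 2 ∂π := by
        gcongr
        exact hD.le_integral_sq e
    _ = ∫ x, w x * (γ * δ * (e ⬝ᵥ φ x) ^ 2) ∂π := by
        rw [← integral_const_mul]
        congr with x
        ring
    _ ≤ _ := hD.integral_weight_mul_le_integral_obsLaw hf (A := (γ + 1) * δ * Fintype.card ι ^ 2)
        (((measurable_dotProduct_feature hD.measurable_feature e).pow_const 2).const_mul _)
        (measurable_scoreIncrement hψ.continuous.measurable hD.measurable_feature θ e δ)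
        (by positivity) (fun x hx => ?_) (fun z hz => ?_) ?_
  · rw [abs_of_nonneg (by positivity)]
    have hle := hsq x hx
    gcongr
    linarith
  · refine (abs_scoreIncrement_le hψ hδ.le).trans ?_
    nlinarith [hsq z.1 hz, mul_nonneg (mul_nonneg hγ hδ.le) (sq_nonneg (Fintype.card ι : ℝ))]
  · filter_upwards [hbias] with x hx hw
    have hint := integrable_comp_add_of_bounded (ν := ν) hψ.continuous.measurable hB
    simp only [scoreIncrement, residual_obs, add_sub_assoc, integral_mul_const]
    rw [integral_sub (hint _) (hint _)]
    set a := e ⬝ᵥ φ x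
    set b := f x - θ ⬝ᵥ φ x
    change _ ≤ (meanScore ψ ν b - meanScore ψ ν (b - δ * a)) * a
    have hδa : |δ * a| ≤ r / 2 := by
      rw [abs_mul, abs_of_pos hδ]
      exact (mul_le_mul_of_nonneg_left (hdir x hw) hδ.le).trans hδr
    have hb := hx hw
    have hb' : |b| ≤ r := by linarith [abs_nonneg b]
    have hmono := hν.mul_sq_le ((abs_sub b (δ * a)).trans (by linarith)) hb'
    rw [sub_sub_cancel] at hmono
    refine le_of_mul_le_mul_left ?_ hδ
    linarith

end IsDesign

end Expectation

end MEstimation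

section Minimiser

variable {E ι τ : Type*} [Fintype ι] [Fintype τ]

/-- The weighted contrast, as a function of the coefficients `t`, that an M-estimator minimises. -/
def empiricalContrast (ρ : ℝ → ℝ) (w : E → ℝ) (φ : E → ι → ℝ) (z : τ → E × ℝ) (t : ι → ℝ) : ℝ :=
  ∑ i, w (z i).1 * ρ (residual φ t (z i))

theorem add_deriv_mul_sub_le {ρ : ℝ → ℝ} (hconv : ConvexOn ℝ univ ρ) (hdiff : Differentiable ℝ ρ)
    (x y : ℝ) : ρ x + deriv ρ x * (y - x) ≤ ρ y := by
  rcases lt_trichotomy x y with hxy | rfl | hxy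
  · have hle := hconv.deriv_le_slope (mem_univ x) (mem_univ y) hxy (hdiff x)
    rw [slope_def_field, le_div_iff₀ (sub_pos.2 hxy)] at hle
    linarith
  · simp
  · have hle := hconv.slope_le_deriv (mem_univ y) (mem_univ x) hxy (hdiff x)
    rw [slope_def_field, div_le_iff₀ (sub_pos.2 hxy)] at hle
    linarith

variable {ρ : ℝ → ℝ} {w : E → ℝ} {φ : E → ι → ℝ} {z : τ → E × ℝ} {θ : ι → ℝ} {δ : ℝ}

theorem sum_deriv_mul_nonneg_of_empiricalContrast_le (hconv : ConvexOn ℝ univ ρ)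
    (hdiff : Differentiable ℝ ρ) (hw : ∀ x, 0 ≤ w x) {e : ι → ℝ} {s : ℝ} (hδs : δ < s)
    (hle : empiricalContrast ρ w φ z (θ + s • e) ≤ empiricalContrast ρ w φ z (θ + δ • e)) :
    0 ≤ ∑ i, w (z i).1 *
      (deriv ρ (residual φ θ (z i) - δ * (e ⬝ᵥ φ (z i).1)) * (e ⬝ᵥ φ (z i).1)) := by
  simp only [empiricalContrast, residual_add_smul] at hle
  refine le_of_mul_le_mul_left ?_ (sub_pos.2 hδs)
  rw [mul_zero, Finset.mul_sum]
  have htangent := Finset.sum_le_sum fun i (_ : i ∈ Finset.univ) => mul_le_mul_of_nonneg_left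
    (add_deriv_mul_sub_le hconv hdiff (residual φ θ (z i) - δ * (e ⬝ᵥ φ (z i).1))
      (residual φ θ (z i) - s * (e ⬝ᵥ φ (z i).1))) (hw (z i).1)
  have hsum := htangent.trans hle
  rw [← sub_nonneg, ← Finset.sum_sub_distrib] at hsum
  refine hsum.trans_eq (Finset.sum_congr rfl fun i _ => ?_)
  ring

-- The point at distance `δ` from `θ` on the segment towards the minimiser is still admissible, and
-- the contrast does not increase from there to the minimiser.
theorem exists_sum_scoreIncrement_le (hconv : ConvexOn ℝ univ ρ) (hdiff : Differentiable ℝ ρ)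
    (hw : ∀ x, 0 ≤ w x) {Θ : Set (ι → ℝ)} (hΘ : Convex ℝ Θ) {θ' : ι → ℝ} (hθ : θ ∈ Θ)
    (hθ' : θ' ∈ Θ) (hmin : IsMinOn (empiricalContrast ρ w φ z) Θ θ') (hδ0 : 0 ≤ δ)
    (hδ : δ < ‖θ' - θ‖) :
    ∃ e : ι → ℝ, ‖e‖ = 1 ∧
      ∑ i, w (z i).1 * scoreIncrement (deriv ρ) φ θ e δ (z i) ≤
        ∑ i, w (z i).1 * (deriv ρ (residual φ θ (z i)) * (e ⬝ᵥ φ (z i).1)) := by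
  set s := ‖θ' - θ‖ with hs
  have hs0 : 0 < s := hδ0.trans_lt hδ
  set e := s⁻¹ • (θ' - θ) with he
  have hθ'e : θ' = θ + s • e := by rw [he, smul_inv_smul₀ hs0.ne', add_sub_cancel]
  have he1 : ‖e‖ = 1 := by
    rw [he, norm_smul, norm_inv, Real.norm_of_nonneg hs0.le, ← hs, inv_mul_cancel₀ hs0.ne']
  have hmem : θ + δ • e ∈ Θ := by
    have h := hΘ.add_smul_sub_mem hθ hθ' (t := δ * s⁻¹)
      ⟨by positivity, by rw [← div_eq_mul_inv, div_le_one hs0]; exact hδ.le⟩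
    rwa [mul_smul] at h
  have hnonneg := sum_deriv_mul_nonneg_of_empiricalContrast_le hconv hdiff hw hδ
    (hθ'e ▸ hmin hmem)
  refine ⟨e, he1, ?_⟩
  rw [← sub_nonneg, ← Finset.sum_sub_distrib]
  refine hnonneg.trans_eq (Finset.sum_congr rfl fun i _ => ?_)
  simp only [scoreIncrement]
  ring

theorem sum_mul_dotProduct_le {e : ι → ℝ} (he : ‖e‖ ≤ 1) {u : τ → ℝ} {v : τ → ι → ℝ}
    {R : ℝ} (hR : ∀ p, |∑ i, u i * v i p| ≤ R) :
    ∑ i, u i * (e ⬝ᵥ v i) ≤ Fintype.card ι * R := by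
  calc ∑ i, u i * (e ⬝ᵥ v i) = ∑ p, e p * ∑ i, u i * v i p := by
        simp only [dotProduct, Finset.mul_sum]
        rw [Finset.sum_comm]
        exact Finset.sum_congr rfl fun p _ => Finset.sum_congr rfl fun i _ => by ring
    _ ≤ ∑ _p : ι, R := Finset.sum_le_sum fun p _ => by
        refine (le_abs_self _).trans ?_
        rw [abs_mul]
        exact (mul_le_of_le_one_left (abs_nonneg _) ((norm_le_pi_norm e p).trans he)).trans (hR p)
    _ = Fintype.card ι * R := by simp

-- `N` is a net of the unit sphere, and `2 D² ε ≤ η` lets the term `δ η` absorb the discretisation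
-- error in the increments of the score.
theorem norm_sub_le_of_sum_lt (hconv : ConvexOn ℝ univ ρ) (hdiff : Differentiable ℝ ρ)
    (hlip : LipschitzWith 1 (deriv ρ)) (hw : ∀ x, 0 ≤ w x) (hφ : ∀ x, w x ≠ 0 → ‖φ x‖ ≤ 1)
    {Θ : Set (ι → ℝ)} (hΘ : Convex ℝ Θ) {θ' : ι → ℝ} (hθ : θ ∈ Θ) (hθ' : θ' ∈ Θ)
    (hmin : IsMinOn (empiricalContrast ρ w φ z) Θ θ') (hδ : 0 ≤ δ) {N : Set (ι → ℝ)} {η ε R : ℝ}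
    (hN1 : ∀ e ∈ N, ‖e‖ = 1) (hN : ∀ e : ι → ℝ, ‖e‖ = 1 → ∃ e₀ ∈ N, ‖e - e₀‖ ≤ ε)
    (hε : 2 * Fintype.card ι ^ 2 * ε ≤ η)
    (hcurv : ∀ e ∈ N, Fintype.card ι * R <
      ∑ i, w (z i).1 * (scoreIncrement (deriv ρ) φ θ e δ (z i) - δ * η))
    (hgrad : ∀ p, |∑ i, w (z i).1 * deriv ρ (residual φ θ (z i)) * φ (z i).1 p| ≤ R) :
    ‖θ' - θ‖ ≤ δ := by
  by_contra! hlt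
  obtain ⟨e, he, hle⟩ := exists_sum_scoreIncrement_le hconv hdiff hw hΘ hθ hθ' hmin hδ hlt
  obtain ⟨e₀, he₀, hdist⟩ := hN e he
  have hdot : ∀ (a : ι → ℝ) {c : ℝ} {x : E}, w x ≠ 0 → ‖a‖ ≤ c →
      |a ⬝ᵥ φ x| ≤ Fintype.card ι * c := fun a c x hx ha => by
    refine (abs_dotProduct_le a (φ x)).trans ?_
    gcongr
    exact (mul_le_of_le_one_right (norm_nonneg a) (hφ x hx)).trans ha
  have hnet : ∑ i, w (z i).1 * (scoreIncrement (deriv ρ) φ θ e₀ δ (z i) - δ * η) ≤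
      ∑ i, w (z i).1 * scoreIncrement (deriv ρ) φ θ e δ (z i) := by
    refine Finset.sum_le_sum fun i _ => ?_
    rcases eq_or_ne (w (z i).1) 0 with h0 | h0
    · simp [h0]
    refine mul_le_mul_of_nonneg_left ?_ (hw _)
    have hdiff := abs_scoreIncrement_sub_le (z := z i) (θ := θ) hlip hδ (hdot e h0 he.le)
      (hdot e₀ h0 (hN1 e₀ he₀).le) (hdot (e - e₀) h0 hdist)
    nlinarith [(abs_le.1 hdiff).1, mul_le_mul_of_nonneg_left hε hδ]
  have hscore := sum_mul_dotProduct_le he.le (v := fun i => φ (z i).1) hgrad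
  simp only [mul_assoc] at hscore
  linarith [hcurv e₀ he₀]

end Minimiser

section Tail

variable {E ι τ : Type*} [MeasurableSpace E] [Fintype ι] [Fintype τ] {π : Measure E}
  [IsProbabilityMeasure π] {w : E → ℝ} {φ : E → ι → ℝ} {W H q : ℝ} {ψ : ℝ → ℝ} {γ r B : ℝ}
  {f : E → ℝ} {ν : τ → Measure ℝ} {θ e : ι → ℝ} {δ η κ : ℝ}

namespace IsDesign

theorem measureReal_sum_scoreIncrement_le (hD : IsDesign π w φ W H q) (hH0 : 0 < H) (hH1 : H ≤ 1)
    (hf : AEMeasurable f π) (hψ : LipschitzWith 1 ψ) (hB : ∀ z, |ψ z| ≤ B)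
    (hν : ∀ i, IsIdentifiedBy ψ γ r (ν i)) (hγ : 0 ≤ γ)
    (hbias : ∀ᵐ x ∂π, w x ≠ 0 → |f x - θ ⬝ᵥ φ x| ≤ r / 2) (he : ‖e‖ = 1) (hδ0 : 0 < δ)
    (hδ1 : δ ≤ 1) (hδr : δ * Fintype.card ι ≤ r / 2) (hη : 0 < η) (hκ : 0 ≤ κ)
    (hκη : κ + 2 * η ≤ γ * q) :
    (Measure.pi fun i => obsLaw π f (ν i)).real
        {z | ∑ i, w (z i).1 * (scoreIncrement ψ φ θ e δ (z i) - δ * η) ≤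
          Fintype.card τ * (η * δ * H)} ≤
      Real.exp (-((κ * δ) ^ 2 / (8 * (W + 1) * (Fintype.card ι ^ 2 + η + B) ^ 2) *
        (Fintype.card τ * H))) := by
  have := fun i => (hν i).isProbabilityMeasure
  have := fun i => isProbabilityMeasure_obsLaw (ν := ν i) hf
  have hB0 : 0 ≤ B := (abs_nonneg _).trans (hB 0)
  have hinc := measurable_scoreIncrement hψ.continuous.measurable hD.measurable_feature θ e δ
  have hincA : ∀ z : E × ℝ, w z.1 ≠ 0 →
      |scoreIncrement ψ φ θ e δ z| ≤ δ * (Fintype.card ι : ℝ) ^ 2 := fun z hz => by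
    refine (abs_scoreIncrement_le hψ hδ0.le).trans ?_
    have hdir := hD.abs_dotProduct_feature_le e hz
    rw [he, mul_one] at hdir
    exact mul_le_mul_of_nonneg_left (sq_le_sq' (abs_le.1 hdir).1 (abs_le.1 hdir).2) hδ0.le
  refine hD.measureReal_sum_weight_mul_le hH0 hH1 hf (hinc.sub_const _) (by positivity)
    (fun z hz => ?_) ?_ (by positivity) fun i => ?_
  · calc |scoreIncrement ψ φ θ e δ z - δ * η|
        ≤ δ * (Fintype.card ι : ℝ) ^ 2 + δ * η := by
          refine (abs_sub _ _).trans ?_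
          rw [abs_of_nonneg (mul_nonneg hδ0.le hη.le)]
          gcongr
          exact hincA z hz
      _ = δ * ((Fintype.card ι : ℝ) ^ 2 + η) := by ring
      _ ≤ (Fintype.card ι : ℝ) ^ 2 + η := mul_le_of_le_one_left (by positivity) hδ1
      _ ≤ (Fintype.card ι : ℝ) ^ 2 + η + B := le_add_of_nonneg_right hB0
  · rw [abs_of_nonneg (by positivity)]
    nlinarith [sq_nonneg (Fintype.card ι : ℝ)]
  · have hmass : ∫ z, w z.1 * (δ * η) ∂obsLaw π f (ν i) ≤ δ * η * H :=
      ((le_abs_self _).trans (abs_integral_le_integral_abs)).trans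
        (hD.integral_abs_weight_mul_le hf measurable_const (by positivity) fun _ _ =>
          (abs_of_nonneg (by positivity)).le)
    have hcurv := hD.le_integral_scoreIncrement hf hψ hB (hν i) hγ hbias he hδ0 hδr
    simp only [mul_sub]
    rw [integral_sub (hD.integrable_weight_mul_obsLaw hf hinc (by positivity) hincA)
      (hD.integrable_weight_mul_obsLaw hf measurable_const (abs_nonneg _) fun _ _ => le_rfl)]
    nlinarith [mul_le_mul_of_nonneg_right hκη (mul_nonneg hδ0.le hH0.le)]

theorem measureReal_abs_sum_score_gt (hD : IsDesign π w φ W H q) (hH0 : 0 < H) (hH1 : H ≤ 1)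
    (hf : AEMeasurable f π) (hψ : LipschitzWith 1 ψ) (hB : ∀ z, |ψ z| ≤ B)
    (hν : ∀ i, IsIdentifiedBy ψ γ r (ν i)) (hη : 0 ≤ η) {A : ℝ} (hA0 : 0 < A) (hBA : B ≤ A)
    (hηA : 2 * η ≤ A) (hbias : ∀ᵐ x ∂π, w x ≠ 0 → |f x - θ ⬝ᵥ φ x| ≤ η) (p : ι) :
    (Measure.pi fun i => obsLaw π f (ν i)).real
        {z | Fintype.card τ * (2 * η * H) <
          |∑ i, w (z i).1 * ψ (residual φ θ (z i)) * φ (z i).1 p|} ≤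
      2 * Real.exp (-(η ^ 2 / (8 * (W + 1) * A ^ 2) * (Fintype.card τ * H))) := by
  have := fun i => (hν i).isProbabilityMeasure
  have := fun i => isProbabilityMeasure_obsLaw (ν := ν i) hf
  have hB0 : 0 ≤ B := (abs_nonneg _).trans (hB 0)
  have hφp : ∀ x, w x ≠ 0 → |φ x p| ≤ 1 := fun x hx =>
    (norm_le_pi_norm (φ x) p).trans (hD.norm_feature_le x hx)
  have hφ := (measurable_pi_apply p).comp hD.measurable_feature
  have htail : ∀ {a : E → ℝ}, Measurable a → (∀ x, w x ≠ 0 → |a x| ≤ 1) →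
      (Measure.pi fun i => obsLaw π f (ν i)).real
        {z | ∑ i, w (z i).1 * (ψ (residual φ θ (z i)) * a (z i).1) ≤
          Fintype.card τ * (-(2 * η) * H)} ≤
      Real.exp (-(η ^ 2 / (8 * (W + 1) * A ^ 2) * (Fintype.card τ * H))) := fun ha ha1 => by
    refine hD.measureReal_sum_weight_mul_le hH0 hH1 hf
      ((hψ.continuous.measurable.comp (measurable_residual hD.measurable_feature θ)).mul
        (ha.comp measurable_fst)) hA0 (fun z hz => ?_) ?_ hη fun i => ?_
    · rw [Pi.mul_apply, abs_mul]
      exact (mul_le_mul (hB _) (ha1 _ hz) (abs_nonneg _) hB0).trans (by linarith)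
    · rwa [abs_neg, abs_of_nonneg (by positivity)]
    · refine le_of_eq_of_le ?_ (hD.neg_le_integral_score hf hψ hB (hν i) hη hbias ha ha1)
      ring
  rw [two_mul (Real.exp _)]
  refine (measureReal_mono ?_ (measure_ne_top _ _)).trans ((measureReal_union_le _ _).trans
    (add_le_add (htail hφ hφp) (htail hφ.neg fun x hx => by simpa using hφp x hx)))
  intro z hz
  rw [mem_ofPred_eq, lt_abs] at hz
  rcases hz with hpos | hneg
  · refine Or.inr ?_
    simp only [Pi.neg_apply, Function.comp_apply, mem_ofPred_eq, mul_neg, Finset.sum_neg_distrib,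
      ← mul_assoc]
    linarith
  · refine Or.inl ?_
    simp only [Function.comp_apply, mem_ofPred_eq, ← mul_assoc]
    linarith

end IsDesign

end Tail

section Deviation

variable {ι : Type*} [Fintype ι]

theorem exists_finset_net_sphere {ε : ℝ} (hε : 0 < ε) :
    ∃ N : Finset (ι → ℝ), (∀ e ∈ N, ‖e‖ = 1) ∧
      ∀ e : ι → ℝ, ‖e‖ = 1 → ∃ e₀ ∈ N, ‖e - e₀‖ ≤ ε := by
  obtain ⟨N, hN, hfin, hcover⟩ :=
    (isCompact_sphere (0 : ι → ℝ) 1).finite_cover_balls hε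
  refine ⟨hfin.toFinset, fun e he => ?_, fun e he => ?_⟩
  · simpa using hN (hfin.mem_toFinset.1 he)
  · obtain ⟨e₀, he₀, hdist⟩ := mem_iUnion₂.1 (hcover (mem_sphere_zero_iff_norm.2 he))
    exact ⟨e₀, hfin.mem_toFinset.2 he₀, (mem_ball_iff_norm.1 hdist).le⟩

variable {E τ : Type*} [MeasurableSpace E] [Fintype τ] {π : Measure E} [IsProbabilityMeasure π]
  {w : E → ℝ} {φ : E → ι → ℝ} {W H q : ℝ} {ρ : ℝ → ℝ} {γ r B : ℝ} {f : E → ℝ}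
  {ν : τ → Measure ℝ} {θ : ι → ℝ} {δ η κ ε : ℝ} {N : Finset (ι → ℝ)}

theorem IsDesign.measureReal_minimiser_le (hD : IsDesign π w φ W H q) (hH0 : 0 < H) (hH1 : H ≤ 1)
    (hf : AEMeasurable f π) (hconv : ConvexOn ℝ univ ρ) (hdiff : Differentiable ℝ ρ)
    (hlip : LipschitzWith 1 (deriv ρ)) (hB : ∀ z, |deriv ρ z| ≤ B)
    (hν : ∀ i, IsIdentifiedBy (deriv ρ) γ r (ν i)) (hγ : 0 ≤ γ) {Θ : Set (ι → ℝ)}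
    (hΘ : Convex ℝ Θ) (hθ : θ ∈ Θ) (hδ0 : 0 < δ) (hδ1 : δ ≤ 1)
    (hδr : δ * Fintype.card ι ≤ r / 2) (hη : 0 < η) (hκ : 0 ≤ κ) (hκη : κ + 2 * η ≤ γ * q)
    (hκη' : 2 * (Fintype.card ι + 1) * κ ≤ η) (hκr : κ * δ ≤ r / 2)
    (hbias : ∀ᵐ x ∂π, w x ≠ 0 → |f x - θ ⬝ᵥ φ x| ≤ κ * δ) (hN1 : ∀ e ∈ N, ‖e‖ = 1)
    (hN : ∀ e : ι → ℝ, ‖e‖ = 1 → ∃ e₀ ∈ N, ‖e - e₀‖ ≤ ε)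
    (hε : 2 * Fintype.card ι ^ 2 * ε ≤ η) :
    (Measure.pi fun i => obsLaw π f (ν i)).real
        {z | ∃ θ' ∈ Θ, IsMinOn (empiricalContrast ρ w φ z) Θ θ' ∧ δ < ‖θ' - θ‖} ≤
      (N.card + Fintype.card ι * 2) *
        Real.exp (-((κ * δ) ^ 2 / (8 * (W + 1) * (Fintype.card ι ^ 2 + η + B) ^ 2) *
          (Fintype.card τ * H))) := by
  have := fun i => (hν i).isProbabilityMeasure
  have := fun i => isProbabilityMeasure_obsLaw (ν := ν i) hf
  have hB0 : 0 ≤ B := (abs_nonneg _).trans (hB 0)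
  set D : ℝ := (Fintype.card ι : ℝ) with hDdef
  have hD0 : 0 ≤ D := Nat.cast_nonneg _
  set P := (Measure.pi fun i => obsLaw π f (ν i))
  set curv : (ι → ℝ) → Set (τ → E × ℝ) := fun e =>
    {z | ∑ i, w (z i).1 * (scoreIncrement (deriv ρ) φ θ e δ (z i) - δ * η) ≤
      Fintype.card τ * (η * δ * H)}
  set grad : ι → Set (τ → E × ℝ) := fun p =>
    {z | Fintype.card τ * (2 * (κ * δ) * H) <
      |∑ i, w (z i).1 * deriv ρ (residual φ θ (z i)) * φ (z i).1 p|}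
  have hsub : {z | ∃ θ' ∈ Θ, IsMinOn (empiricalContrast ρ w φ z) Θ θ' ∧ δ < ‖θ' - θ‖} ⊆
      (⋃ e ∈ N, curv e) ∪ ⋃ p ∈ Finset.univ, grad p := by
    rintro z ⟨θ', hθ', hmin, hlt⟩
    by_contra! hz
    simp only [curv, grad, mem_union, mem_iUnion, mem_ofPred_eq, Finset.mem_univ, not_or,
      not_exists, not_le, not_lt, forall_true_left] at hz
    refine hlt.not_ge (norm_sub_le_of_sum_lt hconv hdiff hlip hD.weight_nonneg hD.norm_feature_le
      hΘ hθ hθ' hmin hδ0.le hN1 hN hε (fun e he => lt_of_le_of_lt ?_ (hz.1 e he)) hz.2)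
    calc D * (Fintype.card τ * (2 * (κ * δ) * H))
        = Fintype.card τ * (2 * D * κ * (δ * H)) := by ring
      _ ≤ Fintype.card τ * (η * (δ * H)) := by
          gcongr
          linarith
      _ = Fintype.card τ * (η * δ * H) := by ring
  refine ((measureReal_mono hsub (measure_ne_top _ _)).trans (measureReal_union_le _ _)).trans ?_
  rw [add_mul, mul_assoc D]
  refine add_le_add ((measureReal_biUnion_finset_le _ _).trans ?_)
    ((measureReal_biUnion_finset_le _ _).trans ?_)
  · rw [← nsmul_eq_mul]
    exact Finset.sum_le_card_nsmul _ _ _ fun e he =>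
      hD.measureReal_sum_scoreIncrement_le hH0 hH1 hf hlip hB hν hγ
        (hbias.mono fun x hx hw => (hx hw).trans hκr) (hN1 e he) hδ0 hδ1 hδr hη hκ hκη
  · rw [hDdef, ← nsmul_eq_mul, ← Finset.card_univ]
    refine Finset.sum_le_card_nsmul _ _ _ fun p _ => hD.measureReal_abs_sum_score_gt hH0 hH1 hf
      hlip hB hν (by positivity) (by positivity) (le_add_of_nonneg_left (by positivity)) ?_ hbias p
    nlinarith [sq_nonneg D, mul_le_mul_of_nonneg_left hδ1 hκ, mul_nonneg hD0 hκ]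

theorem exists_measureReal_minimiser_le (hconv : ConvexOn ℝ univ ρ) (hdiff : Differentiable ℝ ρ)
    (hlip : LipschitzWith 1 (deriv ρ)) (hB : ∀ z, |deriv ρ z| ≤ B) (hγ : 0 < γ) (hr : 0 < r)
    (hq : 0 < q) (hW : 0 ≤ W) :
    ∃ κ > 0, ∃ δ₀ > 0, ∃ a > 0, ∃ C, ∀ {E τ : Type*} [MeasurableSpace E] [Fintype τ]
      {π : Measure E} [IsProbabilityMeasure π] {w : E → ℝ} {φ : E → ι → ℝ} {H : ℝ} {f : E → ℝ}
      {ν : τ → Measure ℝ} {Θ : Set (ι → ℝ)} {θ : ι → ℝ} {δ : ℝ},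
      IsDesign π w φ W H q → 0 < H → H ≤ 1 → AEMeasurable f π →
      (∀ i, IsIdentifiedBy (deriv ρ) γ r (ν i)) → Convex ℝ Θ → θ ∈ Θ → 0 < δ → δ ≤ δ₀ →
      (∀ᵐ x ∂π, w x ≠ 0 → |f x - θ ⬝ᵥ φ x| ≤ κ * δ) →
      (Measure.pi fun i => obsLaw π f (ν i)).real
        {z | ∃ θ' ∈ Θ, IsMinOn (empiricalContrast ρ w φ z) Θ θ' ∧ δ < ‖θ' - θ‖} ≤
      C * Real.exp (-(a * (Fintype.card τ * H) * δ ^ 2)) := by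
  set D : ℝ := (Fintype.card ι : ℝ)
  have hD0 : 0 ≤ D := Nat.cast_nonneg _
  have hB0 : 0 ≤ B := (abs_nonneg _).trans (hB 0)
  set η := γ * q / 4 with hη
  have hη0 : 0 < η := by positivity
  set κ := η / (2 * (D + 1)) with hκ
  have hκ0 : 0 < κ := by positivity
  have hκη : 2 * (D + 1) * κ = η := by
    rw [hκ]
    field_simp
  obtain ⟨N, hN1, hN⟩ := exists_finset_net_sphere (ι := ι) (ε := η / (2 * (D + 1) ^ 2))
    (by positivity)
  have hε : 2 * D ^ 2 * (η / (2 * (D + 1) ^ 2)) ≤ η := by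
    rw [← mul_div_assoc, div_le_iff₀ (by positivity)]
    nlinarith [mul_nonneg hη0.le hD0]
  refine ⟨κ, hκ0, min 1 (min (r / (2 * (D + 1))) (r / (2 * κ))), by positivity,
    κ ^ 2 / (8 * (W + 1) * (D ^ 2 + η + B) ^ 2), by positivity, N.card + D * 2, ?_⟩
  intro E τ _ _ π _ w φ H f ν Θ θ δ hdes hH0 hH1 hf hν hΘ hθ hδ0 hδ hbias
  have hδr : δ * D ≤ r / 2 := by
    have hle := hδ.trans ((min_le_right _ _).trans (min_le_left _ _))
    rw [le_div_iff₀ (by positivity)] at hle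
    linarith
  have hκr : κ * δ ≤ r / 2 := by
    have hle := hδ.trans ((min_le_right _ _).trans (min_le_right _ _))
    rw [le_div_iff₀ (by positivity)] at hle
    linarith
  refine (hdes.measureReal_minimiser_le hH0 hH1 hf hconv hdiff hlip hB hν hγ.le hΘ hθ hδ0
    (hδ.trans (min_le_left _ _)) hδr hη0 hκ0.le (by nlinarith) hκη.le hκr hbias hN1 hN
    hε).trans_eq ?_
  congr 3
  ring

end Deviation

/-! ### Local polynomials -/

section Polynomial

-- For fixed `s`, the polynomial `y ↦ P (y, s)` has the leading coefficient `Q.leadingCoeff s`.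
theorem ae_eval_cons_ne_zero {n : ℕ} {P : MvPolynomial (Fin (n + 1)) ℝ} {s : Fin n → ℝ}
    (hs : MvPolynomial.eval s (MvPolynomial.finSuccEquiv ℝ n P).leadingCoeff ≠ 0) :
    ∀ᵐ y : ℝ, MvPolynomial.eval (Fin.cons y s : Fin (n + 1) → ℝ) P ≠ 0 := by
  set Q := MvPolynomial.finSuccEquiv ℝ n P
  have hR : Polynomial.map (MvPolynomial.eval s) Q ≠ 0 := fun h0 => hs <| by
    simpa using congrArg (fun R => Polynomial.coeff R Q.natDegree) h0
  filter_upwards [measure_eq_zero_iff_ae_notMem.1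
    ((Polynomial.finite_setOfPred_isRoot hR).measure_zero volume)] with y hy h0
  rw [MvPolynomial.eval_eq_eval_mv_eval'] at h0
  exact hy h0

theorem ae_mvPolynomial_eval_ne_zero : ∀ {n : ℕ} {P : MvPolynomial (Fin n) ℝ}, P ≠ 0 →
    ∀ᵐ x : Fin n → ℝ, MvPolynomial.eval x P ≠ 0
  | 0, P, hP => by
    refine ae_of_all _ fun x h => hP ?_
    rw [MvPolynomial.eq_C_of_isEmpty P] at h ⊢
    rw [MvPolynomial.eval_C] at h
    rw [h, MvPolynomial.C_0]
  | n + 1, P, hP => by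
    have hcont : Continuous fun w : ℝ × (Fin n → ℝ) =>
        MvPolynomial.eval (Fin.cons w.1 w.2 : Fin (n + 1) → ℝ) P :=
      (MvPolynomial.continuous_eval P).comp
        (continuous_pi fun i => Fin.cases (by simpa using continuous_fst)
          (fun j => by simpa only [Fin.cons_succ] using by fun_prop) i)
    have hmeas : MeasurableSet {w : ℝ × (Fin n → ℝ) |
        MvPolynomial.eval (Fin.cons w.1 w.2 : Fin (n + 1) → ℝ) P ≠ 0} :=
      (isOpen_ne.preimage hcont).measurableSet
    have hprod : ∀ᵐ w : ℝ × (Fin n → ℝ),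
        MvPolynomial.eval (Fin.cons w.1 w.2 : Fin (n + 1) → ℝ) P ≠ 0 := by
      rw [Measure.volume_eq_prod, Measure.ae_prod_iff_ae_ae hmeas, Measure.ae_ae_comm hmeas]
      filter_upwards [ae_mvPolynomial_eval_ne_zero (n := n)
        (P := (MvPolynomial.finSuccEquiv ℝ n P).leadingCoeff) (by simpa using hP)] with s hs
      exact ae_eval_cons_ne_zero hs
    filter_upwards [(volume_preserving_piFinSuccAbove (fun _ : Fin (n + 1) => ℝ)
      0).quasiMeasurePreserving.ae hprod] with x hx
    convert hx
    exact (Fin.cons_self_tail x).symm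

/-- The vector of all monomials `u ^ p` of degree at most `b`, so that `t ⬝ᵥ monomials b u` is the
value at `u` of the polynomial with coefficients `t`. -/
def monomials {d : ℕ} (b : ℕ) (u : Fin d → ℝ) (p : multiIndices d b) : ℝ := ∏ j, u j ^ p.1 j

variable {d b : ℕ}

theorem continuous_monomials : Continuous (monomials (d := d) b) := by
  unfold monomials
  fun_prop

theorem norm_monomials_le {u : Fin d → ℝ} (hu : ‖u‖ ≤ 1) : ‖monomials b u‖ ≤ 1 := by
  refine (pi_norm_le_iff_of_nonneg zero_le_one).2 fun p => ?_
  rw [monomials, norm_prod]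
  refine Finset.prod_le_one (fun _ _ => norm_nonneg _) fun j _ => ?_
  rw [norm_pow]
  exact pow_le_one₀ (norm_nonneg _) ((norm_le_pi_norm u j).trans hu)

theorem ae_dotProduct_monomials_ne_zero {t : multiIndices d b → ℝ} (ht : t ≠ 0) :
    ∀ᵐ u : Fin d → ℝ, t ⬝ᵥ monomials b u ≠ 0 := by
  set P : MvPolynomial (Fin d) ℝ :=
    ∑ p : multiIndices d b, MvPolynomial.monomial (Finsupp.equivFunOnFinite.symm p.1) (t p) with hP
  have hcoeff : ∀ p : multiIndices d b,
      MvPolynomial.coeff (Finsupp.equivFunOnFinite.symm p.1) P = t p := fun p => by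
    rw [hP, MvPolynomial.coeff_sum, Finset.sum_eq_single p _ (by simp)]
    · simp
    · intro p' _ hne
      rw [MvPolynomial.coeff_monomial, if_neg]
      exact fun h => hne (Subtype.ext (Finsupp.equivFunOnFinite.symm.injective h))
  have hP0 : P ≠ 0 := fun h => ht <| funext fun p => by simp [← hcoeff p, h]
  filter_upwards [ae_mvPolynomial_eval_ne_zero hP0] with u hu
  convert hu
  simp [hP, dotProduct, monomials, MvPolynomial.eval_monomial, Finsupp.prod_fintype]

end Polynomial

theorem exists_mul_norm_sq_le {E : Type*} [NormedAddCommGroup E] [NormedSpace ℝ E] [ProperSpace E]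
    {Q : E → ℝ} (hsmul : ∀ (a : ℝ) (x : E), Q (a • x) = a ^ 2 * Q x)
    (hcont : ContinuousOn Q (Metric.sphere 0 1)) (hpos : ∀ x, x ≠ 0 → 0 < Q x) :
    ∃ q > 0, ∀ x, q * ‖x‖ ^ 2 ≤ Q x := by
  have hzero : Q 0 = 0 := by simpa using hsmul 0 0
  rcases subsingleton_or_nontrivial E with hE | hE
  · exact ⟨1, one_pos, fun x => by simp [Subsingleton.elim x 0, hzero]⟩
  obtain ⟨x₀, hx₀, hmin⟩ := (isCompact_sphere (0 : E) 1).exists_isMinOn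
    (NormedSpace.sphere_nonempty.2 zero_le_one) hcont
  refine ⟨Q x₀, hpos x₀ (ne_zero_of_mem_unit_sphere ⟨x₀, hx₀⟩), fun x => ?_⟩
  rcases eq_or_ne x 0 with rfl | hx
  · simp [hzero]
  have hle : Q x₀ ≤ Q (‖x‖⁻¹ • x) := hmin (by simp [norm_smul, hx])
  have hx' := norm_pos_iff.2 hx
  rwa [hsmul, inv_pow, ← div_eq_inv_mul, le_div_iff₀ (by positivity)] at hle

namespace IsKernel

variable {d b : ℕ} {K : (Fin d → ℝ) → ℝ}

theorem integrable (hK : IsKernel K) : Integrable K :=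
  Integrable.of_integral_ne_zero (hK.integral_eq_one ▸ one_ne_zero)

theorem norm_le_half (hK : IsKernel K) {u : Fin d → ℝ} (hu : K u ≠ 0) : ‖u‖ ≤ 1 / 2 :=
  (pi_norm_le_iff_of_nonneg (by norm_num)).2 fun j =>
    abs_le.2 ⟨(hK.support hu).1 j, (hK.support hu).2 j⟩

theorem norm_monomials_le (hK : IsKernel K) {u : Fin d → ℝ} (hu : K u ≠ 0) :
    ‖monomials b u‖ ≤ 1 :=
  RhoLPA.norm_monomials_le ((hK.norm_le_half hu).trans (by norm_num))

theorem norm_mul_sq_le (hK : IsKernel K) (e : multiIndices d b → ℝ) (u : Fin d → ℝ) :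
    ‖K u * (e ⬝ᵥ monomials b u) ^ 2‖ ≤ K u * ((multiIndices d b).card * ‖e‖) ^ 2 := by
  rw [norm_mul, Real.norm_of_nonneg (hK.nonneg u), norm_pow, Real.norm_eq_abs]
  rcases eq_or_ne (K u) 0 with h0 | h0
  · simp [h0]
  have hu := hK.nonneg u
  have hle := abs_dotProduct_le e (monomials b u)
  rw [Fintype.card_coe] at hle
  gcongr
  refine hle.trans ?_
  gcongr
  exact mul_le_of_le_one_right (norm_nonneg e) (hK.norm_monomials_le h0)

theorem measurable_mul_sq (hK : IsKernel K) (e : multiIndices d b → ℝ) :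
    Measurable fun u => K u * (e ⬝ᵥ monomials b u) ^ 2 :=
  hK.measurable.mul ((measurable_dotProduct_feature continuous_monomials.measurable e).pow_const 2)

theorem integrable_mul_sq (hK : IsKernel K) (e : multiIndices d b → ℝ) :
    Integrable fun u => K u * (e ⬝ᵥ monomials b u) ^ 2 :=
  (hK.integrable.mul_const _).mono' (hK.measurable_mul_sq e).aestronglyMeasurable
    (ae_of_all _ (hK.norm_mul_sq_le e))

theorem setIntegral_mul_sq_pos (hK : IsKernel K) {S : Set (Fin d → ℝ)} (hS : 0 < ∫ u in S, K u)
    {e : multiIndices d b → ℝ} (he : e ≠ 0) :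
    0 < ∫ u in S, K u * (e ⬝ᵥ monomials b u) ^ 2 := by
  have hnn : ∀ u, 0 ≤ K u * (e ⬝ᵥ monomials b u) ^ 2 := fun u =>
    mul_nonneg (hK.nonneg u) (sq_nonneg _)
  refine (integral_nonneg hnn).lt_of_ne fun h0 => hS.ne' ?_
  refine integral_eq_zero_of_ae ?_
  filter_upwards [(setIntegral_eq_zero_iff_of_nonneg_ae (ae_of_all _ hnn)
    (hK.integrable_mul_sq e).integrableOn).1 h0.symm,
    ae_restrict_of_ae (ae_dotProduct_monomials_ne_zero he)] with u hu hu'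
  simpa [hu'] using hu

theorem exists_mul_norm_sq_le_setIntegral (hK : IsKernel K) {S : Set (Fin d → ℝ)}
    (hS : 0 < ∫ u in S, K u) (b : ℕ) :
    ∃ q > 0, ∀ e : multiIndices d b → ℝ,
      q * ‖e‖ ^ 2 ≤ ∫ u in S, K u * (e ⬝ᵥ monomials b u) ^ 2 := by
  refine exists_mul_norm_sq_le (fun a e => ?_) ?_ fun e he => hK.setIntegral_mul_sq_pos hS he
  · rw [← integral_const_mul]
    congr with u
    rw [smul_dotProduct, smul_eq_mul]
    ring
  · refine continuousOn_of_dominated (bound := fun u => K u * (multiIndices d b).card ^ 2)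
      (fun e _ => (hK.measurable_mul_sq e).aestronglyMeasurable)
      (fun e he => ae_of_all _ fun u => ?_) (hK.integrable.mul_const _).integrableOn
      (ae_of_all _ fun u => ?_)
    · simpa [mem_sphere_zero_iff_norm.1 he] using hK.norm_mul_sq_le e u
    · exact (continuous_const.mul ((continuous_id.dotProduct continuous_const).pow 2)).continuousOn

end IsKernel

section Rescale

variable {d : ℕ} {x₀ : Fin d → ℝ} {h : ℝ}

theorem measurableSet_cube (d : ℕ) : MeasurableSet (cube d) := measurableSet_Icc

instance isProbabilityMeasure_volume_restrict_cube (d : ℕ) :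
    IsProbabilityMeasure (volume.restrict (cube d)) :=
  ⟨by simp [cube, Real.volume_Icc_pi]⟩

/-- The position of `x` relative to `x₀`, in units of the bandwidth `h`. -/
def rescale (x₀ : Fin d → ℝ) (h : ℝ) (x : Fin d → ℝ) : Fin d → ℝ := fun j => (x j - x₀ j) / h

theorem rescale_eq_smul (x₀ : Fin d → ℝ) (h : ℝ) (x : Fin d → ℝ) :
    rescale x₀ h x = h⁻¹ • (x - x₀) := by
  ext j
  simp [rescale, div_eq_inv_mul]

theorem add_mul_rescale (hh : h ≠ 0) (x : Fin d → ℝ) (j : Fin d) :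
    x₀ j + h * rescale x₀ h x j = x j := by
  rw [rescale, mul_div_cancel₀ _ hh, add_sub_cancel]

theorem measurable_rescale (x₀ : Fin d → ℝ) (h : ℝ) : Measurable (rescale x₀ h) := by
  unfold rescale
  fun_prop

theorem integral_rescale (x₀ : Fin d → ℝ) (hh : 0 < h) (F : (Fin d → ℝ) → ℝ) :
    ∫ x, F (rescale x₀ h x) = h ^ d * ∫ u, F u := by
  simp only [rescale_eq_smul]
  rw [integral_sub_right_eq_self (fun x => F (h⁻¹ • x)) x₀,
    Measure.integral_comp_inv_smul_of_nonneg volume F hh.le]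
  simp

theorem integrable_rescale (x₀ : Fin d → ℝ) (hh : h ≠ 0) {F : (Fin d → ℝ) → ℝ}
    (hF : Integrable F) : Integrable fun x => F (rescale x₀ h x) := by
  simp only [rescale_eq_smul]
  exact (hF.comp_smul (inv_ne_zero hh)).comp_sub_right x₀

theorem measurableSet_inwardDirections (x₀ : Fin d → ℝ) :
    MeasurableSet (inwardDirections x₀) := by
  simp only [inwardDirections, ofPred_forall]
  refine MeasurableSet.iInter fun j => ?_
  exact ((MeasurableSet.const _).imp
      (measurableSet_le measurable_const (measurable_pi_apply j))).inter
    ((MeasurableSet.const _).imp (measurableSet_le (measurable_pi_apply j) measurable_const))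

theorem eventually_nonneg_add_mul {a : ℝ} (ha : 0 ≤ a) :
    ∀ᶠ h in 𝓝[>] (0 : ℝ), ∀ u, (a = 0 → 0 ≤ u) → |u| ≤ 1 → 0 ≤ a + h * u := by
  rcases ha.eq_or_lt with rfl | ha
  · filter_upwards [self_mem_nhdsWithin] with h hh u hu _
    simpa using mul_nonneg (le_of_lt hh) (hu rfl)
  · filter_upwards [Ioo_mem_nhdsGT ha] with h hh u _ hu
    nlinarith [hh.1, hh.2, (abs_le.1 hu).1]

theorem eventually_mem_cube_of_rescale_mem (hx₀ : x₀ ∈ cube d) :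
    ∀ᶠ h in 𝓝[>] (0 : ℝ), ∀ x, rescale x₀ h x ∈ inwardDirections x₀ → ‖rescale x₀ h x‖ ≤ 1 →
      x ∈ cube d := by
  filter_upwards [self_mem_nhdsWithin,
    eventually_all.2 fun j => eventually_nonneg_add_mul (hx₀.1 j),
    eventually_all.2 fun j => eventually_nonneg_add_mul (sub_nonneg.2 (hx₀.2 j))]
    with h hh hlower hupper x hin hx
  have habs : ∀ j, |rescale x₀ h x j| ≤ 1 := fun j => (norm_le_pi_norm _ j).trans hx
  refine ⟨fun j => ?_, fun j => ?_⟩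
  · rw [← add_mul_rescale (ne_of_gt hh) x j]
    exact hlower j _ (hin j).1 (habs j)
  · have hle := hupper j (-rescale x₀ h x j)
      (fun h1 => neg_nonneg.2 ((hin j).2 (sub_eq_zero.1 h1).symm)) (by simpa using habs j)
    rw [← add_mul_rescale (x₀ := x₀) (ne_of_gt hh) x j]
    simp only [Pi.one_apply] at hle ⊢
    linarith

end Rescale

namespace IsKernel

variable {d b : ℕ} {K : (Fin d → ℝ) → ℝ} {x₀ : Fin d → ℝ} {h : ℝ}

theorem setIntegral_rescale_le (hK : IsKernel K) (x₀ : Fin d → ℝ) (hh : 0 < h)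
    (S : Set (Fin d → ℝ)) : ∫ x in S, K (rescale x₀ h x) ≤ h ^ d := by
  calc ∫ x in S, K (rescale x₀ h x) ≤ ∫ x, K (rescale x₀ h x) :=
        setIntegral_le_integral (integrable_rescale x₀ hh.ne' hK.integrable)
          (ae_of_all _ fun x => hK.nonneg _)
    _ = h ^ d := by rw [integral_rescale x₀ hh, hK.integral_eq_one, mul_one]

theorem mul_setIntegral_mul_sq_le (hK : IsKernel K) (hh : 0 < h) {S C : Set (Fin d → ℝ)}
    (hS : MeasurableSet S) (hC : MeasurableSet C)
    (hsub : ∀ x, rescale x₀ h x ∈ S → ‖rescale x₀ h x‖ ≤ 1 → x ∈ C)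
    (e : multiIndices d b → ℝ) :
    h ^ d * ∫ u in S, K u * (e ⬝ᵥ monomials b u) ^ 2 ≤
      ∫ x in C, K (rescale x₀ h x) * (e ⬝ᵥ monomials b (rescale x₀ h x)) ^ 2 := by
  set F : (Fin d → ℝ) → ℝ := fun u => K u * (e ⬝ᵥ monomials b u) ^ 2
  have hF : ∀ u, 0 ≤ F u := fun u => mul_nonneg (hK.nonneg u) (sq_nonneg _)
  have hint : Integrable F := hK.integrable_mul_sq e
  rw [← integral_indicator hS, ← integral_rescale x₀ hh, ← integral_indicator hC]
  refine integral_mono (integrable_rescale x₀ hh.ne' (hint.indicator hS))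
    ((integrable_rescale x₀ hh.ne' hint).indicator hC) fun x => ?_
  refine indicator_apply_le' (fun hin => ?_) fun _ => indicator_nonneg (fun y _ => hF _) x
  rcases eq_or_ne (K (rescale x₀ h x)) 0 with h0 | h0
  · simp only [h0, zero_mul]
    exact indicator_nonneg (fun y _ => hF _) x
  · rw [indicator_of_mem (hsub x hin ((hK.norm_le_half h0).trans (by norm_num)))]

theorem exists_eventually_isDesign (hK : IsKernel K) (hx₀ : x₀ ∈ cube d)
    (hKx₀ : 0 < ∫ z in inwardDirections x₀, K z) {W : ℝ} (hW : ∀ z, K z ≤ W) (b : ℕ) :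
    ∃ q > 0, ∀ᶠ h in 𝓝[>] (0 : ℝ), IsDesign (volume.restrict (cube d))
      (fun x => K (rescale x₀ h x)) (fun x => monomials b (rescale x₀ h x)) W (h ^ d) q := by
  obtain ⟨q, hq0, hq⟩ := hK.exists_mul_norm_sq_le_setIntegral hKx₀ b
  refine ⟨q, hq0, ?_⟩
  filter_upwards [self_mem_nhdsWithin, eventually_mem_cube_of_rescale_mem hx₀] with h hh hsub
  have hh' : 0 < h := hh
  refine ⟨hK.measurable.comp (measurable_rescale x₀ h),
    continuous_monomials.measurable.comp (measurable_rescale x₀ h), fun x => hK.nonneg _,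
    fun x => hW _, fun x hx => hK.norm_monomials_le hx, hK.setIntegral_rescale_le x₀ hh _,
    fun e => le_trans ?_ (hK.mul_setIntegral_mul_sq_le hh (measurableSet_inwardDirections x₀)
      (measurableSet_cube d) hsub e)⟩
  rw [mul_comm q, mul_assoc]
  gcongr
  exact hq e

end IsKernel

/-! ### The deviation inequality for the local estimator -/

/-- The coefficients, in the rescaled variable `(x - x₀) / h`, of the Taylor polynomial of `f` at
`x₀`. -/
def taylorCoeff {d : ℕ} (b : ℕ) (f : (Fin d → ℝ) → ℝ) (x₀ : Fin d → ℝ) (h : ℝ)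
    (p : multiIndices d b) : ℝ :=
  iterPartial p.1 f x₀ * ∏ j, h ^ p.1 j / (p.1 j).factorial

theorem taylorCoeff_dotProduct_monomials {d : ℕ} (b : ℕ) (f : (Fin d → ℝ) → ℝ)
    (x₀ x : Fin d → ℝ) {h : ℝ} (hh : h ≠ 0) :
    taylorCoeff b f x₀ h ⬝ᵥ monomials b (rescale x₀ h x) =
      ∑ p ∈ multiIndices d b, iterPartial p f x₀ * taylorMonomial p (x - x₀) := by
  rw [← Finset.sum_coe_sort]
  refine Finset.sum_congr rfl fun p _ => ?_
  rw [taylorCoeff, monomials, mul_assoc, ← Finset.prod_mul_distrib, taylorMonomial]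
  congr 1
  refine Finset.prod_congr rfl fun j _ => ?_
  have := pow_ne_zero (p.1 j) hh
  simp only [rescale, Pi.sub_apply, div_pow]
  field_simp

theorem taylorCoeff_zeroIndex {d : ℕ} (b : ℕ) (f : (Fin d → ℝ) → ℝ) (x₀ : Fin d → ℝ) (h : ℝ) :
    taylorCoeff b f x₀ h (zeroIndex d b) = f x₀ := by
  simp [taylorCoeff, zeroIndex, iterPartial_zero]

namespace IsHolder

variable {d : ℕ} {β L M : ℝ} {f : (Fin d → ℝ) → ℝ} {x₀ x : Fin d → ℝ} {h : ℝ}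

theorem taylorCoeff_mem_coeffBall (hM : 0 ≤ M) (hf : IsHolder d β L M f) (hx₀ : x₀ ∈ cube d)
    (hh0 : 0 ≤ h) (hh1 : h ≤ 1) :
    taylorCoeff (strictFloor β) f x₀ h ∈ coeffBall d (strictFloor β) M := by
  refine le_trans ?_ (hf.sum_abs_iterPartial_le hM hx₀)
  rw [← Finset.sum_coe_sort (multiIndices d (strictFloor β))]
  refine Finset.sum_le_sum fun p _ => ?_
  rw [taylorCoeff, abs_mul]
  refine mul_le_of_le_one_right (abs_nonneg _) ?_
  rw [abs_of_nonneg (Finset.prod_nonneg fun j _ => by positivity)]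
  refine Finset.prod_le_one (fun j _ => by positivity) fun j _ => ?_
  have : (1 : ℝ) ≤ (p.1 j).factorial := by exact_mod_cast Nat.factorial_pos _
  exact div_le_one_of_le₀ ((pow_le_one₀ hh0 hh1).trans this) (by positivity)

theorem abs_sub_taylorCoeff_le (hβ : 0 < β) (hL : 0 ≤ L) (hf : IsHolder d β L M f)
    (hx₀ : x₀ ∈ cube d) (hx : x ∈ cube d) (hh : 0 < h) (hxh : ‖rescale x₀ h x‖ ≤ 1) :
    |f x - taylorCoeff (strictFloor β) f x₀ h ⬝ᵥ monomials (strictFloor β) (rescale x₀ h x)| ≤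
      d * ((multiIndices d (strictFloor β)).card * L) * h ^ β := by
  have hnorm : ‖x - x₀‖ ≤ h := by
    rw [rescale_eq_smul, norm_smul, norm_inv, Real.norm_of_nonneg hh.le] at hxh
    exact (inv_mul_le_one₀ hh).1 hxh
  rw [taylorCoeff_dotProduct_monomials _ _ _ _ hh.ne']
  refine (hf.abs_sub_taylor_le hβ hL hx hx₀).trans ?_
  rw [mul_assoc (d : ℝ), mul_assoc _ L]
  gcongr

theorem abs_le (hM : 0 ≤ M) (hf : IsHolder d β L M f) (hx : x ∈ cube d) : |f x| ≤ M := by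
  have hle := Finset.single_le_sum (f := fun p => |iterPartial p f x|) (fun _ _ => abs_nonneg _)
    (zeroIndex d (strictFloor β)).2
  refine le_trans ?_ (hle.trans (hf.sum_abs_iterPartial_le hM hx))
  simp [zeroIndex, iterPartial_zero]

theorem aemeasurable (hβ : 0 < β) (hL : 0 ≤ L) (hf : IsHolder d β L M f) :
    AEMeasurable f (volume.restrict (cube d)) :=
  (hf.continuousOn hβ hL).aemeasurable (measurableSet_cube d)

end IsHolder

theorem convex_coeffBall (d b : ℕ) (M : ℝ) : Convex ℝ (coeffBall d b M) := by
  intro s hs t ht a c ha hc hac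
  have hs' : ∑ p, |s p| ≤ M := hs
  have ht' : ∑ p, |t p| ≤ M := ht
  calc ∑ p, |(a • s + c • t) p| ≤ ∑ p, (a * |s p| + c * |t p|) := Finset.sum_le_sum fun p _ =>
        (abs_add_le _ _).trans_eq (by simp [abs_mul, abs_of_nonneg ha, abs_of_nonneg hc])
    _ = a * ∑ p, |s p| + c * ∑ p, |t p| := by
        rw [Finset.sum_add_distrib, Finset.mul_sum, Finset.mul_sum]
    _ ≤ a * M + c * M := by gcongr
    _ = M := by rw [← add_mul, hac, one_mul]

theorem localPoly_eq_dotProduct {d b : ℕ} {K : (Fin d → ℝ) → ℝ} (hK : IsKernel K)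
    {x₀ x : Fin d → ℝ} {h : ℝ} (hh : 0 < h) (hx : x ∈ cube d) (hKx : K (rescale x₀ h x) ≠ 0)
    (t : multiIndices d b → ℝ) :
    localPoly x₀ h t x = t ⬝ᵥ monomials b (rescale x₀ h x) := by
  refine indicator_of_mem (s := nbhd x₀ h) ?_ _
  have habs : ∀ j, |rescale x₀ h x j| ≤ 1 / 2 := fun j =>
    (norm_le_pi_norm _ j).trans (hK.norm_le_half hKx)
  refine ⟨⟨fun j => ?_, fun j => ?_⟩, hx⟩ <;>
  · have hj := abs_le.1 (habs j)
    rw [← add_mul_rescale (x₀ := x₀) hh.ne' x j]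
    nlinarith

theorem criterion_eq_empiricalContrast {d b n : ℕ} {ρ : ℝ → ℝ} {K : (Fin d → ℝ) → ℝ}
    (hK : IsKernel K) {x₀ : Fin d → ℝ} {h : ℝ} (hh : 0 < h) {z : Sample d n}
    (hz : ∀ i, (z i).1 ∈ cube d) (t : multiIndices d b → ℝ) :
    criterion ρ K x₀ h z t = 1 / (n * h ^ d) * empiricalContrast ρ
      (fun x => K (rescale x₀ h x)) (fun x => monomials b (rescale x₀ h x)) z t := by
  refine congrArg _ (Finset.sum_congr rfl fun i _ => ?_)
  change _ * K (rescale x₀ h (z i).1) = K (rescale x₀ h (z i).1) * _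
  rcases eq_or_ne (K (rescale x₀ h (z i).1)) 0 with h0 | h0
  · rw [h0, zero_mul, mul_zero]
  · rw [localPoly_eq_dotProduct hK hh (hz i) h0, mul_comm, residual]

theorem isProbabilityMeasure_sampleLaw {d : ℕ} (n : ℕ) {g : ℕ → ℝ → ℝ}
    (hg : ∀ i, IsNoiseDensity (g i)) {f : (Fin d → ℝ) → ℝ}
    (hf : AEMeasurable f (volume.restrict (cube d))) :
    IsProbabilityMeasure (sampleLaw d n g f) :=
  have := fun i => (hg i).isProbabilityMeasure
  have := fun i => isProbabilityMeasure_obsLaw (ν := noiseLaw (g i)) hf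
  inferInstanceAs (IsProbabilityMeasure (Measure.pi fun i : Fin n =>
    obsLaw (volume.restrict (cube d)) f (noiseLaw (g i))))

theorem ae_fst_mem_cube {d n : ℕ} {g : ℕ → ℝ → ℝ} (hg : ∀ i, IsNoiseDensity (g i))
    {f : (Fin d → ℝ) → ℝ} (hf : AEMeasurable f (volume.restrict (cube d))) :
    ∀ᵐ z ∂sampleLaw d n g f, ∀ i, (z i).1 ∈ cube d := by
  have hν := fun i => (hg i).isProbabilityMeasure
  have hobs := fun i => isProbabilityMeasure_obsLaw (ν := noiseLaw (g i)) hf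
  refine eventually_all.2 fun i => (Measure.tendsto_eval_ae_ae
    (μ := fun i : Fin n => obsLaw (volume.restrict (cube d)) f (noiseLaw (g i)))
    (i := i)).eventually (p := fun w => w.1 ∈ cube d) ?_
  rw [obsLaw, ae_map_iff (aemeasurable_obs hf) (measurable_fst (measurableSet_cube d))]
  exact Measure.quasiMeasurePreserving_fst.ae (ae_restrict_mem (measurableSet_cube d))

namespace IsLPAEstimator

variable {d n b : ℕ} {M : ℝ} {ρ : ℝ → ℝ} {K : (Fin d → ℝ) → ℝ} {x₀ : Fin d → ℝ} {h : ℝ}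
  {fhat : Sample d n → ℝ}

theorem abs_le (hfhat : IsLPAEstimator b M ρ K x₀ h fhat) (z : Sample d n) : |fhat z| ≤ M := by
  obtain ⟨θ, hθ, _, hz⟩ := hfhat.2 z
  rw [hz]
  exact (Finset.single_le_sum (f := fun p => |θ p|) (fun _ _ => abs_nonneg _)
    (Finset.mem_univ _)).trans hθ

theorem exists_isMinOn_empiricalContrast (hfhat : IsLPAEstimator b M ρ K x₀ h fhat)
    (hK : IsKernel K) (hh : 0 < h) (hn : 0 < n) {z : Sample d n} (hz : ∀ i, (z i).1 ∈ cube d) :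
    ∃ θ ∈ coeffBall d b M, IsMinOn (empiricalContrast ρ (fun x => K (rescale x₀ h x))
      (fun x => monomials b (rescale x₀ h x)) z) (coeffBall d b M) θ ∧
      fhat z = θ (zeroIndex d b) := by
  obtain ⟨θ, hθ, hmin, hval⟩ := hfhat.2 z
  refine ⟨θ, hθ, fun t ht => ?_, hval⟩
  have hle := hmin t ht
  rw [criterion_eq_empiricalContrast hK hh hz, criterion_eq_empiricalContrast hK hh hz] at hle
  exact le_of_mul_le_mul_left hle (by positivity)

end IsLPAEstimator

theorem exists_measureReal_isLPAEstimator_le {d : ℕ} {β L M c : ℝ} (hβ : 0 < β) (hL : 0 ≤ L)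
    (hM : 0 ≤ M) (hc : 0 < c) {x₀ : Fin d → ℝ} (hx₀ : x₀ ∈ cube d) {K : (Fin d → ℝ) → ℝ}
    (hK : IsKernel K) (hKx₀ : 0 < ∫ z in inwardDirections x₀, K z) {ρ : ℝ → ℝ} {g : ℕ → ℝ → ℝ}
    (hρ : IsContrast ρ g) (hg : g ∈ densityClass ρ c) :
    ∃ A > 0, ∃ δ₀ > 0, ∃ a > 0, ∃ C, ∀ᶠ h in 𝓝[>] (0 : ℝ), ∀ {n : ℕ} {fhat : Sample d n → ℝ}
      {f δ}, 0 < n → IsLPAEstimator (strictFloor β) M ρ K x₀ h fhat → IsHolder d β L M f →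
        A * h ^ β ≤ δ → δ ≤ δ₀ →
        (sampleLaw d n g f).real {z | δ < |fhat z - f x₀|} ≤
          C * Real.exp (-(a * (n * h ^ d) * δ ^ 2)) := by
  obtain ⟨W, hW⟩ := hK.bounded
  obtain ⟨B, hB⟩ := hρ.bounded_deriv
  obtain ⟨r, hr, hν⟩ := hρ.exists_isIdentifiedBy hc hg
  obtain ⟨q, hq, hdesign⟩ := hK.exists_eventually_isDesign hx₀ hKx₀ hW (strictFloor β)
  obtain ⟨κ, hκ, δ₀, hδ₀, a, ha, C, hdev⟩ := exists_measureReal_minimiser_le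
    (ι := multiIndices d (strictFloor β)) hρ.convex hρ.differentiable hρ.lipschitz_deriv hB
    (half_pos hc) hr hq ((hK.nonneg 0).trans (hW 0))
  set Cb : ℝ := d * ((multiIndices d (strictFloor β)).card * L)
  refine ⟨Cb / κ + 1, by positivity, δ₀, hδ₀, a, ha, C, ?_⟩
  filter_upwards [hdesign, Ioc_mem_nhdsGT one_pos] with h hdes hh n fhat f δ hn hfhat hf hδA hδ
  have hh0 : 0 < h := hh.1
  have hpow : 0 < h ^ β := Real.rpow_pos_of_pos hh0 β
  have hf' := hf.aemeasurable hβ hL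
  have hbias : ∀ᵐ x ∂volume.restrict (cube d), K (rescale x₀ h x) ≠ 0 →
      |f x - taylorCoeff (strictFloor β) f x₀ h ⬝ᵥ monomials _ (rescale x₀ h x)| ≤ κ * δ := by
    filter_upwards [ae_restrict_mem (measurableSet_cube d)] with x hx hKx
    refine (hf.abs_sub_taylorCoeff_le hβ hL hx₀ hx hh0
      ((hK.norm_le_half hKx).trans (by norm_num))).trans ?_
    calc Cb * h ^ β = κ * (Cb / κ * h ^ β) := by field_simp
      _ ≤ κ * δ := by gcongr; nlinarith
  have hmain := hdev (θ := taylorCoeff (strictFloor β) f x₀ h) (ν := fun i : Fin n =>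
    noiseLaw (g i)) hdes (by positivity) (pow_le_one₀ hh0.le hh.2) hf' (fun i => hν i)
    (convex_coeffBall d _ M) (hf.taylorCoeff_mem_coeffBall hM hx₀ hh0.le hh.2)
    ((by positivity : 0 < (Cb / κ + 1) * h ^ β).trans_le hδA) hδ hbias
  rw [Fintype.card_fin] at hmain
  refine le_trans (ENNReal.toReal_mono (hb := ?_) (measure_mono_ae ?_)) hmain
  · have := isProbabilityMeasure_sampleLaw n hg.1 hf'
    exact measure_ne_top (sampleLaw d n g f) _
  · filter_upwards [ae_fst_mem_cube hg.1 hf'] with z hz (hzδ : δ < |fhat z - f x₀|)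
    obtain ⟨θ, hθ, hmin, hval⟩ := hfhat.exists_isMinOn_empiricalContrast hK hh0 hn hz
    refine ⟨θ, hθ, hmin, hzδ.trans_le ?_⟩
    rw [hval, ← taylorCoeff_zeroIndex (strictFloor β) f x₀ h]
    exact norm_le_pi_norm (θ - taylorCoeff (strictFloor β) f x₀ h) (zeroIndex d _)

/-! ### The upper bound on the risk -/

theorem lintegral_rpow_le_of_exp_tail {Ω : Type*} [MeasurableSpace Ω] {μ : Measure Ω} {T : Ω → ℝ}
    (hT : AEMeasurable T μ) (hT0 : 0 ≤ᵐ[μ] T) {r a C : ℝ} (hr : 0 < r) (ha : 0 < a)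
    (htail : ∀ t > 0, μ {ω | t < T ω} ≤ ENNReal.ofReal (C * Real.exp (-(a * t)))) :
    ∫⁻ ω, ENNReal.ofReal (T ω ^ r) ∂μ ≤
      ENNReal.ofReal r * (ENNReal.ofReal C * ENNReal.ofReal ((1 / a) ^ r * Real.Gamma r)) := by
  have hint : IntegrableOn (fun t : ℝ => t ^ (r - 1) * Real.exp (-(a * t))) (Ioi 0) := by
    simpa using integrableOn_rpow_mul_exp_neg_mul_rpow (s := r - 1) (p := 1) (by linarith)
      one_pos ha
  have hnonneg : ∀ t ∈ Ioi (0 : ℝ), 0 ≤ t ^ (r - 1) * Real.exp (-(a * t)) := fun t ht =>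
    mul_nonneg (Real.rpow_nonneg (le_of_lt ht) _) (Real.exp_pos _).le
  rw [lintegral_rpow_eq_lintegral_meas_lt_mul μ hT0 hT hr,
    ← Real.integral_rpow_mul_exp_neg_mul_Ioi hr ha,
    ofReal_integral_eq_lintegral_ofReal hint
      ((ae_restrict_mem measurableSet_Ioi).mono hnonneg)]
  gcongr ENNReal.ofReal r * ?_
  rw [← lintegral_const_mul' _ _ ENNReal.ofReal_ne_top]
  refine setLIntegral_mono' measurableSet_Ioi fun t ht => ?_
  calc μ {ω | t < T ω} * ENNReal.ofReal (t ^ (r - 1))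
      ≤ ENNReal.ofReal (C * Real.exp (-(a * t))) * ENNReal.ofReal (t ^ (r - 1)) := by
        gcongr
        exact htail t ht
    _ = ENNReal.ofReal C * ENNReal.ofReal (t ^ (r - 1) * Real.exp (-(a * t))) := by
        rw [ENNReal.ofReal_mul' (Real.exp_pos _).le, ENNReal.ofReal_mul' (Real.exp_pos _).le]
        ring

theorem le_exp_of_le_exp_sq {P : ℝ → ℝ} (hanti : Antitone P) (hP0 : ∀ t, 0 ≤ P t)
    (hP1 : ∀ t, P t ≤ 1) {a s A T R C : ℝ} (ha : 0 ≤ a) (hs0 : 0 ≤ s) (hs1 : s ≤ 1)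
    (hA : 1 ≤ A) (hAT : A ≤ T) (hsR : s * R ≤ T) (hR : ∀ t, R ≤ t → P t = 0)
    (hP : ∀ t, A ≤ t → t ≤ T → P t ≤ C * Real.exp (-(a * t ^ 2))) (t : ℝ) :
    P t ≤ (C + Real.exp (a * s ^ 2 * A)) * Real.exp (-(a * s ^ 2 * t)) := by
  have hC : 0 ≤ C := nonneg_of_mul_nonneg_left ((hP0 A).trans (hP A le_rfl hAT)) (Real.exp_pos _)
  rcases le_or_gt R t with hRt | hRt
  · rw [hR t hRt]
    positivity
  rcases le_or_gt t A with htA | htA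
  · calc P t ≤ 1 := hP1 t
      _ ≤ Real.exp (a * s ^ 2 * A) * Real.exp (-(a * s ^ 2 * t)) := by
          rw [← Real.exp_add]
          exact Real.one_le_exp (by nlinarith [mul_nonneg ha (sq_nonneg s)])
      _ ≤ _ := by
          gcongr
          exact le_add_of_nonneg_left hC
  · have ht0 : 0 ≤ t := by linarith
    have hle : s * t ≤ min t T :=
      le_min (mul_le_of_le_one_left ht0 hs1) ((mul_le_mul_of_nonneg_left hRt.le hs0).trans hsR)
    have hsq : a * s ^ 2 * t ≤ a * min t T ^ 2 := by
      calc a * s ^ 2 * t ≤ a * s ^ 2 * t ^ 2 := by gcongr; nlinarith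
        _ = a * (s * t) ^ 2 := by ring
        _ ≤ a * min t T ^ 2 := by gcongr
    calc P t ≤ P (min t T) := hanti (min_le_left _ _)
      _ ≤ C * Real.exp (-(a * min t T ^ 2)) := hP _ (le_min htA.le hAT) (min_le_right _ _)
      _ ≤ (C + Real.exp (a * s ^ 2 * A)) * Real.exp (-(a * s ^ 2 * t)) := by
          gcongr
          exact le_add_of_nonneg_right (Real.exp_pos _).le

section Rates

variable {d : ℕ} {β L : ℝ}

theorem bandwidth_pos (hL : 0 < L) {n : ℕ} (hn : 0 < n) : 0 < bandwidth d β L n := by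
  unfold bandwidth
  positivity

theorem rate_pos {n : ℕ} (hn : 0 < n) : 0 < rate d β n := by
  unfold rate
  positivity

theorem bandwidth_rpow (L : ℝ) (n : ℕ) :
    bandwidth d β L n ^ β = (L ^ 2) ^ (-(β / (2 * β + d))) * rate d β n := by
  rw [bandwidth, rate, ← Real.rpow_mul (by positivity), ← Real.mul_rpow (by positivity)
    (by positivity)]
  congr 1
  ring

theorem bandwidth_pow (L : ℝ) (n : ℕ) :
    bandwidth d β L n ^ d =
      (L ^ 2) ^ (-(d / (2 * β + d))) * (n : ℝ) ^ (-(d / (2 * β + d))) := by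
  rw [bandwidth, ← Real.rpow_natCast, ← Real.rpow_mul (by positivity),
    ← Real.mul_rpow (by positivity) (by positivity)]
  congr 1
  ring

theorem rate_sq (n : ℕ) : rate d β n ^ 2 = (n : ℝ) ^ (-(2 * β / (2 * β + d))) := by
  rw [rate, ← Real.rpow_natCast, ← Real.rpow_mul (Nat.cast_nonneg n)]
  congr 1
  push_cast
  ring

theorem mul_bandwidth_pow_mul_rate_sq (hβ : 0 < β) (L : ℝ) {n : ℕ} (hn : 0 < n) :
    n * bandwidth d β L n ^ d * rate d β n ^ 2 = (L ^ 2) ^ (-(d / (2 * β + d))) := by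
  have hn0 : (0 : ℝ) < n := by exact_mod_cast hn
  have hexp : 1 + -(d / (2 * β + d)) + -(2 * β / (2 * β + d)) = 0 := by
    have : 2 * β + (d : ℝ) ≠ 0 := by positivity
    field_simp
    ring
  have hcancel :
      (n : ℝ) * (n : ℝ) ^ (-(d / (2 * β + d))) * (n : ℝ) ^ (-(2 * β / (2 * β + d))) = 1 := by
    nth_rewrite 1 [← Real.rpow_one (n : ℝ)]
    rw [← Real.rpow_add hn0, ← Real.rpow_add hn0, hexp, Real.rpow_zero]
  rw [bandwidth_pow, rate_sq, mul_left_comm, mul_assoc, hcancel, mul_one]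

theorem tendsto_natCast_rpow_neg {s : ℝ} (hs : 0 < s) :
    Tendsto (fun n : ℕ => (n : ℝ) ^ (-s)) atTop (𝓝 0) :=
  (tendsto_rpow_neg_atTop hs).comp tendsto_natCast_atTop_atTop

theorem tendsto_rate (hβ : 0 < β) : Tendsto (rate d β) atTop (𝓝 0) :=
  tendsto_natCast_rpow_neg (by positivity)

theorem tendsto_bandwidth (hβ : 0 < β) (hL : 0 < L) :
    Tendsto (bandwidth d β L) atTop (𝓝[>] 0) := by
  refine tendsto_nhdsWithin_iff.2 ⟨?_, (eventually_gt_atTop 0).mono fun n hn => bandwidth_pos hL hn⟩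
  have heq : bandwidth d β L = fun n : ℕ =>
      (L ^ 2) ^ (-(1 / (2 * β + d))) * (n : ℝ) ^ (-(1 / (2 * β + d))) :=
    funext fun n => Real.mul_rpow (by positivity) (by positivity)
  rw [heq, ← mul_zero ((L ^ 2) ^ (-(1 / (2 * β + d))))]
  exact (tendsto_natCast_rpow_neg (by positivity)).const_mul _

end Rates

section UpperBound

variable {d : ℕ} {β L M c : ℝ} {x₀ : Fin d → ℝ} {K : (Fin d → ℝ) → ℝ} {ρ : ℝ → ℝ} {g : ℕ → ℝ → ℝ}
  {fhat : ∀ n, Sample d n → ℝ}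

theorem exists_measureReal_rate_lt_le (hβ : 0 < β) (hL : 0 < L) (hM : 0 < M) (hc : 0 < c)
    (hx₀ : x₀ ∈ cube d) (hK : IsKernel K) (hKx₀ : 0 < ∫ z in inwardDirections x₀, K z)
    (hρ : IsContrast ρ g) (hg : g ∈ densityClass ρ c)
    (hfhat : ∀ n, IsLPAEstimator (strictFloor β) M ρ K x₀ (bandwidth d β L n) (fhat n)) :
    ∃ a > 0, ∃ C, ∀ᶠ n in atTop, ∀ f, IsHolder d β L M f → ∀ t,
      (sampleLaw d n g f).real {z | t * rate d β n < |fhat n z - f x₀|} ≤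
        C * Real.exp (-(a * t)) := by
  obtain ⟨A, _, δ₀, hδ₀, a, ha, C, hdev⟩ :=
    exists_measureReal_isLPAEstimator_le hβ hL.le hM.le hc hx₀ hK hKx₀ hρ hg
  set c₁ := (L ^ 2) ^ (-(β / (2 * β + d)))
  set c₂ := (L ^ 2) ^ (-(d / (2 * β + d)))
  set s := min 1 (δ₀ / (2 * M))
  set A' := max 1 (A * c₁)
  refine ⟨a * c₂ * s ^ 2, by positivity, C + Real.exp (a * c₂ * s ^ 2 * A'), ?_⟩
  have hrate : ∀ᶠ n in atTop, A' * rate d β n ≤ δ₀ :=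
    ((tendsto_rate (d := d) hβ).const_mul A').eventually_le_const (by simpa using hδ₀)
  filter_upwards [(tendsto_bandwidth hβ hL).eventually hdev, hrate, eventually_gt_atTop 0]
    with n hdev hrate hn f hf t
  have hφ : 0 < rate d β n := rate_pos hn
  have := isProbabilityMeasure_sampleLaw n hg.1 (hf.aemeasurable hβ hL.le)
  refine le_exp_of_le_exp_sq (T := δ₀ / rate d β n) (R := 2 * M / rate d β n)
    (P := fun t => (sampleLaw d n g f).real {z | t * rate d β n < |fhat n z - f x₀|})
    (fun t₁ t₂ ht => measureReal_mono fun z hz => ?_) (fun t => measureReal_nonneg)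
    (fun t => measureReal_le_one) (by positivity) (by positivity) (min_le_left _ _)
    (le_max_left _ _) ((le_div_iff₀ hφ).2 hrate) ?_ (fun t ht => ?_) (fun t ht₁ ht₂ => ?_) t
  · exact (mul_le_mul_of_nonneg_right ht hφ.le).trans_lt hz
  · rw [← mul_div_assoc]
    gcongr
    exact (le_div_iff₀ (by positivity)).1 (min_le_right _ _)
  · have hempty : {z | t * rate d β n < |fhat n z - f x₀|} = ∅ := by
      refine eq_empty_of_forall_notMem fun z (hz : t * rate d β n < |fhat n z - f x₀|) => ?_
      have := (abs_sub (fhat n z) (f x₀)).trans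
        (add_le_add ((hfhat n).abs_le z) (hf.abs_le hM.le hx₀))
      linarith [(div_le_iff₀ hφ).1 ht]
    rw [hempty, measureReal_empty]
  · refine (hdev hn (hfhat n) hf ?_ ((le_div_iff₀ hφ).1 ht₂)).trans_eq ?_
    · rw [bandwidth_rpow, ← mul_assoc]
      gcongr
      exact (le_max_right _ _).trans ht₁
    · have hc₂ : n * bandwidth d β L n ^ d * rate d β n ^ 2 = c₂ :=
        mul_bandwidth_pow_mul_rate_sq hβ L hn
      rw [← hc₂]
      ring_nf

theorem upperBound_rate (hβ : 0 < β) (hL : 0 < L) (hM : 0 < M) (hc : 0 < c) (hx₀ : x₀ ∈ cube d)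
    (hK : IsKernel K) (hKx₀ : 0 < ∫ z in inwardDirections x₀, K z) (hρ : IsContrast ρ g)
    (hg : g ∈ densityClass ρ c)
    (hfhat : ∀ n, IsLPAEstimator (strictFloor β) M ρ K x₀ (bandwidth d β L n) (fhat n))
    {r : ℝ} (hr : 0 < r) : UpperBound β L M g x₀ r (rate d β) fhat := by
  obtain ⟨a, ha, C, htail⟩ :=
    exists_measureReal_rate_lt_le hβ hL hM hc hx₀ hK hKx₀ hρ hg hfhat
  set S := ENNReal.ofReal r * (ENNReal.ofReal C * ENNReal.ofReal ((1 / a) ^ r * Real.Gamma r))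
  refine lt_of_le_of_lt (b := S) (limsup_le_of_le (h := ?_))
    (by finiteness)
  filter_upwards [htail, eventually_gt_atTop 0] with n htail hn
  have hφ : 0 < rate d β n := rate_pos hn
  rw [maxRisk]
  simp only [ENNReal.mul_iSup]
  refine iSup₂_le fun f hf => ?_
  have := isProbabilityMeasure_sampleLaw n hg.1 (hf.aemeasurable hβ hL.le)
  have herr : Measurable fun z => |fhat n z - f x₀| := ((hfhat n).1.sub_const _).abs
  rw [← lintegral_const_mul _ (herr.pow_const r).ennreal_ofReal]
  calc ∫⁻ z, ENNReal.ofReal (rate d β n ^ (-r)) * ENNReal.ofReal (|fhat n z - f x₀| ^ r)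
        ∂sampleLaw d n g f
      = ∫⁻ z, ENNReal.ofReal ((|fhat n z - f x₀| / rate d β n) ^ r) ∂sampleLaw d n g f := by
        refine lintegral_congr fun z => ?_
        rw [← ENNReal.ofReal_mul (by positivity), Real.div_rpow (abs_nonneg _) hφ.le,
          Real.rpow_neg hφ.le, div_eq_inv_mul]
    _ ≤ S := lintegral_rpow_le_of_exp_tail (herr.div_const _).aemeasurable
        (ae_of_all _ fun z => by positivity) hr ha fun t _ => by
          rw [← ofReal_measureReal]
          simp only [lt_div_iff₀ hφ]
          exact ENNReal.ofReal_le_ofReal (htail f hf t)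

end UpperBound

/-! ### Kullback–Leibler divergence of products and of shifted noise -/

section KullbackLeibler

open InformationTheory ProbabilityTheory

variable {E F : Type*} [MeasurableSpace E] [MeasurableSpace F]

theorem klDiv_map_measurableEquiv (e : E ≃ᵐ F) (μ ν : Measure E) [IsFiniteMeasure μ]
    [IsFiniteMeasure ν] : klDiv (μ.map e) (ν.map e) = klDiv μ ν := by
  refine le_antisymm (klDiv_map_le μ ν e.measurable) ?_
  simpa using klDiv_map_le (μ.map e) (ν.map e) e.symm.measurable

theorem klDiv_prod (μ₁ μ₂ : Measure E) (ν₁ ν₂ : Measure F) [IsProbabilityMeasure μ₁]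
    [IsProbabilityMeasure μ₂] [IsProbabilityMeasure ν₁] [IsProbabilityMeasure ν₂] :
    klDiv (μ₁.prod ν₁) (μ₂.prod ν₂) = klDiv μ₁ μ₂ + klDiv ν₁ ν₂ := by
  have hsnd : klDiv (μ₁.prod ν₁) (μ₁.prod ν₂) = klDiv ν₁ ν₂ := by
    have hswap : ⇑(MeasurableEquiv.prodComm : E × F ≃ᵐ F × E) = Prod.swap := rfl
    rw [← klDiv_map_measurableEquiv MeasurableEquiv.prodComm, hswap, Measure.prod_swap,
      Measure.prod_swap, ← Measure.compProd_const, ← Measure.compProd_const, klDiv_compProd_left]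
  rw [← Measure.compProd_const, ← Measure.compProd_const, klDiv_compProd_eq_add,
    Measure.compProd_const, Measure.compProd_const, hsnd]

theorem klDiv_pi : ∀ {n : ℕ} (μ ν : Fin n → Measure E) [∀ i, IsProbabilityMeasure (μ i)]
    [∀ i, IsProbabilityMeasure (ν i)], klDiv (Measure.pi μ) (Measure.pi ν) = ∑ i, klDiv (μ i) (ν i)
  | 0, μ, ν, _, _ => by rw [Subsingleton.elim μ ν, klDiv_self]; simp
  | n + 1, μ, ν, _, _ => by
    rw [← klDiv_map_measurableEquiv (MeasurableEquiv.piFinSuccAbove (fun _ => E) 0),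
      (measurePreserving_piFinSuccAbove μ 0).map_eq, (measurePreserving_piFinSuccAbove ν 0).map_eq,
      klDiv_prod, klDiv_pi, Fin.sum_univ_succ]
    rfl

theorem klDiv_compProd_eq_lintegral [MeasurableSpace.CountableOrCountablyGenerated E F]
    (π : Measure E) [IsProbabilityMeasure π] (κ η : Kernel E F) [IsMarkovKernel κ]
    [IsMarkovKernel η] (hac : ∀ᵐ x ∂π, κ x ≪ η x) :
    klDiv (π ⊗ₘ κ) (π ⊗ₘ η) = ∫⁻ x, klDiv (κ x) (η x) ∂π := by
  have hκη := κ.measurable_rnDeriv η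
  have hdens : π ⊗ₘ κ = (π ⊗ₘ η).withDensity fun p => κ.rnDeriv η p.1 p.2 := by
    rw [← Measure.compProd_withDensity hκη]
    exact Measure.compProd_congr (hac.mono fun x hx => (Kernel.withDensity_rnDeriv_eq hx).symm)
  have hrn : (π ⊗ₘ κ).rnDeriv (π ⊗ₘ η) =ᵐ[π ⊗ₘ η] fun p => κ.rnDeriv η p.1 p.2 := by
    rw [hdens]
    exact Measure.rnDeriv_withDensity _ hκη
  rw [klDiv_eq_lintegral_klFun_of_ac (Measure.AbsolutelyContinuous.compProd_right hac),
    lintegral_congr_ae (hrn.mono fun p hp =>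
      congrArg (fun t : ℝ≥0∞ => ENNReal.ofReal (klFun t.toReal)) hp),
    Measure.lintegral_compProd (by fun_prop)]
  refine lintegral_congr_ae (hac.mono fun x hx => ?_)
  simp only [klDiv_eq_lintegral_klFun_of_ac hx]
  exact lintegral_congr_ae ((Kernel.rnDeriv_eq_rnDeriv_measure (κ := κ)).mono fun y hy =>
    congrArg (fun t : ℝ≥0∞ => ENNReal.ofReal (klFun t.toReal)) hy)

/-- The conditional law of the response `f x + ξ` given the covariate `x`, as a kernel. -/
def obsKernel (f : E → ℝ) (hf : Measurable f) (ν : Measure ℝ) : Kernel E ℝ :=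
  (Kernel.deterministic f hf ×ₖ Kernel.const E ν).map fun p => p.1 + p.2

variable {f : E → ℝ} {ν : Measure ℝ}

theorem obsKernel_apply [SFinite ν] (hf : Measurable f) (x : E) :
    obsKernel f hf ν x = ν.map (f x + ·) := by
  rw [obsKernel, Kernel.map_apply _ measurable_add, Kernel.prod_apply, Kernel.deterministic_apply,
    Kernel.const_apply, Measure.dirac_prod, Measure.map_map measurable_add measurable_prodMk_left]
  rfl

instance isMarkovKernel_obsKernel [IsProbabilityMeasure ν] (hf : Measurable f) :
    IsMarkovKernel (obsKernel f hf ν) :=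
  Kernel.IsMarkovKernel.map _ measurable_add

theorem obsLaw_eq_compProd (π : Measure E) [SFinite π] [IsProbabilityMeasure ν]
    (hf : Measurable f) : obsLaw π f ν = π ⊗ₘ obsKernel f hf ν := by
  have hobs : Measurable fun w : E × ℝ => (w.1, f w.1 + w.2) := by fun_prop
  ext s hs
  rw [obsLaw, Measure.map_apply hobs hs, Measure.prod_apply (hobs hs), Measure.compProd_apply hs]
  refine lintegral_congr fun x => ?_
  rw [obsKernel_apply, Measure.map_apply (measurable_const_add _) (measurable_prodMk_left hs)]
  rfl

theorem klDiv_obsLaw_zero (π : Measure E) [IsProbabilityMeasure π] [IsProbabilityMeasure ν]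
    (hf : Measurable f) (hac : ∀ x, ν ≪ ν.map (f x + ·)) :
    klDiv (obsLaw π (fun _ => 0) ν) (obsLaw π f ν) =
      ∫⁻ x, klDiv ν (ν.map (f x + ·)) ∂π := by
  rw [obsLaw_eq_compProd π measurable_const, obsLaw_eq_compProd π hf,
    klDiv_compProd_eq_lintegral π _ _ (ae_of_all _ fun x => by simpa [obsKernel_apply] using hac x)]
  simp [obsKernel_apply]

theorem IsNoiseDensity.map_const_add_noiseLaw {g : ℝ → ℝ} (hg : IsNoiseDensity g) (a : ℝ) :
    (noiseLaw g).map (a + ·) = noiseLaw fun u => g (u + -a) := by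
  ext s hs
  rw [Measure.map_apply (measurable_const_add a) hs, noiseLaw, noiseLaw,
    withDensity_apply _ (measurable_const_add a hs), withDensity_apply _ hs]
  have hshift := (measurePreserving_add_left volume a).setLIntegral_comp_preimage hs
    (f := fun u => ENNReal.ofReal (g (u + -a)))
    (hg.measurable.comp (measurable_add_const _)).ennreal_ofReal
  simpa using hshift

-- `x + klFun x = 1 + x log x` is minimal at `x = e⁻¹`.
theorem one_sub_inv_exp_le_add_klFun {x : ℝ} (hx : 0 ≤ x) :
    1 - (Real.exp 1)⁻¹ ≤ x + klFun x := by
  rcases hx.eq_or_lt with rfl | hx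
  · rw [klFun_zero]
    linarith [inv_pos.2 (Real.exp_pos 1)]
  · have hlog := Real.log_le_sub_one_of_pos (x := (x * Real.exp 1)⁻¹) (by positivity)
    rw [Real.log_inv, Real.log_mul hx.ne' (Real.exp_pos 1).ne', Real.log_exp] at hlog
    have hmul := mul_le_mul_of_nonneg_left hlog hx.le
    have hinv : x * (x * Real.exp 1)⁻¹ = (Real.exp 1)⁻¹ := by field_simp
    rw [klFun]
    linarith

theorem one_sub_inv_exp_le_add_klDiv (P Q : Measure E) [IsProbabilityMeasure P]
    [IsProbabilityMeasure Q] {A : Set E} (hA : MeasurableSet A) :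
    ENNReal.ofReal (1 - (Real.exp 1)⁻¹) ≤ P A + Q Aᶜ + klDiv P Q := by
  by_cases hac : P ≪ Q
  swap
  · simp [klDiv_of_not_ac hac]
  have hPA : P A = ∫⁻ z in A, P.rnDeriv Q z ∂Q := (Measure.setLIntegral_rnDeriv hac A).symm
  rw [hPA, ← lintegral_indicator hA, ← lintegral_indicator_one hA.compl,
    klDiv_eq_lintegral_klFun_of_ac hac,
    ← lintegral_add_right _ (measurable_one.indicator hA.compl),
    ← lintegral_add_right _ (by fun_prop)]
  calc ENNReal.ofReal (1 - (Real.exp 1)⁻¹) = ∫⁻ _, ENNReal.ofReal (1 - (Real.exp 1)⁻¹) ∂Q := by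
        simp
    _ ≤ _ := lintegral_mono_ae ?_
  filter_upwards [P.rnDeriv_lt_top Q] with z hz
  by_cases hzA : z ∈ A
  · have hbound := ENNReal.ofReal_le_ofReal
      (one_sub_inv_exp_le_add_klFun (x := (P.rnDeriv Q z).toReal) ENNReal.toReal_nonneg)
    rw [ENNReal.ofReal_add ENNReal.toReal_nonneg (klFun_nonneg ENNReal.toReal_nonneg),
      ENNReal.ofReal_toReal hz.ne] at hbound
    simpa [hzA] using hbound
  · have hle : ENNReal.ofReal (1 - (Real.exp 1)⁻¹) ≤ 1 :=
      ENNReal.ofReal_le_one.2 (sub_le_self _ (inv_pos.2 (Real.exp_pos 1)).le)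
    simpa [hzA] using hle.trans le_self_add

end KullbackLeibler

/-! ### Smooth bumps in the Hölder class -/

section Bump

variable {d : ℕ} {x₀ : Fin d → ℝ} {h : ℝ}

/-- The tensor product `C ∏ᵢ Gᵢ((xᵢ - x₀ᵢ)/h)`, a family closed under partial derivatives up to the
values of `C` and `G`; bumps at `x₀` of width `h` are of this form. -/
def scaledProd (x₀ : Fin d → ℝ) (h C : ℝ) (G : Fin d → ℝ → ℝ) (x : Fin d → ℝ) : ℝ :=
  C * ∏ i, G i (rescale x₀ h x i)

theorem hasDerivAt_scaledProd (C : ℝ) {G : Fin d → ℝ → ℝ} (j : Fin d)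
    (hG : Differentiable ℝ (G j)) (x : Fin d → ℝ) (t : ℝ) :
    HasDerivAt (fun t => scaledProd x₀ h C G (Function.update x j t))
      (scaledProd x₀ h (C / h) (Function.update G j (deriv (G j))) (Function.update x j t)) t := by
  have hsplit : ∀ (c : ℝ) (F : ℝ → ℝ) (s : ℝ),
      scaledProd x₀ h c (Function.update G j F) (Function.update x j s) =
        c * (F ((s - x₀ j) / h) * ∏ i ∈ Finset.univ.erase j, G i (rescale x₀ h x i)) := by
    intro c F s
    rw [scaledProd, ← Finset.mul_prod_erase _ _ (Finset.mem_univ j)]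
    simp only [Function.update_self, rescale]
    congr 2
    refine Finset.prod_congr rfl fun i hi => ?_
    rw [Function.update_of_ne (Finset.ne_of_mem_erase hi),
      Function.update_of_ne (Finset.ne_of_mem_erase hi)]
  have hself := hsplit C (G j)
  simp only [Function.update_eq_self] at hself
  simp only [hself, hsplit]
  have harg : HasDerivAt (fun s : ℝ => (s - x₀ j) / h) (1 / h) t :=
    ((hasDerivAt_id t).sub_const _).div_const h
  have hfactor := ((hG ((t - x₀ j) / h)).hasDerivAt.comp t harg).mul_const
    (∏ i ∈ Finset.univ.erase j, G i (rescale x₀ h x i))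
  refine (hfactor.const_mul C).congr_deriv ?_
  ring

theorem partialDeriv_eqOn_scaledProd {C : ℝ} {G : Fin d → ℝ → ℝ} {f : (Fin d → ℝ) → ℝ}
    (hf : EqOn f (scaledProd x₀ h C G) (cube d)) (j : Fin d) (hG : Differentiable ℝ (G j)) :
    EqOn (partialDeriv j f)
      (scaledProd x₀ h (C / h) (Function.update G j (deriv (G j)))) (cube d) := by
  intro x hx
  have hxj := apply_mem_Icc_of_mem_cube hx j
  have hderiv := (hasDerivAt_scaledProd (x₀ := x₀) (h := h) C j hG x (x j)).hasDerivWithinAt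
    (s := Icc 0 1)
  rw [Function.update_eq_self] at hderiv
  exact (hderiv.congr_of_mem (fun t ht => hf (update_mem_cube hx j ht)) hxj).derivWithin
    (uniqueDiffOn_Icc_zero_one _ hxj)

theorem differentiable_iterate_deriv {η : ℝ → ℝ} (hη : ContDiff ℝ (⊤ : ℕ∞) η) (k : ℕ) :
    Differentiable ℝ (deriv^[k] η) :=
  (hη.iterate_deriv k).differentiable (by simp)

theorem iterate_partialDeriv_eqOn {C : ℝ} {G : Fin d → ℝ → ℝ} {f : (Fin d → ℝ) → ℝ}
    (hf : EqOn f (scaledProd x₀ h C G) (cube d)) (j : Fin d) (hG : ContDiff ℝ (⊤ : ℕ∞) (G j)) :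
    ∀ k : ℕ, EqOn ((partialDeriv j)^[k] f)
      (scaledProd x₀ h (C / h ^ k) (Function.update G j (deriv^[k] (G j)))) (cube d)
  | 0 => by simpa using hf
  | k + 1 => by
    have ih := iterate_partialDeriv_eqOn hf j hG k
    have hstep := partialDeriv_eqOn_scaledProd ih j
      (by simpa using differentiable_iterate_deriv hG k)
    simp only [Function.update_idem, Function.update_self] at hstep
    rw [Function.iterate_succ_apply', Function.iterate_succ_apply', pow_succ, ← div_div]
    exact hstep

theorem foldr_partialDeriv_eqOn_scaledProd {C : ℝ} {η : ℝ → ℝ} (hη : ContDiff ℝ (⊤ : ℕ∞) η)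
    {f : (Fin d → ℝ) → ℝ} (hf : EqOn f (scaledProd x₀ h C fun _ => η) (cube d)) (p : Fin d → ℕ) :
    ∀ l : List (Fin d), l.Nodup →
      EqOn (l.foldr (fun j g => (partialDeriv j)^[p j] g) f)
        (scaledProd x₀ h (C / h ^ (l.map p).sum) fun j => if j ∈ l then deriv^[p j] η else η)
        (cube d)
  | [], _ => by simpa using hf
  | a :: l, hl => by
    rw [List.nodup_cons] at hl
    have hstep := iterate_partialDeriv_eqOn (foldr_partialDeriv_eqOn_scaledProd hη hf p l hl.2) a
      (by simpa [hl.1] using hη) (p a)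
    have hupdate : (fun j => if j ∈ a :: l then deriv^[p j] η else η) =
        Function.update (fun j => if j ∈ l then deriv^[p j] η else η) a
          (deriv^[p a] (if a ∈ l then deriv^[p a] η else η)) := by
      ext1 j
      rcases eq_or_ne j a with rfl | hja
      · simp [hl.1]
      · simp [hja]
    rwa [List.foldr_cons, hupdate, List.map_cons, List.sum_cons, add_comm, pow_add, ← div_div]

theorem iterPartial_eqOn_scaledProd {C : ℝ} {η : ℝ → ℝ} (hη : ContDiff ℝ (⊤ : ℕ∞) η)
    {f : (Fin d → ℝ) → ℝ} (hf : EqOn f (scaledProd x₀ h C fun _ => η) (cube d)) (p : Fin d → ℕ) :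
    EqOn (iterPartial p f) (scaledProd x₀ h (C / h ^ ∑ j, p j) fun j => deriv^[p j] η)
      (cube d) := by
  have hfold := foldr_partialDeriv_eqOn_scaledProd hη hf p _ (List.nodup_finRange d)
  simpa [iterPartial, List.sum_ofFn, ← List.ofFn_eq_map] using hfold

theorem differentiableWithinAt_iterPartial_scaledProd {C : ℝ} {η : ℝ → ℝ}
    (hη : ContDiff ℝ (⊤ : ℕ∞) η) (p : Fin d → ℕ) (j : Fin d) {x : Fin d → ℝ} (hx : x ∈ cube d) :
    DifferentiableWithinAt ℝ
      (fun t => iterPartial p (scaledProd x₀ h C fun _ => η) (Function.update x j t))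
      (Icc 0 1) (x j) := by
  have heq := iterPartial_eqOn_scaledProd (x₀ := x₀) (h := h) (C := C) hη (eqOn_refl _ _) p
  have hxj := apply_mem_Icc_of_mem_cube hx j
  exact ((hasDerivAt_scaledProd (x₀ := x₀) (h := h) _ j (differentiable_iterate_deriv hη (p j)) x
    (x j)).differentiableAt.differentiableWithinAt).congr
    (fun t ht => heq (update_mem_cube hx j ht)) (heq (update_mem_cube hx j hxj))

theorem hasCompactSupport_prod {G : Fin d → ℝ → ℝ} (hG : ∀ i, HasCompactSupport (G i)) :
    HasCompactSupport fun u : Fin d → ℝ => ∏ i, G i (u i) := by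
  refine HasCompactSupport.intro (isCompact_univ_pi fun i => hG i) fun u hu => ?_
  simp only [mem_univ_pi, not_forall] at hu
  obtain ⟨i, hi⟩ := hu
  exact Finset.prod_eq_zero (Finset.mem_univ i) (image_eq_zero_of_notMem_tsupport hi)

theorem exists_bound_prod_deriv {η : ℝ → ℝ} (hη : ContDiff ℝ (⊤ : ℕ∞) η)
    (hηc : HasCompactSupport η) (p : Fin d → ℕ) :
    ∃ B : ℝ, 0 ≤ B ∧ (∀ u : Fin d → ℝ, |∏ i, (deriv^[p i] η) (u i)| ≤ B) ∧
      ∀ u v : Fin d → ℝ, |∏ i, (deriv^[p i] η) (u i) - ∏ i, (deriv^[p i] η) (v i)| ≤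
        B * ∑ i, |u i - v i| := by
  have hsupp : ∀ k, HasCompactSupport (deriv^[k] η) := fun k => by
    induction k with
    | zero => exact hηc
    | succ k ih => rw [Function.iterate_succ_apply']; exact ih.deriv
  have hsm : ContDiff ℝ (⊤ : ℕ∞) fun u : Fin d → ℝ => ∏ i, (deriv^[p i] η) (u i) :=
    contDiff_prod fun i _ => (hη.iterate_deriv (p i)).comp (contDiff_apply ℝ ℝ i)
  have hcs : HasCompactSupport fun u : Fin d → ℝ => ∏ i, (deriv^[p i] η) (u i) :=
    hasCompactSupport_prod fun i => hsupp (p i)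
  obtain ⟨B₁, hB₁⟩ := hcs.exists_bound_of_continuous hsm.continuous
  obtain ⟨B₂, hB₂⟩ := hsm.lipschitzWith_of_hasCompactSupport hcs (by simp)
  have hB₁_nonneg : 0 ≤ B₁ := (norm_nonneg _).trans (hB₁ 0)
  refine ⟨B₁ + B₂, by positivity, fun u => (hB₁ u).trans (by simp), fun u v => ?_⟩
  have hdist := hB₂.dist_le_mul u v
  rw [Real.dist_eq, dist_eq_norm] at hdist
  have hnorm : ‖u - v‖ ≤ ∑ i, |u i - v i| :=
    (pi_norm_le_iff_of_nonneg (Finset.sum_nonneg fun _ _ => abs_nonneg _)).2 fun i =>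
      Finset.single_le_sum (f := fun i => |u i - v i|) (fun _ _ => abs_nonneg _)
        (Finset.mem_univ i)
  refine hdist.trans (mul_le_mul ?_ hnorm (norm_nonneg _) (by positivity))
  linarith

theorem le_mul_rpow_of_le_of_le_mul {y B s γ : ℝ} (hB : 0 ≤ B) (hs : 0 ≤ s) (hγ0 : 0 ≤ γ)
    (hγ1 : γ ≤ 1) (h1 : y ≤ B) (h2 : y ≤ B * s) : y ≤ B * s ^ γ := by
  rcases le_total s 1 with hs1 | hs1
  · refine h2.trans (mul_le_mul_of_nonneg_left ?_ hB)
    simpa using Real.rpow_le_rpow_of_exponent_ge_of_imp hs hs1 hγ1 (by simp)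
  · exact h1.trans (le_mul_of_one_le_right hB (Real.one_le_rpow hs1 hγ0))

theorem sum_abs_rescale_sub (hh : 0 ≤ h) (x y : Fin d → ℝ) :
    ∑ i, |rescale x₀ h x i - rescale x₀ h y i| = (∑ i, |x i - y i|) / h := by
  rw [Finset.sum_div]
  refine Finset.sum_congr rfl fun i _ => ?_
  rw [rescale, rescale, ← sub_div, sub_sub_sub_cancel_right, abs_div, abs_of_nonneg hh]

theorem abs_scaledProd_sub_le {G : Fin d → ℝ → ℝ} {B C γ : ℝ} (hh : 0 ≤ h) (hC : 0 ≤ C)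
    (hγ₀ : 0 ≤ γ) (hγ₁ : γ ≤ 1) (hbound : ∀ u : Fin d → ℝ, |∏ i, G i (u i)| ≤ B)
    (hlip : ∀ u v : Fin d → ℝ,
      |∏ i, G i (u i) - ∏ i, G i (v i)| ≤ B * ∑ i, |u i - v i|) (x y : Fin d → ℝ) :
    |scaledProd x₀ h C G x - scaledProd x₀ h C G y| ≤
      C * (2 * B) / h ^ γ * (∑ i, |x i - y i|) ^ γ := by
  have hB : 0 ≤ B := (abs_nonneg _).trans (hbound 0)
  have hs (u v : Fin d → ℝ) : 0 ≤ ∑ i, |u i - v i| := Finset.sum_nonneg fun _ _ => abs_nonneg _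
  set u := rescale x₀ h x with hu
  set v := rescale x₀ h y with hv
  have hprod : |∏ i, G i (u i) - ∏ i, G i (v i)| ≤ 2 * B * (∑ i, |u i - v i|) ^ γ :=
    le_mul_rpow_of_le_of_le_mul (by positivity) (hs u v) hγ₀ hγ₁
      ((abs_sub _ _).trans (by linarith [hbound u, hbound v]))
      ((hlip u v).trans (by gcongr; linarith))
  rw [hu, hv, sum_abs_rescale_sub hh, Real.div_rpow (hs x y) hh] at hprod
  calc |scaledProd x₀ h C G x - scaledProd x₀ h C G y|
      = C * |∏ i, G i (u i) - ∏ i, G i (v i)| := by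
        rw [scaledProd, scaledProd, ← mul_sub, abs_mul, abs_of_nonneg hC]
    _ ≤ C * (2 * B * ((∑ i, |x i - y i|) ^ γ / h ^ γ)) := by gcongr
    _ = C * (2 * B) / h ^ γ * (∑ i, |x i - y i|) ^ γ := by ring

theorem iSup_abs_iterPartial_scaledProd_le {η : ℝ → ℝ} (hη : ContDiff ℝ (⊤ : ℕ∞) η) {a β B : ℝ}
    (hh : 0 < h) (hh₁ : h ≤ 1) (ha : 0 ≤ a) {p : Fin d → ℕ} (hp : (∑ j, p j : ℕ) ≤ β)
    (hbound : ∀ u : Fin d → ℝ, |∏ i, (deriv^[p i] η) (u i)| ≤ B) :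
    ⨆ x ∈ cube d, ENNReal.ofReal |iterPartial p (scaledProd x₀ h (a * h ^ β) fun _ => η) x| ≤
      ENNReal.ofReal (a * B) := by
  refine iSup₂_le fun x hx => ENNReal.ofReal_le_ofReal ?_
  have hscale : a * h ^ β / h ^ ∑ j, p j ≤ a := by
    rw [mul_div_assoc, ← Real.rpow_natCast, ← Real.rpow_sub hh]
    exact mul_le_of_le_one_right ha (Real.rpow_le_one hh.le hh₁ (sub_nonneg.2 hp))
  rw [iterPartial_eqOn_scaledProd hη (eqOn_refl _ _) p hx, scaledProd, abs_mul,
    abs_of_nonneg (by positivity)]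
  exact mul_le_mul hscale (hbound _) (abs_nonneg _) ha

theorem exists_isHolder_bump {β L M : ℝ} (hβ : 0 < β) (hL : 0 < L) (hM : 0 < M) {η : ℝ → ℝ}
    (hη : ContDiff ℝ (⊤ : ℕ∞) η) (hηc : HasCompactSupport η) (d : ℕ) :
    ∃ a₀ : ℝ, 0 < a₀ ∧ ∀ x₀ : Fin d → ℝ, ∀ h, 0 < h → h ≤ 1 → ∀ a, 0 ≤ a → a ≤ a₀ →
      IsHolder d β L M (scaledProd x₀ h (a * h ^ β) fun _ => η) := by
  set b := strictFloor β
  have hb : (b : ℝ) < β := strictFloor_lt hβ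
  have hβb : β ≤ b + 1 := le_strictFloor_add_one β
  choose B hB₀ hbound hlip using fun p : Fin d → ℕ => exists_bound_prod_deriv hη hηc p
  set A := ∑ p ∈ multiIndices d b, B p
  have hA₀ : 0 ≤ A := Finset.sum_nonneg fun p _ => hB₀ p
  refine ⟨min (L / (2 * A + 1)) (M / (A + 1)), by positivity, fun x₀ h hh hh₁ a ha haa => ?_⟩
  have haL : a * (2 * A + 1) ≤ L := (le_div_iff₀ (by positivity)).1 (haa.trans (min_le_left _ _))
  have haM : a * (A + 1) ≤ M := (le_div_iff₀ (by positivity)).1 (haa.trans (min_le_right _ _))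
  refine ⟨fun p _ j x hx => differentiableWithinAt_iterPartial_scaledProd hη p j hx,
    fun p hp x hx y hy => ?_, ?_⟩
  · have heq := iterPartial_eqOn_scaledProd (x₀ := x₀) (h := h) hη
      (eqOn_refl (scaledProd x₀ h (a * h ^ β) fun _ => η) (cube d)) p
    have hBA : B p ≤ A :=
      Finset.single_le_sum (fun p _ => hB₀ p) (mem_multiIndices.2 hp.le)
    have hscale : a * h ^ β / h ^ b * (2 * B p) / h ^ (β - b) = a * (2 * B p) := by
      rw [Real.rpow_sub hh, Real.rpow_natCast]
      field_simp
    rw [heq hx, heq hy, hp]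
    refine (abs_scaledProd_sub_le hh.le (by positivity) (sub_nonneg.2 hb.le) (by linarith)
      (hbound p) (hlip p) x y).trans ?_
    rw [hscale]
    gcongr
    nlinarith
  · have hsup (p : Fin d → ℕ) (hp : p ∈ multiIndices d b) :=
      iSup_abs_iterPartial_scaledProd_le (x₀ := x₀) (β := β) hη hh hh₁ ha
        ((Nat.cast_le.2 (mem_multiIndices.1 hp)).trans hb.le) (hbound p)
    refine (Finset.sum_le_sum hsup).trans ?_
    rw [← ENNReal.ofReal_sum_of_nonneg fun p _ => mul_nonneg ha (hB₀ p), ← Finset.mul_sum]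
    exact ENNReal.ofReal_le_ofReal (by linarith)

end Bump

/-! ### The lower bound on the minimax risk -/

section LowerBound

open InformationTheory

theorem ofReal_mul_le_risk {Ω : Type*} [MeasurableSpace Ω] {μ : Measure Ω} {A : Set Ω}
    (hA : MeasurableSet A) {T : Ω → ℝ} {s r y : ℝ} (hs : 0 ≤ s) (hr : 0 ≤ r)
    (hT : ∀ z ∈ A, s ≤ T z) (hy : ENNReal.ofReal y ≤ μ A) :
    ENNReal.ofReal (s ^ r * y) ≤ ∫⁻ z, ENNReal.ofReal (T z ^ r) ∂μ := by
  calc ENNReal.ofReal (s ^ r * y) ≤ ENNReal.ofReal (s ^ r) * μ A := by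
        rw [ENNReal.ofReal_mul (by positivity)]
        gcongr
    _ = ∫⁻ _ in A, ENNReal.ofReal (s ^ r) ∂μ := (setLIntegral_const A _).symm
    _ ≤ ∫⁻ z in A, ENNReal.ofReal (T z ^ r) ∂μ :=
        setLIntegral_mono' hA fun z hz =>
          ENNReal.ofReal_le_ofReal (Real.rpow_le_rpow hs (hT z hz) hr)
    _ ≤ ∫⁻ z, ENNReal.ofReal (T z ^ r) ∂μ := setLIntegral_le_lintegral A _

theorem klDiv_obsLaw_noiseLaw_le {d : ℕ} {f : (Fin d → ℝ) → ℝ} (hf : Measurable f) {g : ℝ → ℝ}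
    (hg : IsNoiseDensity g) {κ v₀ : ℝ} (hkl : ∀ v, |v| ≤ v₀ →
      klDiv (noiseLaw g) (noiseLaw fun u => g (u + v)) ≤ ENNReal.ofReal (κ * v ^ 2))
    (hfv : ∀ x, |f x| ≤ v₀) :
    klDiv (obsLaw (volume.restrict (cube d)) (fun _ => 0) (noiseLaw g))
      (obsLaw (volume.restrict (cube d)) f (noiseLaw g)) ≤
        ∫⁻ x in cube d, ENNReal.ofReal (κ * f x ^ 2) := by
  have hν := hg.isProbabilityMeasure
  have hshift (x : Fin d → ℝ) : klDiv (noiseLaw g) ((noiseLaw g).map (f x + ·)) ≤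
      ENNReal.ofReal (κ * f x ^ 2) := by
    rw [hg.map_const_add_noiseLaw, ← neg_sq]
    exact hkl _ (by rw [abs_neg]; exact hfv x)
  rw [klDiv_obsLaw_zero _ hf fun x =>
    (klDiv_ne_top_iff.1 ((hshift x).trans_lt ENNReal.ofReal_lt_top).ne).1]
  exact lintegral_mono hshift

theorem klDiv_sampleLaw_le {d : ℕ} (n : ℕ) {f : (Fin d → ℝ) → ℝ} (hf : Measurable f)
    {g : ℕ → ℝ → ℝ} (hg : ∀ i, IsNoiseDensity (g i)) {κ v₀ : ℝ} (hkl : ∀ i, ∀ v, |v| ≤ v₀ →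
      klDiv (noiseLaw (g i)) (noiseLaw fun u => g i (u + v)) ≤ ENNReal.ofReal (κ * v ^ 2))
    (hfv : ∀ x, |f x| ≤ v₀) :
    klDiv (sampleLaw d n g fun _ => 0) (sampleLaw d n g f) ≤
      n * ∫⁻ x in cube d, ENNReal.ofReal (κ * f x ^ 2) := by
  have hν := fun i => (hg i).isProbabilityMeasure
  have hobs {f : (Fin d → ℝ) → ℝ} (hf : Measurable f) (i : Fin n) :
      IsProbabilityMeasure (obsLaw (volume.restrict (cube d)) f (noiseLaw (g i))) :=
    isProbabilityMeasure_obsLaw hf.aemeasurable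
  have hobs₀ := hobs (f := fun _ => 0) measurable_const
  have hobs₁ := hobs hf
  calc klDiv (sampleLaw d n g fun _ => 0) (sampleLaw d n g f)
      = ∑ i : Fin n, klDiv (obsLaw (volume.restrict (cube d)) (fun _ => 0) (noiseLaw (g i)))
          (obsLaw (volume.restrict (cube d)) f (noiseLaw (g i))) :=
        klDiv_pi (fun i : Fin n => obsLaw (volume.restrict (cube d)) (fun _ => 0) (noiseLaw (g i)))
          fun i : Fin n => obsLaw (volume.restrict (cube d)) f (noiseLaw (g i))
    _ ≤ ∑ _i : Fin n, ∫⁻ x in cube d, ENNReal.ofReal (κ * f x ^ 2) :=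
        Finset.sum_le_sum fun i _ => klDiv_obsLaw_noiseLaw_le hf (hg i) (hkl i) hfv
    _ = n * ∫⁻ x in cube d, ENNReal.ofReal (κ * f x ^ 2) := by simp

theorem quarter_le_or_quarter_le_of_klDiv_le {Ω : Type*} [MeasurableSpace Ω] {P Q : Measure Ω}
    [IsProbabilityMeasure P] [IsProbabilityMeasure Q] (hkl : klDiv P Q ≤ ENNReal.ofReal (1 / 8))
    {A : Set Ω} (hA : MeasurableSet A) :
    ENNReal.ofReal (1 / 4) ≤ P A ∨ ENNReal.ofReal (1 / 4) ≤ Q Aᶜ := by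
  by_contra! hlt
  have hexp : (Real.exp 1)⁻¹ ≤ 3 / 8 := by
    rw [inv_le_comm₀ (Real.exp_pos 1) (by norm_num)]
    linarith [Real.exp_one_gt_d9]
  have hsum : P A + Q Aᶜ + klDiv P Q < ENNReal.ofReal (1 / 4 + 1 / 4 + 1 / 8) := by
    rw [ENNReal.ofReal_add (by norm_num) (by norm_num), ENNReal.ofReal_add (by norm_num)
      (by norm_num)]
    exact ENNReal.add_lt_add_of_lt_of_le (ne_top_of_le_ne_top ENNReal.ofReal_ne_top hkl)
      (ENNReal.add_lt_add hlt.1 hlt.2) hkl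
  refine absurd ((one_sub_inv_exp_le_add_klDiv P Q hA).trans_lt hsum) (not_lt.2 ?_)
  exact ENNReal.ofReal_le_ofReal (by linarith)

theorem le_maxRisk_of_klDiv_le {d n : ℕ} {β L M : ℝ} {g : ℕ → ℝ → ℝ}
    (hg : ∀ i, IsNoiseDensity (g i)) {x₀ : Fin d → ℝ} {f : (Fin d → ℝ) → ℝ} (hf : Measurable f)
    (hf₀ : IsHolder d β L M fun _ => 0) (hf₁ : IsHolder d β L M f) {s r : ℝ} (hs : 0 ≤ s)
    (hr : 0 ≤ r) (hkl : klDiv (sampleLaw d n g fun _ => 0) (sampleLaw d n g f) ≤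
      ENNReal.ofReal (1 / 8)) (hsf : 2 * s ≤ f x₀) {fhat : Sample d n → ℝ}
    (hfhat : Measurable fhat) :
    ENNReal.ofReal (s ^ r * (1 / 4)) ≤ maxRisk β L M g x₀ r fhat := by
  have := isProbabilityMeasure_sampleLaw n hg (f := fun _ : Fin d → ℝ => 0) aemeasurable_const
  have := isProbabilityMeasure_sampleLaw n hg (f := f) hf.aemeasurable
  have hA : MeasurableSet {z | s ≤ |fhat z|} := measurableSet_le measurable_const hfhat.abs
  rcases quarter_le_or_quarter_le_of_klDiv_le hkl hA with hprob | hprob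
  · exact (ofReal_mul_le_risk hA hs hr (T := fun z => |fhat z - 0|)
      (fun z hz => by rwa [sub_zero]) hprob).trans (le_iSup₂_of_le _ hf₀ le_rfl)
  · refine (ofReal_mul_le_risk hA.compl hs hr (T := fun z => |fhat z - f x₀|)
      (fun z hz => ?_) hprob).trans (le_iSup₂_of_le _ hf₁ le_rfl)
    have hz : |fhat z| < s := not_le.1 hz
    rw [abs_sub_comm]
    linarith [le_abs_self (fhat z), le_abs_self (f x₀ - fhat z)]

theorem isHolder_zero (d : ℕ) {β L M : ℝ} (hβ : 0 < β) (hL : 0 < L) (hM : 0 < M) :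
    IsHolder d β L M fun _ => 0 := by
  obtain ⟨a₀, ha₀, hholder⟩ :=
    exists_isHolder_bump hβ hL hM (η := fun _ => 0) contDiff_const HasCompactSupport.zero d
  have hzero : scaledProd (0 : Fin d → ℝ) 1 (0 * 1 ^ β) (fun _ _ => 0) = fun _ => 0 := by
    ext x
    simp [scaledProd]
  exact hzero ▸ hholder 0 1 one_pos le_rfl 0 le_rfl ha₀.le

section ScaledProd

variable {d : ℕ} {x₀ : Fin d → ℝ} {h C : ℝ} {η : ℝ → ℝ}

theorem abs_scaledProd_le (hη : ∀ t, |η t| ≤ 1) (hC : 0 ≤ C) (x : Fin d → ℝ) :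
    |scaledProd x₀ h C (fun _ => η) x| ≤ C := by
  rw [scaledProd, abs_mul, abs_of_nonneg hC, Finset.abs_prod]
  exact mul_le_of_le_one_right hC (Finset.prod_le_one (fun _ _ => abs_nonneg _) fun i _ => hη _)

theorem measurable_scaledProd (hη : Continuous η) :
    Measurable (scaledProd x₀ h C fun _ => η) :=
  (Finset.measurable_prod _ fun i _ =>
    hη.measurable.comp ((measurable_pi_apply i).comp (measurable_rescale x₀ h))).const_mul C

theorem scaledProd_center (hη : η 0 = 1) : scaledProd x₀ h C (fun _ => η) x₀ = C := by
  simp [scaledProd, rescale, hη]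

theorem setLIntegral_scaledProd_sq_le (s : Set (Fin d → ℝ)) (hh : 0 < h) (hη : Continuous η)
    (hηc : HasCompactSupport η) {κ : ℝ} (hκ : 0 ≤ κ) :
    ∫⁻ x in s, ENNReal.ofReal (κ * scaledProd x₀ h C (fun _ => η) x ^ 2) ≤
      ENNReal.ofReal (κ * (C ^ 2 * (h ^ d * ∫ u : Fin d → ℝ, (∏ i, η (u i)) ^ 2))) := by
  have hcont : Continuous fun u : Fin d → ℝ => ∏ i, η (u i) := by fun_prop
  have hsupp : HasCompactSupport fun u : Fin d → ℝ => ∏ i, η (u i) :=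
    hasCompactSupport_prod fun _ => hηc
  have hsupp_sq : HasCompactSupport fun u : Fin d → ℝ => (∏ i, η (u i)) ^ 2 :=
    hsupp.comp_left (g := fun t : ℝ => t ^ 2) (zero_pow two_ne_zero)
  have hint : Integrable fun u : Fin d → ℝ => (∏ i, η (u i)) ^ 2 :=
    (hcont.pow 2).integrable_of_hasCompactSupport hsupp_sq
  have hbump : Integrable fun x => scaledProd x₀ h C (fun _ => η) x ^ 2 := by
    simp only [scaledProd, mul_pow]
    exact (integrable_rescale x₀ hh.ne' hint).const_mul _
  calc ∫⁻ x in s, ENNReal.ofReal (κ * scaledProd x₀ h C (fun _ => η) x ^ 2)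
      ≤ ∫⁻ x, ENNReal.ofReal (κ * scaledProd x₀ h C (fun _ => η) x ^ 2) :=
        setLIntegral_le_lintegral s _
    _ = ENNReal.ofReal (∫ x, κ * scaledProd x₀ h C (fun _ => η) x ^ 2) :=
        (ofReal_integral_eq_lintegral_ofReal (hbump.const_mul κ)
          (ae_of_all _ fun x => by positivity)).symm
    _ = ENNReal.ofReal (κ * (C ^ 2 * (h ^ d * ∫ u : Fin d → ℝ, (∏ i, η (u i)) ^ 2))) := by
        simp only [scaledProd, mul_pow]
        rw [integral_const_mul, integral_const_mul,
          integral_rescale x₀ hh fun u => (∏ i, η (u i)) ^ 2]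

end ScaledProd

theorem exists_amplitude {a₀ v₀ : ℝ} (ha₀ : 0 < a₀) (hv₀ : 0 < v₀) (J : ℝ) :
    ∃ a, 0 < a ∧ a ≤ a₀ ∧ a ≤ v₀ ∧ J * a ^ 2 ≤ 1 / 8 := by
  have hlim : Tendsto (fun a : ℝ => J * a ^ 2) (𝓝[>] 0) (𝓝 0) :=
    (Continuous.tendsto' (by fun_prop) 0 0 (by simp)).mono_left nhdsWithin_le_nhds
  have hsmall : ∀ᶠ a in 𝓝[>] (0 : ℝ), 0 < a ∧ a ≤ a₀ ∧ a ≤ v₀ ∧ J * a ^ 2 ≤ 1 / 8 := by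
    filter_upwards [self_mem_nhdsWithin, Ioc_mem_nhdsGT ha₀, Ioc_mem_nhdsGT hv₀,
      hlim.eventually_le_const (by norm_num : (0 : ℝ) < 1 / 8)] with a ha haa hav haJ
    exact ⟨ha, haa.2, hav.2, haJ⟩
  exact hsmall.exists

theorem bandwidth_le_one {d n : ℕ} {β : ℝ} (hβ : 0 < β) (hn : 0 < n) : bandwidth d β 1 n ≤ 1 := by
  rw [bandwidth, one_pow, one_mul]
  exact Real.rpow_le_one_of_one_le_of_nonpos (Nat.one_le_cast.2 hn)
    (neg_nonpos.2 (by positivity))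

theorem exists_alternative {d : ℕ} {β L M : ℝ} (hβ : 0 < β) (hL : 0 < L) (hM : 0 < M)
    (x₀ : Fin d → ℝ) {g : ℕ → ℝ → ℝ} (hg : ∀ i, IsNoiseDensity (g i))
    (hkl : KullbackCondition g) :
    ∃ a : ℝ, 0 < a ∧ ∀ n : ℕ, 0 < n → ∃ f : (Fin d → ℝ) → ℝ, Measurable f ∧
      IsHolder d β L M f ∧ f x₀ = a * rate d β n ∧
      klDiv (sampleLaw d n g fun _ => 0) (sampleLaw d n g f) ≤ ENNReal.ofReal (1 / 8) := by
  obtain ⟨v₀, hv₀, κ, hkl⟩ := hkl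
  obtain ⟨η⟩ : Nonempty (ContDiffBump (0 : ℝ)) := inferInstance
  obtain ⟨a₀, ha₀, hholder⟩ := exists_isHolder_bump hβ hL hM η.contDiff η.hasCompactSupport d
  obtain ⟨a, ha, haa₀, hav₀, haJ⟩ := exists_amplitude ha₀ hv₀
    (max κ 0 * ∫ u : Fin d → ℝ, (∏ i, η (u i)) ^ 2)
  refine ⟨a, ha, fun n hn => ?_⟩
  set h := bandwidth d β 1 n
  have hh : 0 < h := bandwidth_pos one_pos hn
  have hh₁ : h ≤ 1 := bandwidth_le_one hβ hn
  have hrate : h ^ β = rate d β n := by simp [h, bandwidth_rpow]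
  have hsize : n * h ^ d * rate d β n ^ 2 = 1 := by
    simp [h, mul_bandwidth_pow_mul_rate_sq hβ 1 hn]
  have hη₁ (t : ℝ) : |η t| ≤ 1 := (abs_of_nonneg η.nonneg).trans_le η.le_one
  have hη₀ : η 0 = 1 := η.one_of_mem_closedBall (Metric.mem_closedBall_self η.rIn_pos.le)
  refine ⟨scaledProd x₀ h (a * h ^ β) fun _ => η, measurable_scaledProd η.continuous,
    hholder x₀ h hh hh₁ a ha.le haa₀, by rw [scaledProd_center hη₀, hrate], ?_⟩
  have hsup (x : Fin d → ℝ) : |scaledProd x₀ h (a * h ^ β) (fun _ => η) x| ≤ v₀ :=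
    (abs_scaledProd_le hη₁ (by positivity) x).trans
      ((mul_le_of_le_one_right ha.le (Real.rpow_le_one hh.le hh₁ hβ.le)).trans hav₀)
  have hkl₀ (i : ℕ) (v : ℝ) (hv : |v| ≤ v₀) := (hkl i v hv).trans
    (ENNReal.ofReal_le_ofReal (mul_le_mul_of_nonneg_right (le_max_left κ 0) (sq_nonneg v)))
  refine (klDiv_sampleLaw_le n (measurable_scaledProd η.continuous) hg hkl₀ hsup).trans ?_
  grw [setLIntegral_scaledProd_sq_le _ hh η.continuous η.hasCompactSupport (le_max_right κ 0)]
  rw [← ENNReal.ofReal_natCast, ← ENNReal.ofReal_mul (by positivity), hrate]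
  refine ENNReal.ofReal_le_ofReal (le_of_eq_of_le ?_ haJ)
  linear_combination max κ 0 * (∫ u : Fin d → ℝ, (∏ i, η (u i)) ^ 2) * a ^ 2 * hsize

theorem exists_minimaxRisk_lower_bound {d : ℕ} {β L M : ℝ} (hβ : 0 < β) (hL : 0 < L) (hM : 0 < M)
    (x₀ : Fin d → ℝ) {g : ℕ → ℝ → ℝ} (hg : ∀ i, IsNoiseDensity (g i)) (hkl : KullbackCondition g)
    {r : ℝ} (hr : 0 ≤ r) : ∃ C : ℝ≥0∞, 0 < C ∧ ∀ n : ℕ, 0 < n →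
      C ≤ ENNReal.ofReal (rate d β n ^ (-r)) * minimaxRisk n β L M g x₀ r := by
  obtain ⟨a, ha, halt⟩ := exists_alternative hβ hL hM x₀ hg hkl
  refine ⟨ENNReal.ofReal ((a / 2) ^ r * (1 / 4)), ENNReal.ofReal_pos.2 (by positivity),
    fun n hn => ?_⟩
  obtain ⟨f, hf, hholder, hfx₀, hklf⟩ := halt n hn
  have hφ : 0 < rate d β n := rate_pos hn
  have hrisk : ENNReal.ofReal ((a / 2 * rate d β n) ^ r * (1 / 4)) ≤
      minimaxRisk n β L M g x₀ r :=
    le_iInf₂ fun fhat hfhat => le_maxRisk_of_klDiv_le hg hf (isHolder_zero d hβ hL hM) hholder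
      (by positivity) hr hklf (by rw [hfx₀]; linarith) hfhat
  have hcancel : rate d β n ^ (-r) * rate d β n ^ r = 1 := by
    rw [← Real.rpow_add hφ, neg_add_cancel, Real.rpow_zero]
  calc ENNReal.ofReal ((a / 2) ^ r * (1 / 4))
      = ENNReal.ofReal (rate d β n ^ (-r)) *
          ENNReal.ofReal ((a / 2 * rate d β n) ^ r * (1 / 4)) := by
        rw [← ENNReal.ofReal_mul (by positivity), Real.mul_rpow (by positivity) hφ.le]
        congr 1
        linear_combination (-(a / 2) ^ r * (1 / 4)) * hcancel
    _ ≤ _ := by gcongr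

theorem isMinimax_of_upperBound {d : ℕ} {β L M : ℝ} (hβ : 0 < β) (hL : 0 < L) (hM : 0 < M)
    {x₀ : Fin d → ℝ} {g : ℕ → ℝ → ℝ} (hg : ∀ i, IsNoiseDensity (g i)) (hkl : KullbackCondition g)
    {r : ℝ} (hr : 0 ≤ r) {fhat : ∀ n, Sample d n → ℝ} (hfhat : ∀ n, Measurable (fhat n))
    (hupper : UpperBound β L M g x₀ r (rate d β) fhat) :
    IsMinimax β L M g x₀ r (rate d β) fhat := by
  obtain ⟨C, hC, hle⟩ := exists_minimaxRisk_lower_bound hβ hL hM x₀ hg hkl hr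
  have hminimax := (eventually_gt_atTop 0).mono hle
  refine ⟨hC.trans_le (le_liminf_of_le (h := hminimax)),
    hC.trans_le (le_liminf_of_le (h := hminimax.mono fun n hn => hn.trans ?_)), hupper⟩
  gcongr
  exact iInf₂_le (fhat n) (hfhat n)

end LowerBound

end RhoLPA

end

theorem theorem1_general (d : ℕ) (β L M c : ℝ) (hβ : 0 < β) (hL : 0 < L) (hM : 0 < M)
    (hc : 0 < c) (x₀ : Fin d → ℝ) (hx₀ : x₀ ∈ RhoLPA.cube d)
    (K : (Fin d → ℝ) → ℝ) (hK : RhoLPA.IsKernel K)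
    (hKx₀ : 0 < ∫ z in RhoLPA.inwardDirections x₀, K z)
    (ρ : ℝ → ℝ) (g : ℕ → ℝ → ℝ) (hρ : RhoLPA.IsContrast ρ g) (hg : g ∈ RhoLPA.densityClass ρ c)
    (fhat : ∀ n, RhoLPA.Sample d n → ℝ)
    (hfhat : ∀ n, RhoLPA.IsLPAEstimator (RhoLPA.strictFloor β) M ρ K x₀
      (RhoLPA.bandwidth d β L n) (fhat n)) {r : ℝ} (hr : 0 < r) :
    RhoLPA.UpperBound β L M g x₀ r (RhoLPA.rate d β) fhat ∧
    (RhoLPA.KullbackCondition g → RhoLPA.IsMinimax β L M g x₀ r (RhoLPA.rate d β) fhat) := by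
  have hupper := RhoLPA.upperBound_rate hβ hL hM hc hx₀ hK hKx₀ hρ hg hfhat hr
  exact ⟨hupper, fun hkl => RhoLPA.isMinimax_of_upperBound hβ hL hM hg.1 hkl hr.le
    (fun n => (hfhat n).1) hupper⟩

theorem theorem1 (d : ℕ) (hd : 0 < d) (β L M c : ℝ) (hβ : 0 < β) (hL : 0 < L) (hM : 0 < M)
    (hc : 0 < c) (x₀ : Fin d → ℝ) (hx₀ : x₀ ∈ RhoLPA.cube d)
    (K : (Fin d → ℝ) → ℝ) (hK : RhoLPA.IsKernel K)
    (hKx₀ : 0 < ∫ z in RhoLPA.inwardDirections x₀, K z)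
    (ρ : ℝ → ℝ) (g : ℕ → ℝ → ℝ) (hρ : RhoLPA.IsContrast ρ g) (hg : g ∈ RhoLPA.densityClass ρ c)
    (fhat : ∀ n, RhoLPA.Sample d n → ℝ)
    (hfhat : ∀ n, RhoLPA.IsLPAEstimator (RhoLPA.strictFloor β) M ρ K x₀
      (RhoLPA.bandwidth d β L n) (fhat n)) :
    (∀ r : ℝ, 1 ≤ r → RhoLPA.UpperBound β L M g x₀ r (RhoLPA.rate d β) fhat) ∧
    (RhoLPA.KullbackCondition g →
      ∀ r : ℝ, 1 ≤ r → RhoLPA.IsMinimax β L M g x₀ r (RhoLPA.rate d β) fhat) := by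
  have hgeneral {r : ℝ} (hr : 1 ≤ r) := theorem1_general d β L M c hβ hL hM hc x₀ hx₀ K hK hKx₀ ρ g
    hρ hg fhat hfhat (zero_lt_one.trans_le hr)
  exact ⟨fun r hr => (hgeneral hr).1, fun hkl r hr => (hgeneral hr).2 hkl⟩
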